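/- Fix $n$ and work over $\mathbb C$. Let $w_1,\dots,w_n$ be the standard basis of $W=\mathbb C^n$. Pairs $(i,j)$ always satisfy $1\le i\le j\le n-1$; they label the positive roots $\alpha_{i,j}$ of $\mathfrak{sl}_n$, and $\alpha_{i,j}\le\alpha_{a,b}$ means $a\le i\le j\le b$. Let $\mathfrak b\subset\mathfrak{sl}_n$ be the upper triangular Borel subalgebra, and let $(\mathfrak n^-)^a$ be the abelian Lie algebra with basis $f_{a,b}=f_{\alpha_{a,b}}$ (the class of the matrix unit $w_a\mapsto w_{b+1}$ in $\mathfrak{sl}_n/\mathfrak b$), so that $S(\mathfrak n^-)=\mathbb C[f_{a,b}]$, on which $\mathfrak b$ acts by derivations via the adjoint action $\circ$ on $\mathfrak{sl}_n/\mathfrak b$. **The variety and its ring.** Let $W_{i,j}=\mathrm{span}(w_1,\dots,w_i,w_{j+1},\dots,w_n)$, and let $pr_k$ be the projection of $W$ that kills $w_k$ and fixes the other $w_l$. Let $R_n$ be the variety of collections $(V_{i,j})$ of subspaces of $W$ with $\dim V_{i,j}=i$, $V_{i,j}\subset W_{i,j}$, $V_{i,j}\subset V_{i+1,j}$ for $i<j$,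 and $pr_{j+1}V_{i,j}\subset V_{i,j+1}$ for $j<n-1$, embedded by $V_{i,j}\mapsto\Lambda^iV_{i,j}$ into $\prod_{i\le j}\mathbb P(\Lambda^iW_{i,j})$. Let $X^{(i,j)}_L$, for $L=(l_1<\dots<l_i)\subset\{1,\dots,i,j+1,\dots,n\}$, be the coordinates on $\Lambda^iW_{i,j}$ dual to $w_{l_1}\wedge\dots\wedge w_{l_i}$, extended to all sequences of indices from $\{1,\dots,i,j+1,\dots,n\}$ by antisymmetry (zero if an index repeats). Let $\mathbb C\mathbf X_n$ be the polynomial ring in all $X^{(i,j)}_L$, let $I(R_n)$ be the ideal generated by the multi-homogeneous polynomials vanishing on $R_n$, let $Q_n=\mathbb C\mathbf X_n/I(R_n)$, and, for $\mathbf m=(m_{i,j})$ with $m_{i,j}\in\mathbb Z_{\ge0}$, let $Q_{\mathbf m}\subset Q_n$ be the image of the polynomials of total degree $m_{i,j}$ in the variables $X^{(i,j)}_L$, for all $(i,j)$. Let $f_{a,b}$ act on $\mathbb C\mathbf X_n$ as the derivation with $f_{a,b}X^{(i,j)}_L=-X^{(i,j)}_{l_1,\dots,l_{r-1},a,l_{r+1},\dots,l_i}$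 if $a\le i\le j\le b$ and $l_r=b+1$ for some $r$, and $f_{a,b}X_L^{(i,j)}=0$ otherwise. **The modules.** Let $M_\alpha=S(\mathfrak n^-)/I_\alpha$, where $I_\alpha$ is the ideal generated by $U(\mathfrak b)\circ\langle f_\beta^2,\ \beta\ge\alpha;\ f_\beta,\ \beta\not\ge\alpha\rangle$, and let $v_\alpha$ be the image of $1$. Let $v_{\mathbf m}=\bigotimes v_{\alpha_{i,j}}^{\otimes m_{i,j}}$ and $M_{\mathbf m}=S(\mathfrak n^-)\cdot v_{\mathbf m}\subset\bigotimes_{i\le j}M_{\alpha_{i,j}}^{\otimes m_{i,j}}$. Dual spaces carry the dual action $(f\varphi)(x)=-\varphi(fx)$. The product on $\bigoplus_{\mathbf m}M_{\mathbf m}^*$ is dual to the $(\mathfrak n^-)^a$-equivariant embeddings $M_{\mathbf m^1+\mathbf m^2}\subset M_{\mathbf m^1}\otimes M_{\mathbf m^2}$, $v_{\mathbf m^1+\mathbf m^2}\mapsto v_{\mathbf m^1}\otimes v_{\mathbf m^2}$. **Theorem.** The action of $(\mathfrak n^-)^a$ on $\mathbb C\mathbf X_n$ descends to $Q_n$. One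 has $Q_n=\bigoplus_{\mathbf m}Q_{\mathbf m}$, and each $Q_{\mathbf m}$ is $(\mathfrak n^-)^a$-stable. Each $Q_{\mathbf m}$ is cocyclic with cocyclic vector $v_{\mathbf m}^*=\prod_{i\le j}(X^{(i,j)}_{1,\dots,i})^{m_{i,j}}$: this vector is nonzero in $Q_{\mathbf m}$ and lies in $\mathbb C[f_{a,b}]_{a\le b}\,F$ for every nonzero $F\in Q_{\mathbf m}$. There are isomorphisms of $(\mathfrak n^-)^a$-modules $Q_{\mathbf m}^*\simeq M_{\mathbf m}$. Moreover there is an isomorphism of algebras and of $(\mathfrak n^-)^a$-modules $Q_n\simeq\bigoplus_{\mathbf m}M_{\mathbf m}^*$ that maps $Q_{\mathbf m}$ onto $M_{\mathbf m}^*$ for every $\mathbf m$. -/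

import Mathlib

open scoped TensorProduct DirectSum

noncomputable section

namespace DegenerateSL

/-! ### Positive roots of `sl_n`

The basis vectors `w_1, …, w_n` are indexed by `Fin n` (so `w_k` has index `k - 1`).  The root
`α_{i,j} = α_i + ⋯ + α_j`, `1 ≤ i ≤ j ≤ n - 1`, is the pair `(s, t)` with `s < t` in `Fin n`, where
`s = i - 1` is the index of `w_i` and `t = j` is the index of `w_{j+1}`.  Thus the operator
`f_{i,j}`, which sends `w_i` to `w_{j+1}`, is the matrix unit `E_{t,s}`. -/

/-- The set of positive roots of `sl_n`. -/
abbrev PosRoot (n : ℕ) : Type := {p : Fin n × Fin n // p.1 < p.2}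

variable {n : ℕ}

/-- The index of `w_i`, for the root `α_{i,j}`. -/
abbrev PosRoot.s (α : PosRoot n) : Fin n := α.1.1

/-- The index of `w_{j+1}`, for the root `α_{i,j}`. -/
abbrev PosRoot.t (α : PosRoot n) : Fin n := α.1.2

/-- The number `i`, for the root `α_{i,j}`. -/
abbrev PosRoot.rk (α : PosRoot n) : ℕ := (α.s : ℕ) + 1

/-- The root order: `α_{i,j} ≤ α_{k,l}` iff the difference is a sum of simple roots,
i.e. `k ≤ i` and `j ≤ l`. -/
def PosRoot.Below (α β : PosRoot n) : Prop := β.s ≤ α.s ∧ α.t ≤ β.t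

instance (α β : PosRoot n) : Decidable (α.Below β) := by
  unfold PosRoot.Below; infer_instance

/-- Membership in the index set `{1, …, i, j+1, …, n}`. -/
abbrev PosRoot.Allowed (α : PosRoot n) (k : Fin n) : Prop := k ≤ α.s ∨ α.t ≤ k

/-! ### The variety `R_n` inside the product of projective spaces -/

/-- The subspace `W_{i,j} = span (w_1, …, w_i, w_{j+1}, …, w_n)` of `W = ℂⁿ`. -/
def W (α : PosRoot n) : Submodule ℂ (Fin n → ℂ) :=
  Submodule.span ℂ {w | ∃ k, α.Allowed k ∧ w = Pi.single k 1}

/-- The projection of `W` along the `k`-th basis vector: it kills `w_k` and fixes the others. -/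
def pr (k : Fin n) : (Fin n → ℂ) →ₗ[ℂ] (Fin n → ℂ) :=
  LinearMap.id - LinearMap.single ℂ (fun _ : Fin n => ℂ) k ∘ₗ LinearMap.proj k

/-- The collections `(V_{i,j})` of subspaces of `W` which are the points of `R_n`. -/
structure IsRPoint (V : PosRoot n → Submodule ℂ (Fin n → ℂ)) : Prop where
  /-- `dim V_{i,j} = i`. -/
  finrank_eq : ∀ α, Module.finrank ℂ (V α) = α.rk
  /-- `V_{i,j} ⊆ W_{i,j}`. -/
  le_W : ∀ α, V α ≤ W α
  /-- `V_{i,j} ⊆ V_{i+1,j}` for `i < j`. -/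
  le_succ : ∀ α β : PosRoot n, (β.s : ℕ) = α.s + 1 → β.t = α.t → V α ≤ V β
  /-- `pr_{j+1} V_{i,j} ⊆ V_{i,j+1}` for `j < n - 1`. -/
  pr_le : ∀ α β : PosRoot n, β.s = α.s → (β.t : ℕ) = α.t + 1 → (V α).map (pr α.t) ≤ V β

/-- The exterior power `Λ^i W_{i,j}`. -/
abbrev ExtW (α : PosRoot n) : Type := ⋀[ℂ]^(α.rk) (W α)

/-- `R_n` as a subset of `∏_{i ≤ j} ℙ(Λ^i W_{i,j})`: the collection `(V_{i,j})` is sent to the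
collection of lines `Λ^i V_{i,j} ⊆ Λ^i W_{i,j}`. -/
def R (n : ℕ) : Set ((α : PosRoot n) → Projectivization ℂ (ExtW α)) :=
  {x | ∃ (V : PosRoot n → Submodule ℂ (Fin n → ℂ)) (hV : IsRPoint V), ∀ α,
    (x α).submodule =
      LinearMap.range (exteriorPower.map α.rk (Submodule.inclusion (hV.le_W α)))}

/-! ### The multi-homogeneous coordinate ring of `R_n` -/

/-- The sets `L ⊆ {1, …, i, j+1, …, n}` with `i` elements. -/
abbrev PlSet (α : PosRoot n) : Type :=
  {L : Finset (Fin n) // L.card = α.rk ∧ ∀ k ∈ L, α.Allowed k}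

/-- The increasing enumeration `l_1 < ⋯ < l_i` of `L`. -/
def PlSet.seq {α : PosRoot n} (L : PlSet α) : Fin α.rk → Fin n :=
  fun a => L.1.orderEmbOfFin L.2.1 a

/-- The indices of the variables `X_L^{(i,j)}`. -/
abbrev PlIdx (n : ℕ) : Type := (α : PosRoot n) × PlSet α

/-- The linear coordinate on `Λ^i W_{i,j}` that takes `u_1 ∧ ⋯ ∧ u_i` to the minor
`det ((u_a)_{l_b})`; so it is `1` on `w_L` and `0` on the other basis vectors `w_P`. -/
def plCoord {α : PosRoot n} (L : PlSet α) : ExtW α →ₗ[ℂ] ℂ :=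
  exteriorPower.alternatingMapLinearEquiv
    ((Matrix.detRowAlternating (R := ℂ) (n := Fin α.rk)).compLinearMap
      ((LinearMap.funLeft ℂ ℂ L.seq) ∘ₗ (W α).subtype))

/-- The ring `ℂ𝐗_n` of polynomials in the variables `X_L^{(i,j)}`. -/
abbrev CX (n : ℕ) : Type := MvPolynomial (PlIdx n) ℂ

/-- The multi-degree of a variable: `X_L^{(i,j)}` has degree `1` in the group `(i,j)` and degree
`0` in the other groups. -/
def varDeg (k : PlIdx n) : PosRoot n → ℕ := Pi.single k.1 1

/-- The space `ℂ𝐗_𝐦` of polynomials of total degree `m_{i,j}` in the variables `X_L^{(i,j)}`. -/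
def CXpiece (m : PosRoot n → ℕ) : Submodule ℂ (CX n) :=
  MvPolynomial.weightedHomogeneousSubmodule ℂ varDeg m

/-- `F` vanishes at a point of the product of projective spaces: its value is zero at all
homogeneous coordinates of the point. -/
def VanishesAt (F : CX n) (x : (α : PosRoot n) → Projectivization ℂ (ExtW α)) : Prop :=
  ∀ (u : (α : PosRoot n) → ExtW α) (hu : ∀ α, u α ≠ 0),
    (∀ α, Projectivization.mk ℂ (u α) (hu α) = x α) →
    MvPolynomial.eval (fun k : PlIdx n => plCoord k.2 (u k.1)) F = 0

/-- The ideal `I(R_n)`, generated by the multi-homogeneous polynomials vanishing on `R_n`. -/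
def vanishingIdeal (n : ℕ) : Ideal (CX n) :=
  Ideal.span {F | (∃ m, F ∈ CXpiece m) ∧ ∀ x ∈ R n, VanishesAt F x}

/-- The multi-homogeneous coordinate ring `Q_n = ℂ𝐗_n / I(R_n)`. -/
abbrev Q (n : ℕ) : Type := CX n ⧸ vanishingIdeal n

/-- The projection `ℂ𝐗_n → Q_n`. -/
def toQ (n : ℕ) : CX n →ₐ[ℂ] Q n := Ideal.Quotient.mkₐ ℂ (vanishingIdeal n)

/-- The multi-homogeneous component `Q_𝐦`, the image of `ℂ𝐗_𝐦`. -/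
def Qpiece (m : PosRoot n → ℕ) : Submodule ℂ (Q n) := (CXpiece m).map (toQ n).toLinearMap

/-- The set `{1, …, i}`. -/
def topSet (α : PosRoot n) : PlSet α :=
  ⟨Finset.Iic α.s, by simp, fun k hk => Or.inl (Finset.mem_Iic.1 hk)⟩

/-- The vector `v_𝐦^* = ∏ (X_{1,…,i}^{(i,j)})^{m_{i,j}}` of `Q_𝐦`. -/
def vStar (m : PosRoot n → ℕ) : Q n :=
  toQ n (∏ α, (MvPolynomial.X ⟨α, topSet α⟩) ^ m α)

/-! ### The action of the abelian Lie algebra `(𝔫⁻)^a` on `ℂ𝐗_n` -/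

/-- The element `X_{l_1,…,l_i}^{(i,j)}` for an arbitrary sequence of indices: the usual variable
for an increasing sequence in `{1, …, i, j+1, …, n}`, antisymmetric under permutations, zero if
there is a repetition or an index outside of `{1, …, i, j+1, …, n}`.  (At most one of the
determinants below is nonzero, and it is the sign of the sorting permutation.) -/
def Xseq (α : PosRoot n) (l : Fin α.rk → Fin n) : CX n :=
  ∑ P : PlSet α, MvPolynomial.C
    (Matrix.of fun a b => if l a = P.seq b then (1 : ℂ) else 0).det * MvPolynomial.X ⟨α, P⟩

/-- The action of `f_{a,b}` on `ℂ𝐗_n`: the derivation with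
`f_{a,b} X_L^{(i,j)} = - X_{l_1,…,l_{r-1},a,l_{r+1},…,l_i}^{(i,j)}` if `a ≤ i ≤ j ≤ b` and
`l_r = b + 1`, and `f_{a,b} X_L^{(i,j)} = 0` if there is no such `r`.
The root `β` is `α_{a,b}`. -/
def actCX (β : PosRoot n) : Derivation ℂ (CX n) (CX n) :=
  MvPolynomial.mkDerivation ℂ fun k : PlIdx n =>
    if k.1.Below β then
      - ∑ r : Fin k.1.rk,
          if k.2.seq r = β.t then Xseq k.1 (Function.update k.2.seq r β.s) else 0
    else 0

/-! ### The modules `M_α` -/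

/-- The symmetric algebra `S(𝔫⁻) = ℂ[f_β]_{β > 0}`. -/
abbrev Sn (n : ℕ) : Type := MvPolynomial (PosRoot n) ℂ

/-- The matrix `f_β = E_{t,s}`. -/
def fMat (β : PosRoot n) : Matrix (Fin n) (Fin n) ℂ := Matrix.single β.t β.s 1

/-- The Borel subalgebra `𝔟` of `sl_n`: upper triangular matrices of trace zero. -/
def IsBorel (x : Matrix (Fin n) (Fin n) ℂ) : Prop :=
  (∀ p q, q < p → x p q = 0) ∧ x.trace = 0

/-- The adjoint action of `x ∈ 𝔟` on `S(𝔫⁻) = S(𝔤/𝔟)`: the derivation that sends `f_β` to the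
class of `[x, f_β]` modulo `𝔟`. -/
def adAct (x : Matrix (Fin n) (Fin n) ℂ) : Derivation ℂ (Sn n) (Sn n) :=
  MvPolynomial.mkDerivation ℂ fun β =>
    ∑ γ : PosRoot n, MvPolynomial.C (⁅x, fMat β⁆ γ.t γ.s) * MvPolynomial.X γ

/-- The image of `U(𝔟)` in the endomorphisms of `S(𝔫⁻)`. -/
def UBorel (n : ℕ) : Subalgebra ℂ (Module.End ℂ (Sn n)) :=
  Algebra.adjoin ℂ {T | ∃ x, IsBorel x ∧ T = (adAct x).toLinearMap}

/-- The elements `f_β^2`, `β ≥ α`, and `f_β`, `β ≱ α`. -/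
def gens (α : PosRoot n) : Set (Sn n) :=
  {q | (∃ β, α.Below β ∧ q = MvPolynomial.X β ^ 2) ∨ ∃ β, ¬ α.Below β ∧ q = MvPolynomial.X β}

/-- The ideal `I_α`, generated by `U(𝔟) ∘ ⟨f_β^2, β ≥ α; f_β, β ≱ α⟩`. -/
def annIdeal (α : PosRoot n) : Ideal (Sn n) :=
  Ideal.span {q | ∃ T ∈ UBorel n, ∃ p ∈ gens α, q = T p}

/-- The module `M_α = S(𝔫⁻) / I_α`. -/
def Mroot (α : PosRoot n) : Type := Sn n ⧸ annIdeal α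

instance (α : PosRoot n) : AddCommGroup (Mroot α) :=
  inferInstanceAs (AddCommGroup (Sn n ⧸ annIdeal α))

instance (α : PosRoot n) : Module (Sn n) (Mroot α) :=
  inferInstanceAs (Module (Sn n) (Sn n ⧸ annIdeal α))

instance (α : PosRoot n) : Module ℂ (Mroot α) :=
  inferInstanceAs (Module ℂ (Sn n ⧸ annIdeal α))

instance (α : PosRoot n) : IsScalarTower ℂ (Sn n) (Mroot α) :=
  inferInstanceAs (IsScalarTower ℂ (Sn n) (Sn n ⧸ annIdeal α))

instance (α : PosRoot n) : SMulCommClass (Sn n) ℂ (Mroot α) :=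
  inferInstanceAs (SMulCommClass (Sn n) ℂ (Sn n ⧸ annIdeal α))

/-- The highest weight vector `v_α`, the image of `1`. -/
def vRoot (α : PosRoot n) : Mroot α := Ideal.Quotient.mk (annIdeal α) 1

/-- The action of `f_β` on `M_α`. -/
def fRoot (α β : PosRoot n) : Module.End ℂ (Mroot α) where
  toFun v := (MvPolynomial.X β : Sn n) • v
  map_add' := smul_add _
  map_smul' c v := smul_comm _ c v

/-! ### The modules `M_𝐦` -/

/-- The tensor factors of `⨂ M_{α_{i,j}}^{⊗ m_{i,j}}`: there are `m_α` of them for each `α`. -/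
abbrev Fac (m : PosRoot n → ℕ) : Type := (α : PosRoot n) × Fin (m α)

/-- The tensor product `⨂ M_{α_{i,j}}^{⊗ m_{i,j}}`. -/
abbrev Tens (m : PosRoot n → ℕ) : Type := ⨂[ℂ] k : Fac m, Mroot k.1

/-- The action of `f_β` on the tensor product, `∑ 1 ⊗ ⋯ ⊗ f_β ⊗ ⋯ ⊗ 1`. -/
def fTens (m : PosRoot n → ℕ) (β : PosRoot n) : Module.End ℂ (Tens m) :=
  ∑ k : Fac m, PiTensorProduct.map fun k' : Fac m =>
    if k' = k then fRoot k'.1 β else LinearMap.id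

/-- The vector `v_𝐦 = ⨂ v_{α_{i,j}}^{⊗ m_{i,j}}`. -/
def vTens (m : PosRoot n → ℕ) : Tens m := PiTensorProduct.tprod ℂ fun k : Fac m => vRoot k.1

/-- The image of `S(𝔫⁻)` in the endomorphisms of the tensor product. -/
def STens (m : PosRoot n → ℕ) : Subalgebra ℂ (Module.End ℂ (Tens m)) :=
  Algebra.adjoin ℂ (Set.range (fTens m))

/-- The cyclic submodule `M_𝐦 = S(𝔫⁻) · v_𝐦` of the tensor product. -/
def M (m : PosRoot n → ℕ) : Submodule ℂ (Tens m) :=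
  (Subalgebra.toSubmodule (STens m)).map (LinearMap.applyₗ (vTens m))

theorem vTens_mem (m : PosRoot n → ℕ) : vTens m ∈ M m :=
  ⟨1, (STens m).one_mem, rfl⟩

theorem fTens_mem (m : PosRoot n → ℕ) (β : PosRoot n) : ∀ x ∈ M m, fTens m β x ∈ M m := by
  rintro _ ⟨T, hT, rfl⟩
  exact ⟨fTens m β * T, (STens m).mul_mem (Algebra.subset_adjoin ⟨β, rfl⟩) hT, rfl⟩

/-- `M_𝐦` is contained in every subspace that contains `v_𝐦` and is stable under all `f_β`. -/
theorem M_le {m : PosRoot n → ℕ} {N : Submodule ℂ (Tens m)} (hv : vTens m ∈ N)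
    (hf : ∀ β, ∀ x ∈ N, fTens m β x ∈ N) : M m ≤ N := by
  rintro _ ⟨T, hT, rfl⟩
  change T (vTens m) ∈ N
  have key : ∀ x ∈ N, T x ∈ N := by
    refine Algebra.adjoin_induction (p := fun T _ => ∀ x ∈ N, T x ∈ N) ?_ ?_ ?_ ?_ hT
    · rintro _ ⟨β, rfl⟩; exact hf β
    · intro c x hx; exact N.smul_mem c hx
    · intro S T _ _ hS hT x hx; exact N.add_mem (hS x hx) (hT x hx)
    · intro S T _ _ hS hT x hx; exact hS _ (hT x hx)
  exact key _ hv

/-- The highest weight vector `v_𝐦` of `M_𝐦`. -/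
def vM (m : PosRoot n → ℕ) : M m := ⟨vTens m, vTens_mem m⟩

/-- The action of `f_β` on `M_𝐦`. -/
def fM (m : PosRoot n → ℕ) (β : PosRoot n) : Module.End ℂ (M m) :=
  (fTens m β).restrict (fTens_mem m β)

/-- The dual space `M_𝐦^*`. -/
abbrev MDual (m : PosRoot n → ℕ) : Type := Module.Dual ℂ (M m)

/-- The action of `f_β` on the dual space: `(f_β φ)(x) = - φ(f_β x)`. -/
def fMDual (m : PosRoot n → ℕ) (β : PosRoot n) : Module.End ℂ (MDual m) :=
  - (fM m β).dualMap

/-! ### The embeddings `M_{𝐦¹+𝐦²} ⊂ M_{𝐦¹} ⊗ M_{𝐦²}` and the algebra `⨁ M_𝐦^*` -/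

/-- The first `m_α` of the `m_α + m'_α` tensor factors for `α`. -/
abbrev facL (m m' : PosRoot n → ℕ) (k : Fac m) : Fac (m + m') := ⟨k.1, Fin.castAdd (m' k.1) k.2⟩

/-- The last `m'_α` of the `m_α + m'_α` tensor factors for `α`. -/
abbrev facR (m m' : PosRoot n → ℕ) (k : Fac m') : Fac (m + m') := ⟨k.1, Fin.natAdd (m k.1) k.2⟩

theorem facL_injective (m m' : PosRoot n → ℕ) : Function.Injective (facL m m') := by
  rintro ⟨α, a⟩ ⟨β, b⟩ h
  obtain ⟨rfl, h2⟩ := Sigma.mk.inj_iff.1 h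
  rw [heq_eq_eq, Fin.castAdd_inj] at h2
  exact congrArg (Sigma.mk α) h2

theorem facR_injective (m m' : PosRoot n → ℕ) : Function.Injective (facR m m') := by
  rintro ⟨α, a⟩ ⟨β, b⟩ h
  obtain ⟨rfl, h2⟩ := Sigma.mk.inj_iff.1 h
  rw [heq_eq_eq, Fin.natAdd_inj] at h2
  exact congrArg (Sigma.mk α) h2

theorem facL_ne_facR (m m' : PosRoot n → ℕ) (k : Fac m) (k' : Fac m') :
    facL m m' k ≠ facR m m' k' := by
  obtain ⟨α, a⟩ := k
  obtain ⟨β, b⟩ := k'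
  intro h
  obtain ⟨rfl, h2⟩ := Sigma.mk.inj_iff.1 h
  have h3 := congrArg Fin.val (eq_of_heq h2)
  simp only [Fin.val_castAdd, Fin.val_natAdd] at h3
  have := a.2
  omega

theorem fac_cases (m m' : PosRoot n → ℕ) (k : Fac (m + m')) :
    (∃ j, k = facL m m' j) ∨ ∃ j, k = facR m m' j := by
  obtain ⟨α, a⟩ := k
  refine Fin.addCases (m := m α) (n := m' α)
    (motive := fun a => (∃ j, (⟨α, a⟩ : Fac (m + m')) = facL m m' j) ∨ ∃ j, ⟨α, a⟩ = facR m m' j)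
    (fun i => Or.inl ⟨⟨α, i⟩, rfl⟩) (fun i => Or.inr ⟨⟨α, i⟩, rfl⟩) a

theorem update_facL_facL (m m' : PosRoot n → ℕ) (x : (k : Fac (m + m')) → Mroot k.1) (j : Fac m)
    (v : Mroot j.1) :
    (fun k : Fac m => Function.update x (facL m m' j) v (facL m m' k)) =
      Function.update (fun k : Fac m => x (facL m m' k)) j v := by
  funext k
  by_cases h : k = j
  · subst h; simp
  · rw [Function.update_of_ne h, Function.update_of_ne ((facL_injective m m').ne h)]

theorem update_facR_facR (m m' : PosRoot n → ℕ) (x : (k : Fac (m + m')) → Mroot k.1) (j : Fac m')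
    (v : Mroot j.1) :
    (fun k : Fac m' => Function.update x (facR m m' j) v (facR m m' k)) =
      Function.update (fun k : Fac m' => x (facR m m' k)) j v := by
  funext k
  by_cases h : k = j
  · subst h; simp
  · rw [Function.update_of_ne h, Function.update_of_ne ((facR_injective m m').ne h)]

theorem update_facL_facR (m m' : PosRoot n → ℕ) (x : (k : Fac (m + m')) → Mroot k.1) (j : Fac m)
    (v : Mroot j.1) :
    (fun k : Fac m' => Function.update x (facL m m' j) v (facR m m' k)) =
      fun k : Fac m' => x (facR m m' k) := by
  funext k
  rw [Function.update_of_ne (facL_ne_facR m m' j k).symm]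

theorem update_facR_facL (m m' : PosRoot n → ℕ) (x : (k : Fac (m + m')) → Mroot k.1) (j : Fac m')
    (v : Mroot j.1) :
    (fun k : Fac m => Function.update x (facR m m' j) v (facL m m' k)) =
      fun k : Fac m => x (facL m m' k) := by
  funext k
  rw [Function.update_of_ne (facL_ne_facR m m' k j)]

/-- The identification of the tensor product for `𝐦¹ + 𝐦²` with the product of those for `𝐦¹` and
`𝐦²`, by a rearrangement of the tensor factors. -/
def rearr (m m' : PosRoot n → ℕ) : Tens (m + m') →ₗ[ℂ] Tens m ⊗[ℂ] Tens m' :=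
  PiTensorProduct.lift <| MultilinearMap.mk'
    (fun x => (PiTensorProduct.tprod ℂ fun k : Fac m => x (facL m m' k)) ⊗ₜ[ℂ]
      (PiTensorProduct.tprod ℂ fun k : Fac m' => x (facR m m' k)))
    (by
      intro x k v w
      obtain ⟨j, rfl⟩ | ⟨j, rfl⟩ := fac_cases m m' k
      · simp only [update_facL_facL, update_facL_facR, MultilinearMap.map_update_add,
          TensorProduct.add_tmul]
      · simp only [update_facR_facR, update_facR_facL, MultilinearMap.map_update_add,
          TensorProduct.tmul_add])
    (by
      intro x k c v
      obtain ⟨j, rfl⟩ | ⟨j, rfl⟩ := fac_cases m m' k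
      · simp only [update_facL_facL, update_facL_facR, MultilinearMap.map_update_smul,
          TensorProduct.smul_tmul']
      · simp only [update_facR_facR, update_facR_facL, MultilinearMap.map_update_smul,
          TensorProduct.tmul_smul])

theorem rearr_tprod (m m' : PosRoot n → ℕ) (x : (k : Fac (m + m')) → Mroot k.1) :
    rearr m m' (PiTensorProduct.tprod ℂ x) =
      (PiTensorProduct.tprod ℂ fun k : Fac m => x (facL m m' k)) ⊗ₜ[ℂ]
      (PiTensorProduct.tprod ℂ fun k : Fac m' => x (facR m m' k)) :=
  PiTensorProduct.lift.tprod _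

theorem rearr_vTens (m m' : PosRoot n → ℕ) :
    rearr m m' (vTens (m + m')) = vTens m ⊗ₜ[ℂ] vTens m' :=
  rearr_tprod m m' _

theorem sum_fac (m m' : PosRoot n → ℕ) {A : Type*} [AddCommMonoid A] (g : Fac (m + m') → A) :
    ∑ k, g k = ∑ k, g (facL m m' k) + ∑ k, g (facR m m' k) := by
  rw [Fintype.sum_sigma, Fintype.sum_sigma, Fintype.sum_sigma, ← Finset.sum_add_distrib]
  exact Finset.sum_congr rfl fun α _ => Fin.sum_univ_add (a := m α) (b := m' α) _

theorem rearr_fTens (m m' : PosRoot n → ℕ) (β : PosRoot n) (x : Tens (m + m')) :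
    rearr m m' (fTens (m + m') β x) =
      TensorProduct.map (fTens m β) LinearMap.id (rearr m m' x) +
        TensorProduct.map LinearMap.id (fTens m' β) (rearr m m' x) := by
  have : rearr m m' ∘ₗ fTens (m + m') β =
      (TensorProduct.map (fTens m β) LinearMap.id +
        TensorProduct.map LinearMap.id (fTens m' β)) ∘ₗ rearr m m' := by
    ext x
    simp only [LinearMap.compMultilinearMap_apply, LinearMap.comp_apply,
      fTens, LinearMap.sum_apply, PiTensorProduct.map_tprod, map_add, map_sum, rearr_tprod,
      LinearMap.add_apply, TensorProduct.map_tmul, LinearMap.id_apply, TensorProduct.sum_tmul,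
      TensorProduct.tmul_sum, sum_fac m m', (facL_injective m m').eq_iff,
      (facR_injective m m').eq_iff, facL_ne_facR, (facL_ne_facR m m' _ _).symm, if_false]
  exact LinearMap.congr_fun this x

/-- The inclusion `M_{𝐦¹} ⊗ M_{𝐦²} ⊂ (⨂ M_α^{⊗ m¹_α}) ⊗ (⨂ M_α^{⊗ m²_α})`. -/
def inclM (m m' : PosRoot n → ℕ) : M m ⊗[ℂ] M m' →ₗ[ℂ] Tens m ⊗[ℂ] Tens m' :=
  TensorProduct.map (M m).subtype (M m').subtype

theorem inclM_injective (m m' : PosRoot n → ℕ) : Function.Injective (inclM m m') :=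
  TensorProduct.map_injective_of_flat_flat _ _ (M m).injective_subtype (M m').injective_subtype

theorem inclM_left (m m' : PosRoot n → ℕ) (β : PosRoot n) (y : M m ⊗[ℂ] M m') :
    inclM m m' (TensorProduct.map (fM m β) LinearMap.id y) =
      TensorProduct.map (fTens m β) LinearMap.id (inclM m m' y) := by
  induction y with
  | zero => simp
  | tmul a b => rfl
  | add a b ha hb => simp only [map_add, ha, hb]

theorem inclM_right (m m' : PosRoot n → ℕ) (β : PosRoot n) (y : M m ⊗[ℂ] M m') :
    inclM m m' (TensorProduct.map LinearMap.id (fM m' β) y) =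
      TensorProduct.map LinearMap.id (fTens m' β) (inclM m m' y) := by
  induction y with
  | zero => simp
  | tmul a b => rfl
  | add a b ha hb => simp only [map_add, ha, hb]

theorem rearr_mem (m m' : PosRoot n → ℕ) (x : M (m + m')) :
    rearr m m' x ∈ LinearMap.range (inclM m m') := by
  have h : M (m + m') ≤ (LinearMap.range (inclM m m')).comap (rearr m m') := by
    refine M_le ⟨vM m ⊗ₜ vM m', (rearr_vTens m m').symm⟩ ?_
    rintro β x ⟨y, hy⟩
    refine ⟨TensorProduct.map (fM m β) LinearMap.id y +
      TensorProduct.map LinearMap.id (fM m' β) y, ?_⟩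
    rw [rearr_fTens, ← hy, map_add, inclM_left, inclM_right]
  exact h x.2

/-- The embedding `M_{𝐦¹+𝐦²} ⊂ M_{𝐦¹} ⊗ M_{𝐦²}`: it is the rearrangement of the tensor factors. -/
def emb (m m' : PosRoot n → ℕ) : M (m + m') →ₗ[ℂ] M m ⊗[ℂ] M m' :=
  (LinearEquiv.ofInjective (inclM m m') (inclM_injective m m')).symm.toLinearMap ∘ₗ
    (rearr m m' ∘ₗ (M (m + m')).subtype).codRestrict _ (rearr_mem m m')

theorem inclM_emb (m m' : PosRoot n → ℕ) (x : M (m + m')) :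
    inclM m m' (emb m m' x) = rearr m m' x := by
  have := LinearEquiv.apply_symm_apply (LinearEquiv.ofInjective (inclM m m') (inclM_injective m m'))
    ⟨_, rearr_mem m m' x⟩
  exact congrArg Subtype.val this

/-- The embedding sends `v_{𝐦¹+𝐦²}` to `v_{𝐦¹} ⊗ v_{𝐦²}`. -/
theorem emb_vM (m m' : PosRoot n → ℕ) : emb m m' (vM (m + m')) = vM m ⊗ₜ[ℂ] vM m' :=
  inclM_injective m m' ((inclM_emb m m' _).trans (rearr_vTens m m'))

/-- The embedding is equivariant. -/
theorem emb_fM (m m' : PosRoot n → ℕ) (β : PosRoot n) (x : M (m + m')) :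
    emb m m' (fM (m + m') β x) = TensorProduct.map (fM m β) LinearMap.id (emb m m' x) +
      TensorProduct.map LinearMap.id (fM m' β) (emb m m' x) := by
  apply inclM_injective m m'
  rw [map_add, inclM_left, inclM_right, inclM_emb, inclM_emb]
  exact rearr_fTens m m' β x

/-- The product `M_{𝐦¹}^* × M_{𝐦²}^* → M_{𝐦¹+𝐦²}^*`, dual to the embedding. -/
def dualMul {m m' : PosRoot n → ℕ} (φ : MDual m) (ψ : MDual m') : MDual (m + m') :=
  TensorProduct.dualDistrib ℂ (M m) (M m') (φ ⊗ₜ ψ) ∘ₗ emb m m'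

instance : DirectSum.GNonUnitalNonAssocSemiring (MDual (n := n)) where
  mul φ ψ := dualMul φ ψ
  mul_zero φ := by simp [dualMul]
  zero_mul ψ := by simp [dualMul]
  mul_add φ ψ χ := by simp [dualMul, TensorProduct.tmul_add, LinearMap.add_comp]
  add_mul φ ψ χ := by simp [dualMul, TensorProduct.add_tmul, LinearMap.add_comp]

/-- The algebra `⨁ M_𝐦^*`. -/
abbrev DualAlg (n : ℕ) : Type := ⨁ m : PosRoot n → ℕ, MDual m

/-- The action of `f_β` on `⨁ M_𝐦^*`. -/
def fDualAlg (β : PosRoot n) : Module.End ℂ (DualAlg n) :=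
  DirectSum.lmap fun m => fMDual m β

end DegenerateSL

end

noncomputable section

namespace DegenerateSL

open MvPolynomial

variable {n : ℕ}

/-! ### Functionals on cyclic modules and polynomials -/

section Words

variable {N : Type*} [AddCommMonoid N] [Module ℂ N]

/-! Both sides are realized as the same spaces of polynomials on the open cell of `R_n`.

The group `exp (𝔫⁻)^a` acts on the base point `V_{i,j} = span(w_1, …, w_i)`. Its orbit is the set of
collections whose `(i,j)` member is spanned by the rows `w_k + ∑_{l > j} x_{k,l} w_l` with
coordinates `x` common to all `(i,j)`. On it the Plücker coordinates become minors (`cellMinor`),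
and `f_β` becomes `-∂_β` (`toCell_actCX`). The orbit lies in `R_n` (`mk_cellVec_mem_R`) and is dense
for multi-homogeneous polynomials (`vanishesAt_of_toCell_eq_zero`), so `Q_𝐦` is the space of
restrictions to the cell of polynomials of degree `𝐦`.

On the other side, a functional `φ` on a cyclic module with generator `v` is determined by the
polynomial `φ (exp (∑ x_β f_β) v)`; this is the relation `Rep`, and it turns `φ ∘ f_β` into `∂_β`.
For `M_α` these polynomials are the span of the minors. Indeed `I_α` is generated by variables and
2×2 permanents, so that monomials in `M_α` are antisymmetric in rows and columns and `dim M_α` is at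
most the number of sets `L`, while the minors are killed by `I_α` as differential operators and are
linearly independent (`span_rootCoord`). Exponentials are group-like, so tensor products of
functionals give products of polynomials (`rep_tprod`, `rep_dualMul`). Hence `M_𝐦^*` yields the same
polynomials as `Q_𝐦` (`exists_rep`, `exists_dual`), compatibly with products.

The restriction to the cell forgets the multi-degree, so both algebras are embedded in `ℂ[x]` with a
formal grading monoid adjoined, where their images agree (`range_dualEmb`). Cocyclicity is then
elementary: a nonzero polynomial can be differentiated down to a nonzero constant, and the constant
`1` in degree `𝐦` is `v_𝐦^*`. -/

/-- The product of operators along a word of roots, applied to a vector. -/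
def wordAct (f : PosRoot n → Module.End ℂ N) (v : N) (l : List (PosRoot n)) : N :=
  l.foldr (fun β x => f β x) v

/-- The iterated partial derivative along a word of roots. -/
def wordDeriv (l : List (PosRoot n)) (g : Sn n) : Sn n :=
  l.foldl (fun g β => pderiv β g) g

@[simp] theorem wordAct_nil (f : PosRoot n → Module.End ℂ N) (v : N) : wordAct f v [] = v := rfl

@[simp] theorem wordAct_cons (f : PosRoot n → Module.End ℂ N) (v : N) (β : PosRoot n)
    (l : List (PosRoot n)) : wordAct f v (β :: l) = f β (wordAct f v l) := rfl

@[simp] theorem wordDeriv_nil (g : Sn n) : wordDeriv [] g = g := rfl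

@[simp] theorem wordDeriv_cons (β : PosRoot n) (l : List (PosRoot n)) (g : Sn n) :
    wordDeriv (β :: l) g = wordDeriv l (pderiv β g) := rfl

theorem wordDeriv_add (l : List (PosRoot n)) (g h : Sn n) :
    wordDeriv l (g + h) = wordDeriv l g + wordDeriv l h := by
  induction l generalizing g h with
  | nil => rfl
  | cons β l ih => simp [ih]

theorem wordDeriv_smul (l : List (PosRoot n)) (c : ℂ) (g : Sn n) :
    wordDeriv l (c • g) = c • wordDeriv l g := by
  induction l generalizing g with
  | nil => rfl
  | cons β l ih => simp [ih]

theorem wordDeriv_zero (l : List (PosRoot n)) : wordDeriv l (0 : Sn n) = 0 := by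
  simpa using wordDeriv_smul l 0 0

/-- A polynomial is determined by the values at the origin of its iterated derivatives. -/
theorem eq_zero_of_wordDeriv {g : Sn n}
    (h : ∀ l, constantCoeff (wordDeriv l g) = 0) : g = 0 := by
  ext ν
  rw [coeff_zero]
  induction hd : ν.degree generalizing ν g with
  | zero =>
    obtain rfl := (Finsupp.degree_eq_zero_iff ν).1 hd
    exact h []
  | succ d ih =>
    obtain ⟨β, hβ⟩ : ∃ β, ν β ≠ 0 := by
      by_contra! hc
      have : ν = 0 := Finsupp.ext hc
      simp [this] at hd
    obtain ⟨μ, rfl⟩ : ∃ μ, ν = μ + Finsupp.single β 1 :=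
      ⟨ν - Finsupp.single β 1, (tsub_add_cancel_of_le (by
        rw [Finsupp.single_le_iff]; omega)).symm⟩
    have h1 := ih (g := pderiv β g) (fun l => h (β :: l)) μ (by simpa using hd)
    -- The coefficient at `μ` of `∂_β g` is `μ β + 1` times that of `g` at `μ + e_β`; the factor is
    -- invertible in characteristic zero.
    rw [coeff_pderiv] at h1
    refine (mul_eq_zero.1 h1).resolve_right ?_
    exact Nat.cast_add_one_ne_zero _

/-- `g` represents the functional `φ` on the cyclic module generated by `v`: it is the polynomial
function `x ↦ φ (exp (∑ x_β f_β) v)`. -/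
def Rep (f : PosRoot n → Module.End ℂ N) (v : N) (φ : Module.Dual ℂ N) (g : Sn n) : Prop :=
  ∀ l, φ (wordAct f v l) = constantCoeff (wordDeriv l g)

variable {f : PosRoot n → Module.End ℂ N} {v : N}

theorem Rep.add {φ ψ : Module.Dual ℂ N} {g h : Sn n} (h1 : Rep f v φ g) (h2 : Rep f v ψ h) :
    Rep f v (φ + ψ) (g + h) := fun l => by
  rw [LinearMap.add_apply, h1 l, h2 l, wordDeriv_add, map_add]

theorem Rep.smul (c : ℂ) {φ : Module.Dual ℂ N} {g : Sn n} (h1 : Rep f v φ g) :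
    Rep f v (c • φ) (c • g) := fun l => by
  rw [LinearMap.smul_apply, h1 l, wordDeriv_smul, constantCoeff_smul]

theorem Rep.zero : Rep f v 0 0 := fun l => by
  rw [wordDeriv_zero]; simp

theorem Rep.sum {ι : Type*} (s : Finset ι) {φ : ι → Module.Dual ℂ N} {g : ι → Sn n}
    (h : ∀ i ∈ s, Rep f v (φ i) (g i)) : Rep f v (∑ i ∈ s, φ i) (∑ i ∈ s, g i) := by
  classical
  induction s using Finset.induction_on with
  | empty => exact Rep.zero
  | insert a s ha ih =>
    rw [Finset.sum_insert ha, Finset.sum_insert ha]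
    exact (h a (by simp)).add (ih fun i hi => h i (by simp [hi]))

theorem Rep.comp {φ : Module.Dual ℂ N} {g : Sn n} (h : Rep f v φ g) (β : PosRoot n) :
    Rep f v (φ ∘ₗ f β) (pderiv β g) := fun l => h (β :: l)

/-- The values on words are the Taylor coefficients at the origin up to factorials. With `Rep.ext`
this makes the passage from functionals to polynomials well defined, linear and injective on a
cyclic module. -/
theorem Rep.unique {φ : Module.Dual ℂ N} {g h : Sn n} (h1 : Rep f v φ g) (h2 : Rep f v φ h) :
    g = h := by
  refine sub_eq_zero.1 (eq_zero_of_wordDeriv fun l => ?_)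
  have := (h1.add (h2.smul (-1))) l
  simp only [neg_smul, one_smul, add_neg_cancel, LinearMap.zero_apply, ← sub_eq_add_neg] at this
  exact this.symm

theorem Rep.ext {φ ψ : Module.Dual ℂ N} {g : Sn n} (h1 : Rep f v φ g) (h2 : Rep f v ψ g)
    (hv : Submodule.span ℂ (Set.range (wordAct f v)) = ⊤) : φ = ψ := by
  refine LinearMap.ext_on hv ?_
  rintro _ ⟨l, rfl⟩
  rw [h1 l, h2 l]

end Words

/-! ### Derivatives of polynomials and of products -/

theorem totalDegree_pderiv_lt {g : Sn n} {β : PosRoot n} (h : pderiv β g ≠ 0) :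
    (pderiv β g).totalDegree < g.totalDegree := by
  obtain ⟨ν, hν, hd⟩ := Finset.exists_mem_eq_sup _ (support_nonempty.2 h)
    (fun ν : PosRoot n →₀ ℕ => ν.sum fun _ e => e)
  have h1 := mem_support_iff.1 hν
  rw [coeff_pderiv] at h1
  have h2 := le_totalDegree (mem_support_iff.2 (left_ne_zero_of_mul h1))
  rw [Finsupp.sum_add_index' (by simp) (by simp), Finsupp.sum_single_index rfl] at h2
  change (pderiv β g).support.sup _ < _
  rw [hd]
  omega

theorem eq_C_of_pderiv {g : Sn n} (h : ∀ β, pderiv β g = 0) : g = C (constantCoeff g) := by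
  refine sub_eq_zero.1 (eq_zero_of_wordDeriv fun l => ?_)
  cases l with
  | nil => simp
  | cons β l => rw [wordDeriv_cons, map_sub, h, pderiv_C, sub_zero, wordDeriv_zero, map_zero]

theorem pderiv_comm (β γ : PosRoot n) (g : Sn n) :
    pderiv β (pderiv γ g) = pderiv γ (pderiv β g) := by
  ext ν
  rw [coeff_pderiv, coeff_pderiv, coeff_pderiv, coeff_pderiv, add_right_comm]
  by_cases h : β = γ
  · subst h; ring
  · have h' : γ ≠ β := fun h' => h h'.symm
    simp [h, h']
    ring

theorem derivation_prod {A ι : Type*} [CommRing A] [Algebra ℂ A] (D : Derivation ℂ A A)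
    [DecidableEq ι] (s : Finset ι) (g : ι → A) :
    D (∏ k ∈ s, g k) = ∑ k ∈ s, ∏ j ∈ s, Function.update g k (D (g k)) j := by
  induction s using Finset.induction_on with
  | empty => simp
  | insert a s ha ih =>
    rw [Finset.prod_insert ha, D.leibniz, ih, Finset.sum_insert ha, Finset.prod_insert ha,
      Function.update_self, smul_eq_mul, smul_eq_mul, Finset.mul_sum, add_comm, mul_comm]
    congr 1
    · congr 1
      · exact Finset.prod_congr rfl fun j hj =>
          (Function.update_of_ne (fun h => ha (by rwa [← h])) _ _).symm
    · refine Finset.sum_congr rfl fun k hk => ?_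
      rw [Finset.prod_insert ha, Function.update_of_ne (fun h => ha (by rwa [h]))]

/-! ### Determinants -/

section Det

variable {ι A : Type*} [Fintype ι] [DecidableEq ι] [CommRing A]

theorem derivation_det_updateCol [Algebra ℂ A] (D : Derivation ℂ A A) (M : Matrix ι ι A) :
    D M.det = ∑ k, (M.updateCol k fun i => D (M i k)).det := by
  simp only [Matrix.det_apply, map_sum]
  rw [Finset.sum_comm]
  refine Finset.sum_congr rfl fun σ _ => ?_
  rw [Units.smul_def, map_zsmul, derivation_prod, Finset.smul_sum]
  refine Finset.sum_congr rfl fun k _ => ?_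
  rw [Units.smul_def]
  congr 1
  refine Finset.prod_congr rfl fun j _ => ?_
  by_cases h : j = k
  · subst h; simp
  · simp [h]

theorem derivation_det [Algebra ℂ A] (D : Derivation ℂ A A) (M : Matrix ι ι A) :
    D M.det = ∑ k, (M.updateRow k fun j => D (M k j)).det := by
  rw [← Matrix.det_transpose, derivation_det_updateCol]
  refine Finset.sum_congr rfl fun k _ => ?_
  rw [← Matrix.det_transpose, Matrix.updateCol_transpose, Matrix.transpose_transpose]
  rfl

/-- Laplace expansion along row `k`, with each cofactor written as a determinant in which a column
is replaced by `e_k`. In `Ymat` such a column is the one of an index `≤ i`, so the cofactors are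
again minors of `Ymat`. -/
theorem det_updateRow_eq_sum (M : Matrix ι ι A) (k : ι) (v : ι → A) :
    (M.updateRow k v).det = ∑ r, v r * (M.updateCol r (Pi.single k 1)).det := by
  rw [Matrix.det_eq_sum_mul_adjugate_row _ k]
  refine Finset.sum_congr rfl fun r _ => ?_
  rw [Matrix.updateRow_self, Matrix.adjugate_apply, Matrix.updateRow_idem, ← Matrix.adjugate_apply,
    ← Matrix.transpose_apply (Matrix.adjugate M), Matrix.adjugate_transpose, Matrix.adjugate_apply,
    ← Matrix.det_transpose, Matrix.updateRow_transpose, Matrix.transpose_transpose]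

end Det

/-! ### The minors on the open cell -/

/-- The index in `Fin n` of a row. -/
def rowIdx (α : PosRoot n) (k : Fin α.rk) : Fin n := ⟨k, k.2.trans_le (Nat.succ_le_of_lt α.s.2)⟩

theorem rowIdx_injective (α : PosRoot n) : Function.Injective (rowIdx α) := fun _ _ h =>
  Fin.ext (Fin.mk.inj_iff.1 h)

theorem rowIdx_le (α : PosRoot n) (k : Fin α.rk) : rowIdx α k ≤ α.s :=
  Fin.le_def.2 (Nat.lt_succ_iff.1 k.2)

theorem rowIdx_lt (α : PosRoot n) (k : Fin α.rk) {l : Fin n} (h : α.t ≤ l) : rowIdx α k < l :=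
  ((rowIdx_le α k).trans_lt α.2).trans_le h

theorem exists_rowIdx (α : PosRoot n) {l : Fin n} (h : l ≤ α.s) : ∃ k, rowIdx α k = l :=
  ⟨⟨l, Nat.lt_succ_of_le h⟩, rfl⟩

section Ymat

variable {A : Type*} [CommRing A]

/-- The matrix with rows `w_k + ∑_{l ≥ j + 1} x_{k,l} w_l`, `k ≤ i`, whose row space is the
`(i,j)`-component of the point of the open cell with coordinates `x`. -/
def Ymat (x : PosRoot n → A) (α : PosRoot n) : Matrix (Fin α.rk) (Fin n) A := fun k l =>
  if rowIdx α k = l then 1 else if h : α.t ≤ l then x ⟨(rowIdx α k, l), rowIdx_lt α k h⟩ else 0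

theorem Ymat_of_le (x : PosRoot n → A) (α : PosRoot n) (k : Fin α.rk) {l : Fin n} (h : l ≤ α.s) :
    Ymat x α k l = if rowIdx α k = l then 1 else 0 := by
  have : ¬ α.t ≤ l := not_le.2 (h.trans_lt α.2)
  simp [Ymat, this]

theorem Ymat_of_ge (x : PosRoot n → A) (α : PosRoot n) (k : Fin α.rk) {l : Fin n} (h : α.t ≤ l) :
    Ymat x α k l = x ⟨(rowIdx α k, l), rowIdx_lt α k h⟩ := by
  simp [Ymat, h, (rowIdx_lt α k h).ne]

theorem Ymat_of_not_allowed (x : PosRoot n → A) (α : PosRoot n) (k : Fin α.rk) {l : Fin n}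
    (h : ¬ α.Allowed l) : Ymat x α k l = 0 := by
  have h1 : rowIdx α k ≠ l := fun h' => h (Or.inl (h' ▸ rowIdx_le α k))
  have h2 : ¬ α.t ≤ l := fun h' => h (Or.inr h')
  simp [Ymat, h1, h2]

end Ymat

/-- The maximal minors of the matrix `Ymat`, as polynomial functions on the open cell. -/
def cellMinor (α : PosRoot n) (q : Fin α.rk → Fin n) : Sn n :=
  ((Ymat X α).submatrix id q).det

theorem aeval_cellMinor {A : Type*} [CommRing A] [Algebra ℂ A] (x : PosRoot n → A) (α : PosRoot n)
    (q : Fin α.rk → Fin n) :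
    aeval x (cellMinor α q) = ((Ymat x α).submatrix id q).det := by
  rw [cellMinor, AlgHom.map_det]
  congr 1
  ext k r
  simp only [AlgHom.mapMatrix_apply, Matrix.map_apply, Matrix.submatrix_apply, id, Ymat]
  split_ifs <;> simp

theorem cellMinor_swap (α : PosRoot n) (q : Fin α.rk → Fin n) {r r' : Fin α.rk} (h : r ≠ r') :
    cellMinor α (q ∘ Equiv.swap r r') = - cellMinor α q := by
  have := Matrix.det_permute' (Equiv.swap r r') ((Ymat (X : PosRoot n → Sn n) α).submatrix id q)
  rw [Equiv.Perm.sign_swap h] at this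
  simpa [cellMinor] using this

theorem pderiv_Ymat (α β : PosRoot n) (k : Fin α.rk) (l : Fin n) :
    pderiv β (Ymat (X : PosRoot n → Sn n) α k l) =
      if α.Below β ∧ rowIdx α k = β.s ∧ l = β.t then 1 else 0 := by
  by_cases h : α.t ≤ l
  · rw [Ymat_of_ge _ _ _ h, pderiv_X]
    by_cases h' : β = ⟨(rowIdx α k, l), rowIdx_lt α k h⟩
    · subst h'
      rw [Pi.single_eq_same, if_pos ⟨⟨rowIdx_le α k, h⟩, rfl, rfl⟩]
    · rw [Pi.single_eq_of_ne (Ne.symm h'), if_neg]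
      rintro ⟨-, h1, h2⟩
      exact h' (Subtype.ext (Prod.ext h1.symm h2.symm))
  · rw [if_neg fun h' : α.Below β ∧ rowIdx α k = β.s ∧ l = β.t => h (h'.2.2 ▸ h'.1.2)]
    by_cases h1 : rowIdx α k = l <;> simp [Ymat, h, h1]

/-- The variable `x_β` occurs in one entry of `Ymat`, in row `β.s` and column `β.t`. Its cofactor
amounts to putting the unit column with index `β.s` in place of the column `β.t`, which is the rule
defining `actCX` up to sign. -/
theorem pderiv_cellMinor (α β : PosRoot n) (q : Fin α.rk → Fin n) :
    pderiv β (cellMinor α q) = if α.Below β then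
      ∑ r, if q r = β.t then cellMinor α (Function.update q r β.s) else 0 else 0 := by
  rw [cellMinor, derivation_det]
  simp only [Matrix.submatrix_apply, id, pderiv_Ymat]
  split_ifs with hβ
  · obtain ⟨k₀, hk₀⟩ := exists_rowIdx α hβ.1
    rw [Finset.sum_eq_single k₀]
    · rw [det_updateRow_eq_sum]
      refine Finset.sum_congr rfl fun r _ => ?_
      simp only [hβ, hk₀, true_and, ite_mul, one_mul, zero_mul]
      congr 1
      rw [cellMinor]
      congr 1
      ext i j
      by_cases hj : j = r
      · subst hj
        rw [Matrix.updateCol_self, Matrix.submatrix_apply, Function.update_self,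
          Ymat_of_le _ _ _ hβ.1, ← hk₀, Pi.single_apply]
        simp only [id, (rowIdx_injective α).eq_iff]
      · simp [hj]
    · intro k _ hk
      have : rowIdx α k ≠ β.s := fun h => hk (rowIdx_injective α (h.trans hk₀.symm))
      refine Matrix.det_eq_zero_of_row_eq_zero k fun j => ?_
      simp [this]
    · simp
  · refine Finset.sum_eq_zero fun k _ => Matrix.det_eq_zero_of_row_eq_zero k fun j => ?_
    simp [hβ]

/-- The mixed second derivatives of the minors are antisymmetric. -/
theorem pderiv_pderiv_cellMinor {α β₁ β₂ β₃ β₄ : PosRoot n} (h₁ : α.Below β₁) (h₂ : α.Below β₂)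
    (h₃₁ : β₃.s = β₁.s) (h₃₂ : β₃.t = β₂.t) (h₄₂ : β₄.s = β₂.s) (h₄₁ : β₄.t = β₁.t)
    (q : Fin α.rk → Fin n) :
    pderiv β₁ (pderiv β₂ (cellMinor α q)) + pderiv β₃ (pderiv β₄ (cellMinor α q)) = 0 := by
  have h₃ : α.Below β₃ := ⟨h₃₁ ▸ h₁.1, h₃₂ ▸ h₂.2⟩
  have h₄ : α.Below β₄ := ⟨h₄₂ ▸ h₂.1, h₄₁ ▸ h₁.2⟩
  -- Two derivatives replace two different columns: a column already replaced has index `γ₂.s ≤ α.s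
  -- < γ₁.t`, so the second derivative does not see it.
  have key : ∀ {γ₁ γ₂ : PosRoot n}, α.Below γ₁ → α.Below γ₂ →
      pderiv γ₁ (pderiv γ₂ (cellMinor α q)) = ∑ r, ∑ r',
        if r ≠ r' ∧ q r = γ₂.t ∧ q r' = γ₁.t then
          cellMinor α (Function.update (Function.update q r γ₂.s) r' γ₁.s) else 0 := by
    intro γ₁ γ₂ h h'
    rw [pderiv_cellMinor, if_pos h', map_sum]
    refine Finset.sum_congr rfl fun r _ => ?_
    by_cases hr : q r = γ₂.t
    · rw [if_pos hr, pderiv_cellMinor, if_pos h]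
      refine Finset.sum_congr rfl fun r' _ => ?_
      by_cases hrr : r' = r
      · subst hrr
        have : γ₂.s ≠ γ₁.t := ((h'.1.trans_lt α.2).trans_le h.2).ne
        simp [this]
      · simp [hr, hrr, Ne.symm hrr]
    · simp [hr]
  rw [key h₁ h₂, key h₃ h₄, Finset.sum_comm, ← Finset.sum_add_distrib]
  refine Finset.sum_eq_zero fun r' _ => ?_
  rw [← Finset.sum_add_distrib]
  refine Finset.sum_eq_zero fun r _ => ?_
  rw [h₃₁, h₃₂, h₄₁, h₄₂]
  by_cases hc : r ≠ r' ∧ q r = β₂.t ∧ q r' = β₁.t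
  -- The two pairs of roots insert the same two row indices in opposite places, so the minors differ
  -- by a transposition of columns.
  · rw [if_pos hc, if_pos ⟨hc.1.symm, hc.2.2, hc.2.1⟩,
      show Function.update (Function.update q r' β₂.s) r β₁.s =
        Function.update (Function.update q r β₂.s) r' β₁.s ∘ Equiv.swap r r' from ?_,
      cellMinor_swap _ _ hc.1, add_neg_cancel]
    funext j
    by_cases hj : j = r
    · subst hj; simp
    by_cases hj' : j = r'
    · subst hj'; simp [hc.1, hj]
    · simp [hj, hj', Equiv.swap_apply_of_ne_of_ne hj hj']
  · rw [if_neg hc, if_neg fun h => hc ⟨h.1.symm, h.2.2, h.2.1⟩, add_zero]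

theorem pderiv_cellMinor_of_not_below {α β : PosRoot n} (h : ¬ α.Below β)
    (q : Fin α.rk → Fin n) : pderiv β (cellMinor α q) = 0 := by
  rw [pderiv_cellMinor, if_neg h]

/-! ### The restriction of polynomials to the open cell -/

/-- The substitution of the minors of the open cell for the Plücker variables. -/
def toCell (n : ℕ) : CX n →ₐ[ℂ] Sn n := aeval fun k : PlIdx n => cellMinor k.1 k.2.seq

theorem PlSet.seq_mem {α : PosRoot n} (L : PlSet α) (r : Fin α.rk) : L.seq r ∈ L.1 :=
  Finset.orderEmbOfFin_mem _ _ _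

theorem PlSet.seq_injective {α : PosRoot n} (L : PlSet α) : Function.Injective L.seq :=
  (L.1.orderEmbOfFin L.2.1).injective

theorem PlSet.exists_seq_eq {α : PosRoot n} (L : PlSet α) {l : Fin n} (h : l ∈ L.1) :
    ∃ r, L.seq r = l := by
  have : l ∈ Set.range (L.1.orderEmbOfFin L.2.1) := by
    rw [Finset.range_orderEmbOfFin]; exact h
  exact this

/-- Only the set `P` of the values of `q` contributes, and its coefficient is the sign of the
permutation sorting `q`. If `q` has a repetition, every determinant on both sides has two equal rows
or columns. -/
theorem sum_det_smul_cellMinor (α : PosRoot n) (q : Fin α.rk → Fin n) (hq : ∀ r, α.Allowed (q r)) :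
    ∑ P : PlSet α, (Matrix.of fun a b => if q a = P.seq b then (1 : ℂ) else 0).det •
      cellMinor α P.seq = cellMinor α q := by
  by_cases hinj : Function.Injective q
  · let P₀ : PlSet α := ⟨Finset.univ.image q, by rw [Finset.card_image_of_injective _ hinj]; simp,
      fun k hk => by
        obtain ⟨r, -, rfl⟩ := Finset.mem_image.1 hk
        exact hq r⟩
    choose σ hσ using fun r => P₀.exists_seq_eq (Finset.mem_image_of_mem q (Finset.mem_univ r))
    have hσi : Function.Injective σ := fun a b h => hinj (by rw [← hσ, ← hσ b, h])
    let τ : Equiv.Perm (Fin α.rk) := Equiv.ofBijective σ (Finite.injective_iff_bijective.1 hσi)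
    have hτ : q = P₀.seq ∘ τ := funext fun r => (hσ r).symm
    rw [Finset.sum_eq_single P₀]
    · have h1 : (Matrix.of fun a b => if q a = P₀.seq b then (1 : ℂ) else 0) =
          (1 : Matrix (Fin α.rk) (Fin α.rk) ℂ).submatrix τ id := by
        ext a b
        simp only [Matrix.of_apply, hτ, Function.comp_apply, P₀.seq_injective.eq_iff,
          Matrix.submatrix_apply, Matrix.one_apply, id]
      have h2 := Matrix.det_permute' τ ((Ymat (X : PosRoot n → Sn n) α).submatrix id P₀.seq)
      rw [Matrix.submatrix_submatrix] at h2
      rw [h1, Matrix.det_permute, Matrix.det_one, mul_one, hτ, cellMinor, cellMinor]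
      refine Eq.trans ?_ h2.symm
      rw [smul_eq_C_mul]
      simp
    · intro P _ hP
      obtain ⟨a, ha⟩ : ∃ a, q a ∉ P.1 := by
        by_contra! hc
        refine hP (Subtype.ext (Finset.eq_of_subset_of_card_le ?_ ?_).symm)
        · intro k hk
          obtain ⟨r, -, rfl⟩ := Finset.mem_image.1 hk
          exact hc r
        · rw [P.2.1, P₀.2.1]
      rw [Matrix.det_eq_zero_of_row_eq_zero a, zero_smul]
      intro b
      rw [Matrix.of_apply, if_neg]
      exact fun h => ha (h ▸ P.seq_mem b)
    · simp
  · obtain ⟨a, b, hab, hne⟩ : ∃ a b, q a = q b ∧ a ≠ b := by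
      simpa [Function.Injective] using hinj
    rw [cellMinor, Matrix.det_zero_of_column_eq hne fun i => by simp [hab]]
    refine Finset.sum_eq_zero fun P _ => ?_
    rw [Matrix.det_zero_of_row_eq hne, zero_smul]
    funext c
    simp [hab]

theorem toCell_Xseq (α : PosRoot n) (q : Fin α.rk → Fin n) (hq : ∀ r, α.Allowed (q r)) :
    toCell n (Xseq α q) = cellMinor α q := by
  rw [← sum_det_smul_cellMinor α q hq, Xseq, map_sum]
  refine Finset.sum_congr rfl fun P _ => ?_
  rw [map_mul, toCell, aeval_X, algHom_C, ← Algebra.smul_def]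

/-- Both sides obey the Leibniz rule along the homomorphism `toCell`, so the check reduces to the
variables, where it is `pderiv_cellMinor`. -/
theorem toCell_actCX (β : PosRoot n) (F : CX n) :
    toCell n (actCX β F) = - pderiv β (toCell n F) := by
  induction F using MvPolynomial.induction_on with
  | C c => simp [toCell]
  | add p q hp hq => rw [map_add, map_add, map_add, map_add, hp, hq, neg_add]
  | mul_X p k hp =>
    rw [Derivation.leibniz, map_mul, Derivation.leibniz]
    simp only [smul_eq_mul, map_add, map_mul]
    rw [hp, show toCell n (actCX β (X k)) = - pderiv β (toCell n (X k)) from ?_]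
    · ring
    rw [actCX, mkDerivation_X, toCell, aeval_X, pderiv_cellMinor, ← toCell]
    split_ifs with h
    · rw [map_neg, map_sum]
      congr 1
      refine Finset.sum_congr rfl fun r _ => ?_
      split_ifs
      · refine toCell_Xseq _ _ fun r' => ?_
        by_cases hr : r' = r
        · subst hr; rw [Function.update_self]; exact Or.inl h.1
        · rw [Function.update_of_ne hr]; exact k.2.2.2 _ (k.2.seq_mem r')
      · simp
    · simp

/-! ### Linear independence of the minors -/

/-- This replaces a density argument: arbitrary data sit at `z = 0`, the base point of the cell at
`z = 1`, and `T` is the leading minor whose nonvanishing puts the member at `z` into the cell. -/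
theorem polynomial_eq_zero_of_generic {H T : Polynomial ℂ}
    (h : ∀ z, T.eval z ≠ 0 → H.eval z = 0) (hT : T.eval 1 ≠ 0) : H = 0 := by
  have h1 : H * T = 0 := Polynomial.funext fun z => by
    rw [Polynomial.eval_mul, Polynomial.eval_zero]
    by_cases hz : T.eval z = 0
    · rw [hz, mul_zero]
    · rw [h z hz, zero_mul]
  refine (mul_eq_zero.1 h1).resolve_right ?_
  rintro rfl
  simp at hT

/-- The coordinates of the row space of a matrix with invertible leading minor. -/
def cellCoord (α : PosRoot n) (U : Matrix (Fin α.rk) (Fin n) ℂ) (β : PosRoot n) : ℂ :=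
  if h : β.s ≤ α.s then ((U.submatrix id (rowIdx α))⁻¹ * U) ⟨β.s, Nat.lt_succ_of_le h⟩ β.t else 0

/-- Row reduction: multiplying by the inverse of the leading block makes that block the identity,
and the columns strictly between `α.s` and `α.t` remain zero. -/
theorem eq_mul_Ymat {α : PosRoot n} {U : Matrix (Fin α.rk) (Fin n) ℂ}
    (hU : ∀ k l, ¬ α.Allowed l → U k l = 0) (hdet : (U.submatrix id (rowIdx α)).det ≠ 0) :
    U = U.submatrix id (rowIdx α) * Ymat (cellCoord α U) α := by
  set T := U.submatrix id (rowIdx α) with hT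
  have hunit : IsUnit T.det := isUnit_iff_ne_zero.2 hdet
  have h : T⁻¹ * U = Ymat (cellCoord α U) α := by
    ext k l
    by_cases h1 : l ≤ α.s
    · obtain ⟨k', rfl⟩ := exists_rowIdx α h1
      rw [Ymat_of_le _ _ _ h1]
      have h2 := congrFun (congrFun (Matrix.nonsing_inv_mul T hunit) k) k'
      rw [Matrix.one_apply] at h2
      simp only [(rowIdx_injective α).eq_iff]
      rw [← h2]
      rfl
    by_cases h2 : α.t ≤ l
    · rw [Ymat_of_ge _ _ _ h2, cellCoord, dif_pos (rowIdx_le α k)]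
      rfl
    · have h3 : ¬ α.Allowed l := fun h => h.elim h1 h2
      rw [Ymat_of_not_allowed _ _ _ h3, Matrix.mul_apply]
      exact Finset.sum_eq_zero fun k' _ => by rw [hU k' l h3, mul_zero]
  rw [← h, ← Matrix.mul_assoc, Matrix.mul_nonsing_inv T hunit, Matrix.one_mul]

theorem det_submatrix_of_eq_mul {α : PosRoot n} {U Y : Matrix (Fin α.rk) (Fin n) ℂ}
    {T : Matrix (Fin α.rk) (Fin α.rk) ℂ} (h : U = T * Y) (q : Fin α.rk → Fin n) :
    (U.submatrix id q).det = T.det * (Y.submatrix id q).det := by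
  rw [← Matrix.det_mul]
  congr 1
  subst h
  ext k r
  simp [Matrix.mul_apply]

theorem exists_eq_mul_aeval_cellMinor {α : PosRoot n} {U : Matrix (Fin α.rk) (Fin n) ℂ}
    (hU : ∀ k l, ¬ α.Allowed l → U k l = 0) (hdet : (U.submatrix id (rowIdx α)).det ≠ 0) :
    ∃ (t : ℂ) (x : PosRoot n → ℂ), ∀ q : Fin α.rk → Fin n,
      (U.submatrix id q).det = t * aeval x (cellMinor α q) :=
  ⟨_, _, fun q => (det_submatrix_of_eq_mul (eq_mul_Ymat hU hdet) q).trans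
    (congrArg _ (aeval_cellMinor _ α q).symm)⟩

theorem det_indicator (α : PosRoot n) (L P : PlSet α) :
    (Matrix.of fun a b => if L.seq a = P.seq b then (1 : ℂ) else 0).det =
      if P = L then 1 else 0 := by
  split_ifs with h
  · subst h
    convert Matrix.det_one (n := Fin α.rk) (R := ℂ)
    ext a b
    simp [Matrix.one_apply, P.seq_injective.eq_iff]
  · obtain ⟨l, hl, hl'⟩ : ∃ l ∈ L.1, l ∉ P.1 := by
      by_contra! hc
      exact h (Subtype.ext (Finset.eq_of_subset_of_card_le hc (by rw [L.2.1, P.2.1])).symm)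
    obtain ⟨a, rfl⟩ := L.exists_seq_eq hl
    refine Matrix.det_eq_zero_of_row_eq_zero a fun b => ?_
    rw [Matrix.of_apply, if_neg]
    exact fun h => hl' (h ▸ P.seq_mem b)

/-- A linear relation on the cell holds at every subspace with nonzero leading minor. The pencil `U`
joins the coordinate subspace of `L` at `z = 0` to the base point at `z = 1`, so the relation
extends to `z = 0`, where only the minor of `L` survives. -/
theorem linearIndependent_cellMinor (α : PosRoot n) :
    LinearIndependent ℂ fun L : PlSet α => cellMinor α L.seq := by
  rw [Fintype.linearIndependent_iff]
  intro c hc L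
  let U : Matrix (Fin α.rk) (Fin n) (Polynomial ℂ) := Matrix.of fun k l =>
    (1 - Polynomial.X) * (if L.seq k = l then 1 else 0) +
      Polynomial.X * (if rowIdx α k = l then 1 else 0)
  have hev : ∀ (z : ℂ) (q : Fin α.rk → Fin n), (U.submatrix id q).det.eval z =
      ((Matrix.of fun k l => (1 - z) * (if L.seq k = l then 1 else 0) +
        z * (if rowIdx α k = l then 1 else 0) : Matrix (Fin α.rk) (Fin n) ℂ).submatrix id q).det := by
    intro z q
    rw [← Polynomial.coe_evalRingHom, RingHom.map_det]
    congr 1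
    ext k r
    simp only [RingHom.mapMatrix_apply, Matrix.map_apply, Matrix.submatrix_apply, id, U,
      Matrix.of_apply, Polynomial.coe_evalRingHom, Polynomial.eval_add, Polynomial.eval_mul,
      Polynomial.eval_sub, Polynomial.eval_X, apply_ite (Polynomial.eval z), Polynomial.eval_one,
      Polynomial.eval_zero]
  have h0 : ∑ P : PlSet α, Polynomial.C (c P) * (U.submatrix id P.seq).det = 0 := by
    refine polynomial_eq_zero_of_generic (T := (U.submatrix id (rowIdx α)).det) ?_ ?_
    · intro z hz
      rw [hev] at hz
      simp only [Polynomial.eval_finsetSum, Polynomial.eval_mul, Polynomial.eval_C, hev]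
      obtain ⟨t, x, ht⟩ : ∃ (t : ℂ) (x : PosRoot n → ℂ), ∀ q : Fin α.rk → Fin n,
          ((Matrix.of fun k l => (1 - z) * (if L.seq k = l then 1 else 0) +
            z * (if rowIdx α k = l then 1 else 0) : Matrix (Fin α.rk) (Fin n) ℂ).submatrix
              id q).det = t * aeval x (cellMinor α q) := by
        refine exists_eq_mul_aeval_cellMinor (fun k l hl => ?_) hz
        have h1 : L.seq k ≠ l := fun h => hl (h ▸ L.2.2 _ (L.seq_mem k))
        have h2 : rowIdx α k ≠ l := fun h => hl (h ▸ Or.inl (rowIdx_le α k))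
        rw [Matrix.of_apply, if_neg h1, if_neg h2, mul_zero, mul_zero, add_zero]
      have h2 := congrArg (aeval x) hc
      rw [map_sum, map_zero] at h2
      simp only [map_smul, smul_eq_mul] at h2
      simp only [ht]
      rw [← mul_zero t, ← h2, Finset.mul_sum]
      exact Finset.sum_congr rfl fun P _ => by ring
    · rw [hev]
      convert one_ne_zero (α := ℂ)
      convert Matrix.det_one (n := Fin α.rk) (R := ℂ)
      ext a b
      simp [Matrix.one_apply, (rowIdx_injective α).eq_iff]
  have h1 := congrArg (Polynomial.eval 0) h0
  simp only [Polynomial.eval_finsetSum, Polynomial.eval_mul, Polynomial.eval_C, hev,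
    Polynomial.eval_zero, sub_zero, one_mul, zero_mul, add_zero] at h1
  rw [Finset.sum_eq_single L] at h1
  · have h2 := det_indicator α L L
    rw [if_pos rfl] at h2
    have h3 : ((Matrix.of fun k l => if L.seq k = l then 1 else 0 :
        Matrix (Fin α.rk) (Fin n) ℂ).submatrix id L.seq).det = 1 := h2
    rwa [h3, mul_one] at h1
  · intro P _ hP
    have h2 := det_indicator α L P
    rw [if_neg hP] at h2
    have h3 : ((Matrix.of fun k l => if L.seq k = l then 1 else 0 :
        Matrix (Fin α.rk) (Fin n) ℂ).submatrix id P.seq).det = 0 := h2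
    rw [h3, mul_zero]
  · simp

/-! ### The ideals `I_α` -/

/-- The variable `f_{k,l}` if `α_{k,l} ≥ α`, and zero otherwise. -/
def Yvar (α : PosRoot n) (k l : Fin n) : Sn n :=
  if h : k ≤ α.s ∧ α.t ≤ l then X ⟨(k, l), (h.1.trans_lt α.2).trans_le h.2⟩ else 0

/-- The variable `f_{k,l}` if `k < l`, and zero otherwise. -/
def Xvar (k l : Fin n) : Sn n := if h : k < l then X ⟨(k, l), h⟩ else 0

theorem Yvar_of_below {α β : PosRoot n} (h : α.Below β) : Yvar α β.s β.t = X β :=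
  dif_pos h

theorem Yvar_of_not {α : PosRoot n} {k l : Fin n} (h : ¬ (k ≤ α.s ∧ α.t ≤ l)) :
    Yvar α k l = 0 := dif_neg h

theorem perm_eq_zero {α : PosRoot n} {k k' l l' : Fin n}
    (h : ¬ ((k ≤ α.s ∧ α.t ≤ l) ∧ (k' ≤ α.s ∧ α.t ≤ l'))) :
    Yvar α k l * Yvar α k' l' + Yvar α k l' * Yvar α k' l = 0 := by
  by_cases hk : k ≤ α.s
  swap
  · rw [Yvar_of_not fun h => hk h.1, Yvar_of_not fun h => hk h.1, zero_mul, zero_mul, zero_add]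
  by_cases hk' : k' ≤ α.s
  swap
  · rw [Yvar_of_not (k := k') fun h => hk' h.1, Yvar_of_not (k := k') fun h => hk' h.1, mul_zero,
      mul_zero, zero_add]
  by_cases hl : α.t ≤ l
  swap
  · rw [Yvar_of_not (l := l) fun h => hl h.2, Yvar_of_not (l := l) fun h => hl h.2, mul_zero,
      zero_mul, zero_add]
  rw [Yvar_of_not (l := l') fun h' => h ⟨⟨hk, hl⟩, hk', h'.2⟩,
    Yvar_of_not (l := l') fun h' => h ⟨⟨hk, hl⟩, hk', h'.2⟩, mul_zero, zero_mul, zero_add]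

theorem Xvar_root (β : PosRoot n) : Xvar β.s β.t = X β := dif_pos β.2

theorem Yvar_eq_Xvar {α : PosRoot n} {k l : Fin n} (hk : k ≤ α.s) (hl : α.t ≤ l) :
    Yvar α k l = Xvar k l := by
  rw [Yvar, dif_pos ⟨hk, hl⟩, Xvar, dif_pos]

/-- The ideal generated by `f_β`, `β ≱ α`, and the permanents
`f_{k,l} f_{k',l'} + f_{k,l'} f_{k',l}` in the remaining variables. -/
def permIdeal (α : PosRoot n) : Ideal (Sn n) :=
  Ideal.span ({p | ∃ β, ¬ α.Below β ∧ p = X β} ∪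
    {p | ∃ k k' l l', p = Yvar α k l * Yvar α k' l' + Yvar α k l' * Yvar α k' l})

theorem X_mem_permIdeal {α β : PosRoot n} (h : ¬ α.Below β) : X β ∈ permIdeal α :=
  Ideal.subset_span (Or.inl ⟨β, h, rfl⟩)

theorem perm_mem_permIdeal (α : PosRoot n) (k k' l l' : Fin n) :
    Yvar α k l * Yvar α k' l' + Yvar α k l' * Yvar α k' l ∈ permIdeal α :=
  Ideal.subset_span (Or.inr ⟨k, k', l, l', rfl⟩)

theorem Xvar_sub_Yvar_mem (α : PosRoot n) (k l : Fin n) : Xvar k l - Yvar α k l ∈ permIdeal α := by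
  by_cases h : k ≤ α.s ∧ α.t ≤ l
  · rw [Yvar_eq_Xvar h.1 h.2, sub_self]
    exact zero_mem _
  · rw [Yvar_of_not h, sub_zero, Xvar]
    split_ifs with h'
    · exact X_mem_permIdeal h
    · exact zero_mem _

theorem sum_posRoot {A : Type*} [AddCommMonoid A] (g : Fin n → Fin n → A)
    (hg : ∀ k l, ¬ k < l → g k l = 0) : ∑ γ : PosRoot n, g γ.s γ.t = ∑ k, ∑ l, g k l := by
  rw [← Fintype.sum_prod_type']
  refine Eq.trans (Finset.sum_subtype (Finset.univ.filter fun p : Fin n × Fin n => p.1 < p.2)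
    (by simp) fun p : Fin n × Fin n => g p.1 p.2).symm ?_
  rw [Finset.sum_filter]
  refine Finset.sum_congr rfl fun p _ => ?_
  split_ifs with h
  · rfl
  · exact (hg _ _ h).symm

/-- The two sums come from `x E_{t,s}` and `E_{t,s} x`; passing to the quotient by `𝔟` is the
convention that `Xvar` vanishes off the strictly lower triangle. -/
theorem adAct_X (x : Matrix (Fin n) (Fin n) ℂ) (β : PosRoot n) :
    adAct x (X β) = ∑ p, C (x p β.t) * Xvar β.s p - ∑ q, C (x β.s q) * Xvar q β.t := by
  rw [adAct, mkDerivation_X]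
  have h : ∀ γ : PosRoot n, C (⁅x, fMat β⁆ γ.t γ.s) * X γ =
      (C (if γ.s = β.s then x γ.t β.t else 0) * Xvar γ.s γ.t : Sn n) -
        C (if γ.t = β.t then x β.s γ.s else 0) * Xvar γ.s γ.t := by
    intro γ
    rw [Xvar_root, ← sub_mul, ← C_sub, Ring.lie_def, Matrix.sub_apply, fMat]
    congr 3
    · split_ifs with h
      · rw [h, Matrix.mul_single_apply_same, mul_one]
      · rw [Matrix.mul_single_apply_of_ne _ _ _ _ _ h]
    · split_ifs with h
      · rw [h, Matrix.single_mul_apply_same, one_mul]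
      · rw [Matrix.single_mul_apply_of_ne _ _ _ _ _ h]
  simp only [h]
  rw [Finset.sum_sub_distrib,
    sum_posRoot (fun k l => (C (if k = β.s then x l β.t else 0) * Xvar k l : Sn n))
      (fun k l h => by rw [Xvar, dif_neg h, mul_zero]),
    sum_posRoot (fun k l => (C (if l = β.t then x β.s k else 0) * Xvar k l : Sn n))
      (fun k l h => by rw [Xvar, dif_neg h, mul_zero])]
  congr 1
  · rw [Finset.sum_eq_single β.s]
    · simp
    · intro k _ hk; simp [hk]
    · simp
  · refine Finset.sum_congr rfl fun k _ => ?_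
    rw [Finset.sum_eq_single β.t]
    · simp
    · intro l _ hl; simp [hl]
    · simp

/-- Modulo `permIdeal α` the Borel acts on the row and the column index separately. The formula
persists when `Yvar α k l` is zero by convention, since an upper triangular matrix only lowers the
column index and raises the row index, and so never re-enters the region `k ≤ α.s`, `α.t ≤ l`. -/
theorem adAct_Yvar (α : PosRoot n) {x : Matrix (Fin n) (Fin n) ℂ} (hx : ∀ p q, q < p → x p q = 0)
    (k l : Fin n) :
    Ideal.Quotient.mk (permIdeal α) (adAct x (Yvar α k l)) =
      Ideal.Quotient.mk (permIdeal α)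
        (∑ p, C (x p l) * Yvar α k p - ∑ q, C (x k q) * Yvar α q l) := by
  by_cases h : k ≤ α.s ∧ α.t ≤ l
  · have h1 : Yvar α k l = X ⟨(k, l), (h.1.trans_lt α.2).trans_le h.2⟩ := dif_pos h
    have h2 : ∀ p q, Ideal.Quotient.mk (permIdeal α) (Xvar p q) =
        Ideal.Quotient.mk (permIdeal α) (Yvar α p q) := fun p q =>
      Ideal.Quotient.eq.2 (Xvar_sub_Yvar_mem α p q)
    rw [h1, adAct_X]
    simp only [map_sub, map_sum, map_mul, h2]
  · rw [Yvar_of_not h, map_zero]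
    congr 1
    symm
    rw [sub_eq_zero]
    by_cases hk : k ≤ α.s
    · have hl : ¬ α.t ≤ l := fun hl => h ⟨hk, hl⟩
      rw [Finset.sum_eq_zero, Finset.sum_eq_zero]
      · intro q _
        rw [Yvar_of_not fun h => hl h.2, mul_zero]
      · intro p _
        by_cases hp : l < p
        · rw [hx p l hp, C_0, zero_mul]
        · rw [Yvar_of_not fun h => hp ((not_le.1 hl).trans_le h.2), mul_zero]
    · rw [Finset.sum_eq_zero, Finset.sum_eq_zero]
      · intro q _
        by_cases hq : q < k
        · rw [hx k q hq, C_0, zero_mul]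
        · rw [Yvar_of_not fun h => hq (h.1.trans_lt (not_le.1 hk)), mul_zero]
      · intro p _
        rw [Yvar_of_not fun h => hk h.1, mul_zero]

theorem mk_perm (α : PosRoot n) (k k' l l' : Fin n) :
    Ideal.Quotient.mk (permIdeal α) (Yvar α k l) * Ideal.Quotient.mk (permIdeal α) (Yvar α k' l') =
      - (Ideal.Quotient.mk (permIdeal α) (Yvar α k l') *
        Ideal.Quotient.mk (permIdeal α) (Yvar α k' l)) := by
  rw [eq_neg_iff_add_eq_zero, ← map_mul, ← map_mul, ← map_add]
  exact Ideal.Quotient.eq_zero_iff_mem.2 (perm_mem_permIdeal α k k' l l')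

/-- A generator `f_β` with `β ≱ α` is sent to roots below `β`, which are again not above `α`. On a
permanent, acting on a row or column index produces permanents: `e1` collects the column terms and
`e2` the row terms. -/
theorem adAct_mem_permIdeal (α : PosRoot n) {x : Matrix (Fin n) (Fin n) ℂ}
    (hx : ∀ p q, q < p → x p q = 0) {p : Sn n} (hp : p ∈ permIdeal α) :
    adAct x p ∈ permIdeal α := by
  refine Submodule.span_induction (p := fun p _ => adAct x p ∈ permIdeal α) ?_ ?_ ?_ ?_ hp
  · rintro _ (⟨β, hβ, rfl⟩ | ⟨k, k', l, l', rfl⟩)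
    · rw [adAct_X]
      refine sub_mem (sum_mem fun p _ => ?_) (sum_mem fun q _ => ?_)
      · by_cases hp : β.t < p
        · rw [hx p _ hp, C_0, zero_mul]; exact zero_mem _
        · refine Ideal.mul_mem_left _ _ ?_
          rw [Xvar]
          split_ifs with h
          · exact X_mem_permIdeal fun h' => hβ ⟨h'.1, h'.2.trans (not_lt.1 hp)⟩
          · exact zero_mem _
      · by_cases hq : q < β.s
        · rw [hx _ q hq, C_0, zero_mul]; exact zero_mem _
        · refine Ideal.mul_mem_left _ _ ?_
          rw [Xvar]
          split_ifs with h
          · exact X_mem_permIdeal fun h' => hβ ⟨(not_lt.1 hq).trans h'.1, h'.2⟩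
          · exact zero_mem _
    · rw [← Ideal.Quotient.eq_zero_iff_mem]
      simp only [map_add, Derivation.leibniz, smul_eq_mul, map_mul, adAct_Yvar α hx, map_sub,
        map_sum]
      set y := fun k l => Ideal.Quotient.mk (permIdeal α) (Yvar α k l) with hy
      have hs : ∀ k k' l l', y k l * y k' l' = - (y k l' * y k' l) := mk_perm α
      set c : ℂ → Sn n ⧸ permIdeal α := fun z => Ideal.Quotient.mk (permIdeal α) (C z) with hc
      change y k l * (∑ p, c (x p l') * y k' p - ∑ q, c (x k' q) * y q l') +
          y k' l' * (∑ p, c (x p l) * y k p - ∑ q, c (x k q) * y q l) +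
        (y k l' * (∑ p, c (x p l) * y k' p - ∑ q, c (x k' q) * y q l) +
          y k' l * (∑ p, c (x p l') * y k p - ∑ q, c (x k q) * y q l')) = 0
      have e1 : ∀ k k' l l', y k l * ∑ p, c (x p l') * y k' p =
          - (y k' l * ∑ p, c (x p l') * y k p) := by
        intro k k' l l'
        rw [Finset.mul_sum, Finset.mul_sum, ← Finset.sum_neg_distrib]
        refine Finset.sum_congr rfl fun p _ => ?_
        linear_combination c (x p l') * hs k k' l p
      have e2 : ∀ k k' l l', y k l * ∑ q, c (x k' q) * y q l' =
          - (y k l' * ∑ q, c (x k' q) * y q l) := by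
        intro k k' l l'
        rw [Finset.mul_sum, Finset.mul_sum, ← Finset.sum_neg_distrib]
        refine Finset.sum_congr rfl fun q _ => ?_
        linear_combination c (x k' q) * hs k q l l'
      linear_combination e1 k k' l l' - e2 k k' l l' + e1 k' k l' l - e2 k' k l' l
  · rw [map_zero]; exact zero_mem _
  · intro a b _ _ ha hb
    rw [map_add]; exact add_mem ha hb
  · intro r a ha ha'
    rw [smul_eq_mul, Derivation.leibniz]
    exact add_mem (Ideal.mul_mem_left _ _ ha') (Ideal.mul_mem_right _ _ ha)

/-- Since `permIdeal α` is stable under `𝔟`, only the initial generators matter, and `f_β²` is half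
of the permanent with equal rows and equal columns. -/
theorem annIdeal_le_permIdeal (α : PosRoot n) : annIdeal α ≤ permIdeal α := by
  refine Ideal.span_le.2 ?_
  rintro _ ⟨T, hT, p, hp, rfl⟩
  have hT' : ∀ p ∈ permIdeal α, T p ∈ permIdeal α := by
    refine Algebra.adjoin_induction (p := fun T _ => ∀ p ∈ permIdeal α, T p ∈ permIdeal α)
      ?_ ?_ ?_ ?_ hT
    · rintro _ ⟨x, hx, rfl⟩ p hp
      exact adAct_mem_permIdeal α hx.1 hp
    · intro c p hp
      exact Submodule.smul_of_tower_mem _ c hp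
    · intro S T _ _ hS hT p hp
      exact add_mem (hS p hp) (hT p hp)
    · intro S T _ _ hS hT p hp
      exact hS _ (hT p hp)
  refine hT' p ?_
  obtain ⟨β, hβ, rfl⟩ | ⟨β, hβ, rfl⟩ := hp
  · have h := Submodule.smul_of_tower_mem (permIdeal α) (1 / 2 : ℂ)
      (perm_mem_permIdeal α β.s β.s β.t β.t)
    rw [Yvar_of_below hβ, ← two_smul ℂ, smul_smul, ← sq] at h
    norm_num at h
    exact h
  · exact X_mem_permIdeal hβ

/-- The set of generators in the definition of `annIdeal α`. -/
def annGens (α : PosRoot n) : Set (Sn n) := {q | ∃ T ∈ UBorel n, ∃ p ∈ gens α, q = T p}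

theorem annGens_smul {α : PosRoot n} {q : Sn n} (c : ℂ) (h : q ∈ annGens α) :
    c • q ∈ annGens α := by
  obtain ⟨T, hT, p, hp, rfl⟩ := h
  exact ⟨c • T, (UBorel n).smul_mem hT c, p, hp, rfl⟩

theorem annGens_adAct {α : PosRoot n} {q : Sn n} {x : Matrix (Fin n) (Fin n) ℂ} (hx : IsBorel x)
    (h : q ∈ annGens α) : adAct x q ∈ annGens α := by
  obtain ⟨T, hT, p, hp, rfl⟩ := h
  exact ⟨(adAct x).toLinearMap * T,
    (UBorel n).mul_mem (Algebra.subset_adjoin ⟨x, hx, rfl⟩) hT, p, hp, rfl⟩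

theorem isBorel_single {p q : Fin n} (h : p < q) : IsBorel (Matrix.single p q (1 : ℂ)) := by
  refine ⟨fun a b hab => ?_, Matrix.trace_single_eq_of_ne _ _ _ h.ne⟩
  rw [Matrix.single_apply, if_neg]
  rintro ⟨rfl, rfl⟩
  exact absurd h hab.le.not_gt

theorem adAct_single_Xvar_right {k p l : Fin n} (h1 : k < p) (h2 : p < l) :
    adAct (Matrix.single p l 1) (Xvar k l) = Xvar k p := by
  have h3 : Xvar k l = X ⟨(k, l), h1.trans h2⟩ := dif_pos _
  rw [h3, adAct_X, Finset.sum_eq_single p, Finset.sum_eq_zero]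
  · simp
  · intro q _
    simp [h1.ne']
  · intro q _ hq
    simp [hq.symm]
  · simp

theorem adAct_single_Xvar_left {k k' l : Fin n} (h1 : k < k') (h2 : k' < l) :
    adAct (Matrix.single k k' 1) (Xvar k l) = - Xvar k' l := by
  have h3 : Xvar k l = X ⟨(k, l), h1.trans h2⟩ := dif_pos _
  rw [h3, adAct_X, Finset.sum_eq_zero, Finset.sum_eq_single k']
  · simp
  · intro q _ hq
    simp [hq.symm]
  · simp
  · intro q _
    simp [h2.ne]

/-- Polarization in the column index: `E_{l',l}` sends `f_{k,l}²` to `2 f_{k,l} f_{k,l'}`.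
Membership is kept in `annGens`, which is visibly stable under `𝔟`, so that a further Borel element
can be applied afterwards. -/
theorem mul_same_row_mem {α : PosRoot n} {k l l' : Fin n} (hk : k ≤ α.s) (hl : α.t ≤ l)
    (hl' : α.t ≤ l') : Xvar k l * Xvar k l' ∈ annGens α := by
  have sq_mem : ∀ l, α.t ≤ l → Xvar k l * Xvar k l ∈ annGens α := fun l hl =>
    ⟨1, one_mem _, _, Or.inl ⟨⟨(k, l), (hk.trans_lt α.2).trans_le hl⟩, ⟨hk, hl⟩, rfl⟩, by
      rw [Module.End.one_apply, sq, Xvar, dif_pos]⟩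
  have main : ∀ l l', α.t ≤ l' → l' < l → Xvar k l * Xvar k l' ∈ annGens α := by
    intro l l' hl' h
    have h1 := annGens_adAct (isBorel_single h) (sq_mem l (hl'.trans h.le))
    rw [Derivation.leibniz, adAct_single_Xvar_right ((hk.trans_lt α.2).trans_le hl') h] at h1
    have h2 := annGens_smul (1 / 2 : ℂ) h1
    rw [← two_smul ℂ, smul_smul] at h2
    norm_num at h2
    exact h2
  rcases lt_trichotomy l l' with h | rfl | h
  · rw [mul_comm]; exact main l' l hl h
  · exact sq_mem l hl
  · exact main l l' hl' h

/-- Polarization in the row index: `E_{k,k'}` sends `f_{k,l} f_{k,l'}` to minus the permanent with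
rows `k, k'` and columns `l, l'`. -/
theorem permIdeal_le_annIdeal (α : PosRoot n) : permIdeal α ≤ annIdeal α := by
  refine Ideal.span_le.2 ?_
  rintro _ (⟨β, hβ, rfl⟩ | ⟨k, k', l, l', rfl⟩)
  · exact Ideal.subset_span ⟨1, one_mem _, _, Or.inr ⟨β, hβ, rfl⟩, rfl⟩
  by_cases hr : (k ≤ α.s ∧ α.t ≤ l) ∧ (k' ≤ α.s ∧ α.t ≤ l')
  swap
  · rw [perm_eq_zero hr]
    exact zero_mem _
  obtain ⟨⟨hk, hl⟩, hk', hl'⟩ := hr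
  simp only [Yvar_eq_Xvar, hk, hk', hl, hl']
  have main : ∀ k k' l l', k' ≤ α.s → α.t ≤ l → α.t ≤ l' → k < k' →
      Xvar k l * Xvar k' l' + Xvar k l' * Xvar k' l ∈ annIdeal α := by
    intro k k' l l' hk' hl hl' h
    have h1 := annGens_adAct (isBorel_single h) (mul_same_row_mem (h.le.trans hk') hl hl')
    rw [Derivation.leibniz, adAct_single_Xvar_left h ((hk'.trans_lt α.2).trans_le hl),
      adAct_single_Xvar_left h ((hk'.trans_lt α.2).trans_le hl')] at h1
    have h2 : - _ ∈ annIdeal α := neg_mem (Ideal.subset_span h1)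
    convert h2 using 1
    simp only [smul_eq_mul]
    ring
  rcases lt_trichotomy k k' with h | rfl | h
  · exact main k k' l l' hk' hl hl' h
  · have h1 : ∀ l l', α.t ≤ l → α.t ≤ l' → Xvar k l * Xvar k l' ∈ annIdeal α :=
      fun l l' hl hl' => Ideal.subset_span (mul_same_row_mem hk hl hl')
    exact add_mem (h1 l l' hl hl') (h1 l' l hl' hl)
  · have h1 := main k' k l' l hk hl' hl h
    change _ ∈ annIdeal α
    convert h1 using 1
    ring

/-! ### Products in a ring with antisymmetric relations -/

theorem exists_perm_of_range_eq {ι X : Type*} [Finite ι] {f g : ι → X}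
    (hf : Function.Injective f) (h : Set.range f = Set.range g) :
    ∃ σ : Equiv.Perm ι, f = g ∘ σ := by
  choose σ hσ using fun i => (h ▸ Set.mem_range_self i : f i ∈ Set.range g)
  have hσi : Function.Injective σ := fun a b hab => hf (by rw [← hσ, ← hσ b, hab])
  exact ⟨Equiv.ofBijective σ (Finite.injective_iff_bijective.1 hσi), funext fun i => (hσ i).symm⟩

section Antisymm

variable {K A : Type*} [CommRing A]

theorem eq_zero_of_eq_neg [Algebra ℂ A] {a : A} (h : a = -a) : a = 0 := by
  have h1 : (2 : ℂ) • a = 0 := by rw [two_smul]; nth_rewrite 1 [h]; exact neg_add_cancel a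
  have h2 := congrArg (fun x => (1 / 2 : ℂ) • x) h1
  simpa [smul_smul] using h2

theorem prod_swap {y : K → K → A}
    (hy : ∀ k k' l l', y k l * y k' l' = -(y k l' * y k' l))
    {ι : Type*} [Fintype ι] [DecidableEq ι] (ks ls : ι → K) {a b : ι} (h : a ≠ b) :
    ∏ i, y (ks i) (ls (Equiv.swap a b i)) = - ∏ i, y (ks i) (ls i) := by
  have key : ∀ F : ι → A, ∏ i, F i = F a * F b * ∏ i ∈ (Finset.univ.erase a).erase b, F i :=
    fun F => by
      rw [← Finset.mul_prod_erase _ F (Finset.mem_univ a), ← Finset.mul_prod_erase _ F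
        (Finset.mem_erase.2 ⟨h.symm, Finset.mem_univ b⟩), mul_assoc]
  rw [key, key, Equiv.swap_apply_left, Equiv.swap_apply_right, hy (ks a), neg_mul]
  congr 2
  refine Finset.prod_congr rfl fun i hi => ?_
  simp only [Finset.mem_erase] at hi
  rw [Equiv.swap_apply_of_ne_of_ne hi.2.1 hi.1]

/-- Together with `prod_eq_zero_of_not_injective` this says that a monomial depends, up to a scalar,
only on its set of rows and its set of columns, and that it vanishes on repetition. -/
theorem exists_prod_perm [Algebra ℂ A] {y : K → K → A}
    (hy : ∀ k k' l l', y k l * y k' l' = -(y k l' * y k' l))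
    {ι : Type*} [Fintype ι] [DecidableEq ι] (ks ls : ι → K)
    (σ : Equiv.Perm ι) : ∃ c : ℂ, ∏ i, y (ks i) (ls (σ i)) = c • ∏ i, y (ks i) (ls i) := by
  induction σ using Equiv.Perm.swap_induction_on' with
  | one => exact ⟨1, by simp⟩
  | mul_swap σ a b hab ih =>
    obtain ⟨c, hc⟩ := ih
    refine ⟨-c, ?_⟩
    have := prod_swap hy ks (ls ∘ σ) hab
    simp only [Function.comp_apply] at this
    simp only [Equiv.Perm.mul_apply]
    rw [this, hc, neg_smul]

theorem prod_eq_zero_of_not_injective [Algebra ℂ A] {y : K → K → A}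
    (hy : ∀ k k' l l', y k l * y k' l' = -(y k l' * y k' l))
    {ι : Type*} [Fintype ι] [DecidableEq ι] (ks ls : ι → K)
    (h : ¬ (Function.Injective ks ∧ Function.Injective ls)) : ∏ i, y (ks i) (ls i) = 0 := by
  have h' : ∃ a b, a ≠ b ∧ (ks a = ks b ∨ ls a = ls b) := by
    by_contra! hc
    exact h ⟨fun a b hab => by_contra fun hne => (hc a b hne).1 hab,
      fun a b hab => by_contra fun hne => (hc a b hne).2 hab⟩
  obtain ⟨a, b, hne, hab⟩ := h'
  rw [← Finset.mul_prod_erase _ _ (Finset.mem_univ a), ← Finset.mul_prod_erase _ _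
    (Finset.mem_erase.2 ⟨hne.symm, Finset.mem_univ b⟩), ← mul_assoc]
  have : y (ks a) (ls a) * y (ks b) (ls b) = 0 := by
    refine eq_zero_of_eq_neg ?_
    rcases hab with hab | hab
    · exact (hy _ _ _ _).trans (by rw [hab, mul_comm])
    · exact (hy _ _ _ _).trans (by rw [hab])
  rw [this, zero_mul]

end Antisymm

/-! ### The dual spaces of the modules `M_α` -/

/-- The map `p ↦ p v_α`. -/
def toMroot (α : PosRoot n) : Sn n →ₗ[ℂ] Mroot α :=
  (LinearMap.toSpanSingleton (Sn n) (Mroot α) (vRoot α)).restrictScalars ℂ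

theorem toMroot_apply (α : PosRoot n) (p : Sn n) : toMroot α p = p • vRoot α := rfl

theorem toMroot_eq_mk (α : PosRoot n) (p : Sn n) :
    toMroot α p = Ideal.Quotient.mk (annIdeal α) p := by
  rw [toMroot_apply]
  change Ideal.Quotient.mk (annIdeal α) (p * 1) = _
  rw [mul_one]

theorem toMroot_surjective (α : PosRoot n) : Function.Surjective (toMroot α) := fun x => by
  obtain ⟨p, hp⟩ := Ideal.Quotient.mk_surjective (I := annIdeal α) x
  exact ⟨p, (toMroot_eq_mk α p).trans hp⟩

theorem mem_ker_toMroot {α : PosRoot n} {p : Sn n} :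
    p ∈ LinearMap.ker (toMroot α) ↔ p ∈ annIdeal α := by
  rw [LinearMap.mem_ker, toMroot_eq_mk]
  exact Ideal.Quotient.eq_zero_iff_mem

/-- The class of `f_{k,l}` in the ring `S(𝔫⁻) / I_α`. -/
def ybar (α : PosRoot n) (k l : Fin n) : Sn n ⧸ annIdeal α :=
  Ideal.Quotient.mk (annIdeal α) (Yvar α k l)

theorem ybar_mul (α : PosRoot n) (k k' l l' : Fin n) :
    ybar α k l * ybar α k' l' = -(ybar α k l' * ybar α k' l) := by
  rw [eq_neg_iff_add_eq_zero, ybar, ybar, ybar, ybar, ← map_mul, ← map_mul, ← map_add]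
  exact Ideal.Quotient.eq_zero_iff_mem.2 (permIdeal_le_annIdeal α (perm_mem_permIdeal α k k' l l'))

theorem mk_X_eq_ybar (α β : PosRoot n) :
    Ideal.Quotient.mk (annIdeal α) (X β) = ybar α β.s β.t := by
  by_cases h : α.Below β
  · rw [ybar, Yvar_of_below h]
  · rw [ybar, Yvar_of_not h, map_zero]
    exact Ideal.Quotient.eq_zero_iff_mem.2 (permIdeal_le_annIdeal α (X_mem_permIdeal h))

theorem ybar_of_not {α : PosRoot n} {k l : Fin n} (h : ¬ (k ≤ α.s ∧ α.t ≤ l)) :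
    ybar α k l = 0 := by rw [ybar, Yvar_of_not h, map_zero]

/-- Sequences of rows and columns which correspond to the set `L`. -/
def IsMinorOf {α : PosRoot n} (L : PlSet α) (p : (r : ℕ) × (Fin r → Fin n) × (Fin r → Fin n)) :
    Prop :=
  Function.Injective p.2.1 ∧ Function.Injective p.2.2 ∧
    Set.range p.2.1 = {k | k ≤ α.s ∧ k ∉ L.1} ∧ Set.range p.2.2 = {l | α.t ≤ l ∧ l ∈ L.1}

open Classical in
/-- A monomial in the `f_{k,l}` which takes `w_1 ∧ ⋯ ∧ w_i` to a multiple of `w_L`. -/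
def monoRep {α : PosRoot n} (L : PlSet α) : Sn n ⧸ annIdeal α :=
  if h : ∃ p, IsMinorOf L p then ∏ a, ybar α (h.choose.2.1 a) (h.choose.2.2 a) else 0

/-- A nonzero monomial removes the rows `ks` from `{1, …, i}` and inserts the columns `ls`, which
gives a set `L`; monomials with the same `L` are proportional. -/
theorem prod_mem_span_monoRep (α : PosRoot n) {r : ℕ} (ks ls : Fin r → Fin n) :
    ∏ a, ybar α (ks a) (ls a) ∈ Submodule.span ℂ (Set.range (monoRep (α := α))) := by
  by_cases hinj : Function.Injective ks ∧ Function.Injective ls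
  swap
  · rw [prod_eq_zero_of_not_injective (ybar_mul α) ks ls hinj]
    exact zero_mem _
  by_cases hr : ∀ a, ks a ≤ α.s ∧ α.t ≤ ls a
  swap
  · obtain ⟨a, ha⟩ := not_forall.1 hr
    have h0 : ∏ a, ybar α (ks a) (ls a) = 0 :=
      Finset.prod_eq_zero (Finset.mem_univ a) (ybar_of_not ha)
    rw [h0]
    exact zero_mem _
  have hdisj : Disjoint (Finset.Iic α.s \ Finset.univ.image ks) (Finset.univ.image ls) := by
    rw [Finset.disjoint_left]
    intro l hl hl'
    obtain ⟨a, -, rfl⟩ := Finset.mem_image.1 hl'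
    exact absurd (Finset.mem_Iic.1 (Finset.mem_sdiff.1 hl).1) (α.2.trans_le (hr a).2).not_ge
  have hsub : Finset.univ.image ks ⊆ Finset.Iic α.s := fun k hk => by
    obtain ⟨a, -, rfl⟩ := Finset.mem_image.1 hk
    exact Finset.mem_Iic.2 (hr a).1
  let L : PlSet α := ⟨(Finset.Iic α.s \ Finset.univ.image ks) ∪ Finset.univ.image ls, by
    have h1 := Finset.card_le_card hsub
    rw [Finset.card_union_of_disjoint hdisj, Finset.card_sdiff_of_subset hsub]
    rw [Finset.card_image_of_injective _ hinj.1] at *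
    rw [Finset.card_image_of_injective _ hinj.2]
    simp only [Finset.card_univ, Fintype.card_fin, Fin.card_Iic, PosRoot.rk] at *
    omega, by
    intro k hk
    rcases Finset.mem_union.1 hk with hk | hk
    · exact Or.inl (Finset.mem_Iic.1 (Finset.mem_sdiff.1 hk).1)
    · obtain ⟨a, -, rfl⟩ := Finset.mem_image.1 hk
      exact Or.inr (hr a).2⟩
  have hL : IsMinorOf L ⟨r, ks, ls⟩ := by
    refine ⟨hinj.1, hinj.2, ?_, ?_⟩
    · ext k
      simp only [L, Set.mem_range, Set.mem_ofPred_eq, Finset.mem_union, Finset.mem_sdiff,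
        Finset.mem_image, Finset.mem_Iic, Finset.mem_univ, true_and]
      constructor
      · rintro ⟨a, rfl⟩
        refine ⟨(hr a).1, ?_⟩
        rintro (h | ⟨b, hb⟩)
        · exact h.2 ⟨a, rfl⟩
        · exact absurd (hr a).1 (α.2.trans_le (hb ▸ (hr b).2)).not_ge
      · rintro ⟨h1, h2⟩
        by_contra hc
        exact h2 (Or.inl ⟨h1, hc⟩)
    · ext l
      simp only [L, Set.mem_range, Set.mem_ofPred_eq, Finset.mem_union, Finset.mem_sdiff,
        Finset.mem_image, Finset.mem_Iic, Finset.mem_univ, true_and]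
      constructor
      · rintro ⟨a, rfl⟩
        exact ⟨(hr a).2, Or.inr ⟨a, rfl⟩⟩
      · rintro ⟨h1, h2 | h2⟩
        · exact absurd h2.1 (α.2.trans_le h1).not_ge
        · exact h2
  have hex : ∃ p, IsMinorOf L p := ⟨_, hL⟩
  obtain ⟨c, hc⟩ : ∃ c : ℂ, ∏ a, ybar α (ks a) (ls a) = c • monoRep L := by
    rw [monoRep, dif_pos hex]
    have hch := hex.choose_spec
    generalize hex.choose = p at hch
    obtain ⟨r', ks', ls'⟩ := p
    obtain ⟨i1, i2, e1, e2⟩ := hch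
    obtain ⟨-, -, e1', e2'⟩ := hL
    simp only at i1 i2 e1 e2 e1' e2' ⊢
    have hk : Set.range ks = Set.range ks' := e1'.trans e1.symm
    have hl : Set.range ls = Set.range ls' := e2'.trans e2.symm
    obtain rfl : r = r' := by
      have := congrArg Set.ncard hk
      rwa [Set.ncard_range_of_injective hinj.1, Set.ncard_range_of_injective i1,
        Nat.card_fin, Nat.card_fin] at this
    obtain ⟨σ, rfl⟩ := exists_perm_of_range_eq hinj.1 hk
    obtain ⟨τ, rfl⟩ := exists_perm_of_range_eq hinj.2 hl
    -- Reordering the factors absorbs the permutation of the rows, leaving one relative permutation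
    -- of the columns.
    obtain ⟨c, hc⟩ := exists_prod_perm (ybar_mul α) ks' ls' (σ.symm.trans τ)
    refine ⟨c, ?_⟩
    rw [← hc, ← Equiv.prod_comp σ fun a => ybar α (ks' a) (ls' ((σ.symm.trans τ) a))]
    simp
  rw [hc]
  exact Submodule.smul_mem _ _ (Submodule.subset_span ⟨L, rfl⟩)

theorem span_monoRep (α : PosRoot n) : Submodule.span ℂ (Set.range (monoRep (α := α))) = ⊤ := by
  let N : Submodule ℂ (Sn n ⧸ annIdeal α) := Submodule.span ℂ
    {x | ∃ (r : ℕ) (ks ls : Fin r → Fin n), x = ∏ a, ybar α (ks a) (ls a)}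
  have hN : N ≤ Submodule.span ℂ (Set.range (monoRep (α := α))) := by
    refine Submodule.span_le.2 ?_
    rintro _ ⟨r, ks, ls, rfl⟩
    exact prod_mem_span_monoRep α ks ls
  refine top_le_iff.1 (le_trans ?_ hN)
  rintro x -
  obtain ⟨p, rfl⟩ := Ideal.Quotient.mk_surjective x
  induction p using MvPolynomial.induction_on with
  | C c =>
    have h1 : Ideal.Quotient.mk (annIdeal α) (C c) = c • (1 : Sn n ⧸ annIdeal α) := by
      rw [← mul_one (C c), ← smul_eq_C_mul]; rfl
    rw [h1]
    exact N.smul_mem _ (Submodule.subset_span ⟨0, Fin.elim0, Fin.elim0, by simp⟩)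
  | add p q hp hq => rw [map_add]; exact N.add_mem hp hq
  | mul_X p β hp =>
    rw [map_mul, mk_X_eq_ybar]
    refine Submodule.span_induction (p := fun x _ => x * ybar α β.s β.t ∈ N) ?_ ?_ ?_ ?_ hp
    · rintro _ ⟨r, ks, ls, rfl⟩
      refine Submodule.subset_span ⟨r + 1, Fin.cons β.s ks, Fin.cons β.t ls, ?_⟩
      rw [Fin.prod_univ_succ, mul_comm]
      simp
    · rw [zero_mul]; exact N.zero_mem
    · intro a b _ _ ha hb
      rw [add_mul]; exact N.add_mem ha hb
    · intro c a _ ha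
      rw [smul_mul_assoc]; exact N.smul_mem _ ha

theorem span_monoRep_Mroot (α : PosRoot n) :
    Submodule.span ℂ (Set.range (fun L : PlSet α => (monoRep L : Mroot α))) = ⊤ :=
  span_monoRep α

instance finite_Mroot (α : PosRoot n) : Module.Finite ℂ (Mroot α) :=
  Module.finite_def.2 (Submodule.fg_def.2
    ⟨_, Set.finite_range (fun L : PlSet α => (monoRep L : Mroot α)), span_monoRep_Mroot α⟩)

theorem finrank_Mroot_le (α : PosRoot n) :
    Module.finrank ℂ (Mroot α) ≤ Fintype.card (PlSet α) := by
  have h := finrank_range_le_card (R := ℂ) (fun L : PlSet α => (monoRep L : Mroot α))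
  rwa [Set.finrank, span_monoRep_Mroot, finrank_top] at h

/-! ### The minors as a basis of the dual of `M_α` -/

/-- The functional `p ↦ (p(∂) g)(0)`. -/
def derivPairing (g : Sn n) : Sn n →ₗ[ℂ] ℂ :=
  (basisMonomials (PosRoot n) ℂ).constr ℂ fun ν => (∏ β, (ν β).factorial : ℕ) * coeff ν g

theorem derivPairing_monomial (g : Sn n) (ν : PosRoot n →₀ ℕ) :
    derivPairing g (monomial ν 1) = (∏ β, (ν β).factorial : ℕ) * coeff ν g := by
  have := (basisMonomials (PosRoot n) ℂ).constr_basis ℂ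
    (fun ν => ((∏ β, (ν β).factorial : ℕ) * coeff ν g : ℂ)) ν
  rwa [coe_basisMonomials] at this

theorem derivPairing_one (g : Sn n) : derivPairing g 1 = constantCoeff g := by
  rw [show (1 : Sn n) = monomial 0 1 from rfl, derivPairing_monomial]
  simp [constantCoeff_eq]

theorem derivPairing_add (g h : Sn n) : derivPairing (g + h) = derivPairing g + derivPairing h := by
  refine (basisMonomials (PosRoot n) ℂ).ext fun ν => ?_
  rw [coe_basisMonomials, LinearMap.add_apply, derivPairing_monomial, derivPairing_monomial,
    derivPairing_monomial, coeff_add, mul_add]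

theorem derivPairing_zero : derivPairing (0 : Sn n) = 0 := by
  simpa using derivPairing_add (0 : Sn n) 0

/-- Multiplication by `f_β` is adjoint to `∂_β`. This is what the factorials are for: `(ν + e_β)! =
(ν_β + 1) ν!` matches the factor in `∂_β`. -/
theorem derivPairing_X_mul (g : Sn n) (β : PosRoot n) (p : Sn n) :
    derivPairing g (X β * p) = derivPairing (pderiv β g) p := by
  have h : derivPairing g ∘ₗ LinearMap.mulLeft ℂ (X β) = derivPairing (pderiv β g) := by
    refine (basisMonomials (PosRoot n) ℂ).ext fun ν => ?_
    rw [coe_basisMonomials, LinearMap.comp_apply, LinearMap.mulLeft_apply, X, monomial_mul,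
      one_mul, derivPairing_monomial, derivPairing_monomial, coeff_pderiv,
      add_comm (Finsupp.single β 1) ν]
    have h1 : ∏ γ, ((ν + Finsupp.single β 1 : PosRoot n →₀ ℕ) γ).factorial =
        (ν β + 1) * ∏ γ, (ν γ).factorial := by
      rw [← Finset.mul_prod_erase _ _ (Finset.mem_univ β), ← Finset.mul_prod_erase Finset.univ
        (fun γ => (ν γ).factorial) (Finset.mem_univ β), ← mul_assoc]
      congr 1
      · simp [Nat.factorial_succ]
      · refine Finset.prod_congr rfl fun γ hγ => ?_
        have : β ≠ γ := (Finset.ne_of_mem_erase hγ).symm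
        simp [this]
    rw [h1]
    push_cast
    ring
  exact LinearMap.congr_fun h p

/-- The generators of `permIdeal α`, read as differential operators with constant coefficients,
annihilate the minors. The claim is proved for all multiples `p * q` so that it passes from
generators to the ideal. -/
theorem derivPairing_cellMinor_eq_zero (α : PosRoot n) (L : PlSet α) {p : Sn n}
    (hp : p ∈ annIdeal α) : derivPairing (cellMinor α L.seq) p = 0 := by
  suffices h : ∀ q, derivPairing (cellMinor α L.seq) (p * q) = 0 by simpa using h 1
  refine Submodule.span_induction
    (p := fun p _ => ∀ q, derivPairing (cellMinor α L.seq) (p * q) = 0) ?_ ?_ ?_ ?_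
    (annIdeal_le_permIdeal α hp)
  · rintro _ (⟨β, hβ, rfl⟩ | ⟨k, k', l, l', rfl⟩) q
    · rw [derivPairing_X_mul, pderiv_cellMinor_of_not_below hβ, derivPairing_zero,
        LinearMap.zero_apply]
    · by_cases h : (k ≤ α.s ∧ α.t ≤ l) ∧ (k' ≤ α.s ∧ α.t ≤ l')
      · simp only [Yvar, h.1.1, h.1.2, h.2.1, h.2.2, and_self, dif_pos]
        rw [add_mul, map_add, mul_assoc, mul_assoc, derivPairing_X_mul, derivPairing_X_mul,
          derivPairing_X_mul, derivPairing_X_mul, ← LinearMap.add_apply, ← derivPairing_add,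
          pderiv_comm _ _ (cellMinor α L.seq), add_comm,
          pderiv_comm _ _ (cellMinor α L.seq), add_comm,
          pderiv_pderiv_cellMinor (α := α), derivPairing_zero, LinearMap.zero_apply]
        all_goals first | rfl | exact ⟨h.1.1, h.1.2⟩ | exact ⟨h.2.1, h.2.2⟩
      · rw [perm_eq_zero h, zero_mul, map_zero]
  · intro q; rw [zero_mul, map_zero]
  · intro a b _ _ ha hb q
    rw [add_mul, map_add, ha, hb, add_zero]
  · intro r a _ ha q
    rw [smul_eq_mul, mul_comm r, mul_assoc, ha]

theorem wordAct_fRoot (α : PosRoot n) (l : List (PosRoot n)) :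
    wordAct (fRoot α) (vRoot α) l = toMroot α (l.map X).prod := by
  induction l with
  | nil => rw [wordAct_nil, List.map_nil, List.prod_nil, toMroot_apply, one_smul]
  | cons β l ih =>
    rw [wordAct_cons, ih, List.map_cons, List.prod_cons, toMroot_apply, toMroot_apply, mul_smul]
    rfl

theorem derivPairing_word (g : Sn n) (l : List (PosRoot n)) :
    derivPairing g (l.map X).prod = constantCoeff (wordDeriv l g) := by
  induction l generalizing g with
  | nil => rw [List.map_nil, List.prod_nil, derivPairing_one, wordDeriv_nil]
  | cons β l ih => rw [List.map_cons, List.prod_cons, derivPairing_X_mul, ih, wordDeriv_cons]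

theorem exists_rep_cellMinor (α : PosRoot n) (L : PlSet α) :
    ∃ φ : Module.Dual ℂ (Mroot α), Rep (fRoot α) (vRoot α) φ (cellMinor α L.seq) := by
  let e := (toMroot α).quotKerEquivOfSurjective (toMroot_surjective α)
  refine ⟨(LinearMap.ker (toMroot α)).liftQ (derivPairing (cellMinor α L.seq)) (fun p hp =>
    derivPairing_cellMinor_eq_zero α L (mem_ker_toMroot.1 hp)) ∘ₗ e.symm.toLinearMap, fun l => ?_⟩
  rw [wordAct_fRoot, ← derivPairing_word]
  have h : e.symm (toMroot α (l.map X).prod) = Submodule.Quotient.mk (l.map X).prod :=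
    (LinearEquiv.symm_apply_eq e).2 rfl
  rw [LinearMap.comp_apply, LinearEquiv.coe_coe, h]
  rfl

/-- The coordinate `X_L` as a functional on `M_α`. -/
def rootCoord {α : PosRoot n} (L : PlSet α) : Module.Dual ℂ (Mroot α) :=
  (exists_rep_cellMinor α L).choose

theorem rep_rootCoord {α : PosRoot n} (L : PlSet α) :
    Rep (fRoot α) (vRoot α) (rootCoord L) (cellMinor α L.seq) :=
  (exists_rep_cellMinor α L).choose_spec

theorem linearIndependent_rootCoord (α : PosRoot n) :
    LinearIndependent ℂ (rootCoord (α := α)) := by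
  rw [Fintype.linearIndependent_iff]
  intro c hc
  refine Fintype.linearIndependent_iff.1 (linearIndependent_cellMinor α) c ?_
  have h := Rep.sum Finset.univ fun L _ => (rep_rootCoord (α := α) L).smul (c L)
  rw [hc] at h
  exact h.unique Rep.zero

/-- The two bounds meet here: the coordinates are as many independent functionals as there are sets
`L`, and `finrank_Mroot_le` allows no more. -/
theorem span_rootCoord (α : PosRoot n) :
    Submodule.span ℂ (Set.range (rootCoord (α := α))) = ⊤ := by
  refine (linearIndependent_rootCoord α).span_eq_top_of_card_eq_finrank' ?_
  refine le_antisymm (linearIndependent_rootCoord α).fintype_card_le_finrank ?_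
  rw [Subspace.dual_finrank_eq]
  exact finrank_Mroot_le α

/-- Every functional on `M_α` is represented by a combination of the minors. -/
theorem exists_rep_root {α : PosRoot n} (φ : Module.Dual ℂ (Mroot α)) :
    ∃ c : PlSet α → ℂ, Rep (fRoot α) (vRoot α) φ (∑ L, c L • cellMinor α L.seq) := by
  have h : φ ∈ Submodule.span ℂ (Set.range (rootCoord (α := α))) := by
    rw [span_rootCoord]; trivial
  obtain ⟨c, rfl⟩ := (Submodule.mem_span_range_iff_exists_fun ℂ).1 h
  exact ⟨c, Rep.sum _ fun L _ => (rep_rootCoord L).smul (c L)⟩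

/-! ### The dual spaces of the modules `M_𝐦` -/

/-- Since `f_β` acts on the tensor product by the Leibniz rule, the induction on the word matches
the Leibniz rule for `∂_β` on a product, factor by factor. -/
theorem rep_tprod {m : PosRoot n → ℕ} {φ : (k : Fac m) → Module.Dual ℂ (Mroot k.1)}
    {g : Fac m → Sn n} (h : ∀ k : Fac m, Rep (fRoot k.1) (vRoot k.1) (φ k) (g k)) :
    Rep (fTens m) (vTens m) (PiTensorProduct.dualDistrib (PiTensorProduct.tprod ℂ φ))
      (∏ k, g k) := by
  intro l
  induction l generalizing φ g with
  | nil =>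
    rw [wordAct_nil, wordDeriv_nil, vTens, PiTensorProduct.dualDistrib_apply, map_prod]
    exact Finset.prod_congr rfl fun k _ => h k []
  | cons β l ih =>
    have h1 : PiTensorProduct.dualDistrib (PiTensorProduct.tprod ℂ φ) ∘ₗ fTens m β =
        ∑ k, PiTensorProduct.dualDistrib
          (PiTensorProduct.tprod ℂ (Function.update φ k (φ k ∘ₗ fRoot k.1 β))) := by
      ext x
      simp only [LinearMap.compMultilinearMap_apply, LinearMap.comp_apply, fTens,
        LinearMap.sum_apply, map_sum, PiTensorProduct.map_tprod, PiTensorProduct.dualDistrib_apply]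
      refine Finset.sum_congr rfl fun k _ => Finset.prod_congr rfl fun j _ => ?_
      by_cases hj : j = k
      · subst hj
        rw [if_pos rfl, Function.update_self, LinearMap.comp_apply]
      · rw [if_neg hj, Function.update_of_ne hj, LinearMap.id_apply]
    have h2 := LinearMap.congr_fun h1 (wordAct (fTens m) (vTens m) l)
    rw [LinearMap.comp_apply] at h2
    have h3 : ∀ s : Finset (Fac m), wordDeriv l (∑ k ∈ s, ∏ j, Function.update g k
        (pderiv β (g k)) j) = ∑ k ∈ s, wordDeriv l (∏ j, Function.update g k (pderiv β (g k)) j) := by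
      intro s
      induction s using Finset.induction_on with
      | empty => simpa using wordDeriv_zero l
      | insert a s ha ih => rw [Finset.sum_insert ha, Finset.sum_insert ha, wordDeriv_add, ih]
    rw [wordAct_cons, h2, wordDeriv_cons, derivation_prod, h3, map_sum, LinearMap.sum_apply]
    refine Finset.sum_congr rfl fun k _ => ih fun j => ?_
    by_cases hj : j = k
    · subst hj
      rw [Function.update_self, Function.update_self]
      exact (h j).comp β
    · rw [Function.update_of_ne hj, Function.update_of_ne hj]
      exact h j

theorem coe_wordAct_fM (m : PosRoot n → ℕ) (l : List (PosRoot n)) :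
    ((wordAct (fM m) (vM m) l : M m) : Tens m) = wordAct (fTens m) (vTens m) l := by
  induction l with
  | nil => rfl
  | cons β l ih => rw [wordAct_cons, wordAct_cons, ← ih]; rfl

theorem Rep.restrict {m : PosRoot n → ℕ} {φ : Module.Dual ℂ (Tens m)} {g : Sn n}
    (h : Rep (fTens m) (vTens m) φ g) : Rep (fM m) (vM m) (φ ∘ₗ (M m).subtype) g := fun l => by
  rw [← h l, ← coe_wordAct_fM]
  rfl

theorem span_wordAct_fM (m : PosRoot n → ℕ) :
    Submodule.span ℂ (Set.range (wordAct (fM m) (vM m))) = ⊤ := by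
  have h : M m ≤ (Submodule.span ℂ (Set.range (wordAct (fM m) (vM m)))).map (M m).subtype := by
    refine M_le ⟨vM m, Submodule.subset_span ⟨[], rfl⟩, rfl⟩ ?_
    rintro β _ ⟨x, hx, rfl⟩
    refine ⟨fM m β x, ?_, rfl⟩
    refine Submodule.span_induction (p := fun x _ => fM m β x ∈
      Submodule.span ℂ (Set.range (wordAct (fM m) (vM m)))) ?_ ?_ ?_ ?_ hx
    · rintro _ ⟨l, rfl⟩
      exact Submodule.subset_span ⟨β :: l, rfl⟩
    · rw [map_zero]; exact zero_mem _
    · intro a b _ _ ha hb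
      rw [map_add]; exact add_mem ha hb
    · intro c a _ ha
      rw [map_smul]; exact Submodule.smul_mem _ c ha
  refine top_le_iff.1 ?_
  rintro x -
  obtain ⟨y, hy, hxy⟩ := h x.2
  rwa [← Subtype.ext hxy]

theorem dualMul_comp_fM {m m' : PosRoot n → ℕ} (φ : MDual m) (ψ : MDual m') (β : PosRoot n) :
    dualMul φ ψ ∘ₗ fM (m + m') β = dualMul (φ ∘ₗ fM m β) ψ + dualMul φ (ψ ∘ₗ fM m' β) := by
  have h1 : ∀ y, TensorProduct.dualDistrib ℂ (M m) (M m') (φ ⊗ₜ ψ)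
      (TensorProduct.map (fM m β) LinearMap.id y) =
        TensorProduct.dualDistrib ℂ (M m) (M m') ((φ ∘ₗ fM m β) ⊗ₜ ψ) y := fun y => by
    induction y with
    | zero => simp
    | tmul a b => simp
    | add a b ha hb => simp only [map_add, ha, hb]
  have h2 : ∀ y, TensorProduct.dualDistrib ℂ (M m) (M m') (φ ⊗ₜ ψ)
      (TensorProduct.map LinearMap.id (fM m' β) y) =
        TensorProduct.dualDistrib ℂ (M m) (M m') (φ ⊗ₜ (ψ ∘ₗ fM m' β)) y := fun y => by
    induction y with
    | zero => simp
    | tmul a b => simp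
    | add a b ha hb => simp only [map_add, ha, hb]
  refine LinearMap.ext fun x => ?_
  simp only [dualMul, LinearMap.comp_apply, LinearMap.add_apply]
  rw [emb_fM, map_add, h1, h2]

theorem rep_dualMul {m m' : PosRoot n → ℕ} {φ : MDual m} {ψ : MDual m'} {g h : Sn n}
    (h1 : Rep (fM m) (vM m) φ g) (h2 : Rep (fM m') (vM m') ψ h) :
    Rep (fM (m + m')) (vM (m + m')) (dualMul φ ψ) (g * h) := by
  intro l
  induction l generalizing φ ψ g h with
  | nil =>
    rw [wordAct_nil, wordDeriv_nil, map_mul]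
    have := h1 []
    have := h2 []
    simp_all [dualMul, emb_vM]
  | cons β l ih =>
    have h3 := LinearMap.congr_fun (dualMul_comp_fM φ ψ β) (wordAct (fM (m + m')) (vM (m + m')) l)
    rw [LinearMap.comp_apply, LinearMap.add_apply] at h3
    rw [wordAct_cons, h3, wordDeriv_cons, pderiv_mul, wordDeriv_add, map_add, ih (h1.comp β) h2,
      ih h1 (h2.comp β)]

theorem sum_varDeg (m : PosRoot n → ℕ) : ∑ k : Fac m, Pi.single k.1 1 = m := by
  rw [Fintype.sum_sigma]
  funext α
  simp [Finset.sum_apply, Pi.single_apply]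

theorem toCell_X (k : PlIdx n) : toCell n (X k) = cellMinor k.1 k.2.seq := by
  rw [toCell, aeval_X]

/-- A functional on `M_𝐦` extends to the whole tensor product. There, by finite dimensionality, it
is a sum of pure tensors of functionals, each factor giving a linear form in the Plücker variables.
-/
theorem exists_rep {m : PosRoot n → ℕ} (φ : MDual m) :
    ∃ F ∈ CXpiece m, Rep (fM m) (vM m) φ (toCell n F) := by
  obtain ⟨φ', rfl⟩ := LinearMap.exists_extend φ
  suffices h : ∃ F ∈ CXpiece m, Rep (fTens m) (vTens m) φ' (toCell n F) by
    obtain ⟨F, hF, h⟩ := h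
    exact ⟨F, hF, h.restrict⟩
  obtain ⟨t, rfl⟩ :=
    (PiTensorProduct.dualDistribEquiv (R := ℂ) (M := fun k : Fac m => Mroot k.1)).surjective φ'
  change ∃ F ∈ CXpiece m, Rep (fTens m) (vTens m) (PiTensorProduct.dualDistrib t) (toCell n F)
  have ht : t ∈ Submodule.span ℂ (Set.range
      (PiTensorProduct.tprod ℂ (s := fun k : Fac m => Module.Dual ℂ (Mroot k.1)))) := by
    rw [PiTensorProduct.span_tprod_eq_top]; trivial
  refine Submodule.span_induction (p := fun t _ => ∃ F ∈ CXpiece m, Rep (fTens m) (vTens m)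
    (PiTensorProduct.dualDistrib t) (toCell n F)) ?_ ?_ ?_ ?_ ht
  · rintro _ ⟨φ, rfl⟩
    choose c hc using fun k => exists_rep_root (φ k)
    refine ⟨∏ k : Fac m, ∑ L, c k L • X ⟨k.1, L⟩, ?_, ?_⟩
    · have h := IsWeightedHomogeneous.prod (w := varDeg) Finset.univ
        (fun k : Fac m => ∑ L, c k L • (X ⟨k.1, L⟩ : CX n)) (fun k => Pi.single k.1 1)
        (fun k _ => Submodule.sum_mem (weightedHomogeneousSubmodule ℂ varDeg (Pi.single k.1 1))
          fun L _ => Submodule.smul_mem _ _ (isWeightedHomogeneous_X ℂ varDeg ⟨k.1, L⟩))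
      rwa [sum_varDeg] at h
    · rw [map_prod]
      simp only [map_sum, map_smul, toCell_X]
      exact rep_tprod hc
  · exact ⟨0, zero_mem _, by rw [map_zero, map_zero]; exact Rep.zero⟩
  · rintro a b - - ⟨F, hF, h⟩ ⟨G, hG, h'⟩
    exact ⟨F + G, add_mem hF hG, by rw [map_add, map_add]; exact h.add h'⟩
  · rintro c a - ⟨F, hF, h⟩
    exact ⟨c • F, Submodule.smul_mem _ c hF, by rw [map_smul, map_smul]; exact h.smul c⟩

theorem exists_dual_prod (m : PosRoot n → ℕ) (L : (k : Fac m) → PlSet k.1) :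
    ∃ φ : MDual m, Rep (fM m) (vM m) φ (∏ k, cellMinor k.1 (L k).seq) :=
  ⟨_, (rep_tprod fun k => rep_rootCoord (L k)).restrict⟩

theorem exists_dual_X (k : PlIdx n) :
    ∃ φ : MDual (varDeg k), Rep (fM (varDeg k)) (vM (varDeg k)) φ (toCell n (X k)) := by
  obtain ⟨α, L₀⟩ := k
  -- For the multi-degree of one variable there is a single tensor factor, at `α`; the value
  -- `topSet` elsewhere only completes the family.
  obtain ⟨φ, hφ⟩ := exists_dual_prod (varDeg ⟨α, L₀⟩)
    fun k => if h : α = k.1 then h ▸ L₀ else topSet k.1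
  refine ⟨φ, ?_⟩
  convert hφ
  rw [Fintype.prod_sigma, toCell_X, Finset.prod_eq_single α]
  · simp only [dif_pos, Finset.prod_const, Finset.card_univ, Fintype.card_fin]
    rw [show varDeg ⟨α, L₀⟩ α = 1 from Pi.single_eq_same _ _, pow_one]
  · intro α' _ h
    refine Finset.prod_eq_one fun i _ => ?_
    have := i.2
    simp [varDeg, h] at this
  · simp

theorem exists_dual_monomial (e : PlIdx n →₀ ℕ) (c : ℂ) :
    ∃ (m : PosRoot n → ℕ) (φ : MDual m), monomial e c ∈ CXpiece m ∧
      Rep (fM m) (vM m) φ (toCell n (monomial e c)) := by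
  refine induction_on_monomial (motive := fun p : CX n => ∃ (m : PosRoot n → ℕ) (φ : MDual m),
    p ∈ CXpiece m ∧ Rep (fM m) (vM m) φ (toCell n p)) (fun c => ?_) ?_ e c
  · obtain ⟨φ, hφ⟩ := exists_dual_prod (n := n) 0 fun k => topSet k.1
    refine ⟨0, c • φ, isWeightedHomogeneous_C _ _, ?_⟩
    have h := hφ.smul c
    rw [Finset.prod_eq_one fun k _ => k.2.elim0, smul_eq_C_mul, mul_one] at h
    simpa [toCell] using h
  · rintro p k ⟨m, φ, hp, h⟩
    obtain ⟨ψ, hψ⟩ := exists_dual_X k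
    refine ⟨m + varDeg k, dualMul φ ψ, IsWeightedHomogeneous.mul hp
      (isWeightedHomogeneous_X ℂ varDeg k), ?_⟩
    rw [map_mul]
    exact rep_dualMul h hψ

/-- The converse of `exists_rep`: the two lemmas identify the polynomials coming from `M_𝐦^*` with
the restrictions of `ℂ𝐗_𝐦` to the cell. -/
theorem exists_dual {m : PosRoot n → ℕ} {F : CX n} (hF : F ∈ CXpiece m) :
    ∃ φ : MDual m, Rep (fM m) (vM m) φ (toCell n F) := by
  refine IsWeightedHomogeneous.induction_on (R := ℂ) (w := varDeg (n := n)) (m := m)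
    (motive := fun F _ => ∃ φ : MDual m, Rep (fM m) (vM m) φ (toCell n F)) ?_ ?_ ?_ hF
  · exact ⟨0, by rw [map_zero]; exact Rep.zero⟩
  · rintro p q - - ⟨φ, h⟩ ⟨ψ, h'⟩
    exact ⟨φ + ψ, by rw [map_add]; exact h.add h'⟩
  · intro d c hd
    by_cases hc : c = 0
    · subst hc
      exact ⟨0, by rw [monomial_zero, map_zero]; exact Rep.zero⟩
    obtain ⟨m', φ, h, hφ⟩ := exists_dual_monomial d c
    -- The multi-degree found for the monomial must be `m`, because a nonzero monomial has only one
    -- multi-degree.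
    obtain rfl := IsWeightedHomogeneous.inj_right (monomial_eq_zero.not.2 hc) h
      (isWeightedHomogeneous_monomial _ d c hd)
    exact ⟨φ, hφ⟩

/-- The polynomial function on the open cell which represents a functional on `M_𝐦`. -/
def dualToCell (m : PosRoot n → ℕ) : MDual m →ₗ[ℂ] Sn n where
  toFun φ := toCell n (exists_rep φ).choose
  map_add' φ ψ := (exists_rep (φ + ψ)).choose_spec.2.unique
    ((exists_rep φ).choose_spec.2.add (exists_rep ψ).choose_spec.2)
  map_smul' c φ := (exists_rep (c • φ)).choose_spec.2.unique
    ((exists_rep φ).choose_spec.2.smul c)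

theorem rep_dualToCell {m : PosRoot n → ℕ} (φ : MDual m) :
    Rep (fM m) (vM m) φ (dualToCell m φ) := (exists_rep φ).choose_spec.2

theorem dualToCell_injective (m : PosRoot n → ℕ) : Function.Injective (dualToCell m) :=
  fun φ ψ h => (rep_dualToCell φ).ext (h ▸ rep_dualToCell ψ) (span_wordAct_fM m)

theorem dualToCell_dualMul {m m' : PosRoot n → ℕ} (φ : MDual m) (ψ : MDual m') :
    dualToCell (m + m') (dualMul φ ψ) = dualToCell m φ * dualToCell m' ψ :=
  (rep_dualToCell _).unique (rep_dualMul (rep_dualToCell φ) (rep_dualToCell ψ))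

theorem dualToCell_fMDual {m : PosRoot n → ℕ} (β : PosRoot n) (φ : MDual m) :
    dualToCell m (fMDual m β φ) = - pderiv β (dualToCell m φ) := by
  have h : fMDual m β φ = (-1 : ℂ) • (φ ∘ₗ fM m β) := by
    refine LinearMap.ext fun x => ?_
    simp [fMDual]
  rw [h, map_smul, neg_smul, one_smul]
  congr 1
  exact (rep_dualToCell _).unique ((rep_dualToCell φ).comp β)

theorem exists_dualToCell_eq {m : PosRoot n → ℕ} {F : CX n} (hF : F ∈ CXpiece m) :
    ∃ φ, dualToCell m φ = toCell n F := by
  obtain ⟨φ, hφ⟩ := exists_dual hF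
  exact ⟨φ, (rep_dualToCell φ).unique hφ⟩

theorem exists_toCell_eq {m : PosRoot n → ℕ} (φ : MDual m) :
    ∃ F ∈ CXpiece m, toCell n F = dualToCell m φ :=
  ⟨_, (exists_rep φ).choose_spec.1, rfl⟩

instance finite_M (m : PosRoot n → ℕ) : Module.Finite ℂ (M m) := inferInstance

/-! ### Homogeneous coordinates of the points of `R_n` -/

/-- The top exterior power is a line, with coordinate `b.det`: an alternating map is determined by
its value on the basis, and permuting the basis changes both sides by the same sign. -/
theorem exteriorPower_eq_smul {V : Type*} [AddCommGroup V] [Module ℂ V] {r : ℕ}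
    (b : Module.Basis (Fin r) ℂ V) (y : ⋀[ℂ]^r V) :
    ∃ c : ℂ, y = c • exteriorPower.ιMulti ℂ r b := by
  refine ⟨exteriorPower.alternatingMapLinearEquiv b.det y, ?_⟩
  have h : LinearMap.id = (exteriorPower.alternatingMapLinearEquiv b.det).smulRight
      (exteriorPower.ιMulti ℂ r b) := by
    refine exteriorPower.linearMap_ext (b.ext_alternating fun v hv => ?_)
    obtain ⟨σ, rfl⟩ : ∃ σ : Equiv.Perm (Fin r), v = σ :=
      ⟨Equiv.ofBijective v (Finite.injective_iff_bijective.1 hv), rfl⟩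
    have h1 := (exteriorPower.ιMulti ℂ r (M := V)).map_perm b σ
    have h2 := b.det.map_perm b σ
    simp only [LinearMap.compAlternatingMap_apply, LinearMap.id_apply,
      LinearMap.smulRight_apply, exteriorPower.alternatingMapLinearEquiv_apply_ιMulti]
    change (exteriorPower.ιMulti ℂ r) (⇑b ∘ ⇑σ) = b.det (⇑b ∘ ⇑σ) • _
    rw [h1, h2, b.det_self, Units.smul_def, Units.smul_def, zsmul_one]
    exact (Int.cast_smul_eq_zsmul ℂ _ _).symm
  exact LinearMap.congr_fun h y

theorem mem_W_iff {α : PosRoot n} {u : Fin n → ℂ} :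
    u ∈ W α ↔ ∀ l, ¬ α.Allowed l → u l = 0 := by
  constructor
  · intro hu l hl
    refine Submodule.span_induction (p := fun u _ => u l = 0) ?_ rfl ?_ ?_ hu
    · rintro _ ⟨k, hk, rfl⟩
      have : l ≠ k := fun h => hl (h ▸ hk)
      simp [this]
    · intro a b _ _ ha hb
      simp [ha, hb]
    · intro c a _ ha
      simp [ha]
  · intro h
    rw [pi_eq_sum_univ' u]
    refine Submodule.sum_mem _ fun l _ => ?_
    by_cases hl : α.Allowed l
    · refine Submodule.smul_mem _ _ (Submodule.subset_span ⟨l, hl, ?_⟩)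
      funext j
      simp [Pi.single_apply]
    · rw [h l hl, zero_smul]
      exact zero_mem _

theorem plCoord_ιMulti {α : PosRoot n} (L : PlSet α) (w : Fin α.rk → W α) :
    plCoord L (exteriorPower.ιMulti ℂ α.rk w) =
      (Matrix.of fun k r => (w k : Fin n → ℂ) (L.seq r)).det := by
  rw [plCoord, exteriorPower.alternatingMapLinearEquiv_apply_ιMulti]
  rfl

theorem range_map_inclusion {α : PosRoot n} {V : Submodule ℂ (Fin n → ℂ)} (hV : V ≤ W α)
    (b : Module.Basis (Fin α.rk) ℂ V) :
    LinearMap.range (exteriorPower.map α.rk (Submodule.inclusion hV)) =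
      Submodule.span ℂ {exteriorPower.ιMulti ℂ α.rk fun k => Submodule.inclusion hV (b k)} := by
  refine le_antisymm ?_ ?_
  · rintro _ ⟨y, rfl⟩
    obtain ⟨c, rfl⟩ := exteriorPower_eq_smul b y
    rw [map_smul, exteriorPower.map_apply_ιMulti]
    exact Submodule.smul_mem _ _ (Submodule.subset_span rfl)
  · rw [Submodule.span_singleton_le_iff_mem]
    exact ⟨exteriorPower.ιMulti ℂ α.rk b, exteriorPower.map_apply_ιMulti _ _⟩

/-- By the dimension count any spanning matrix with `i` rows has a basis of `V_{i,j}` as its rows.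
Its maximal minors are then the Plücker coordinates up to the choice of a vector on the line. -/
theorem exists_plCoord_eq {V : PosRoot n → Submodule ℂ (Fin n → ℂ)} (hV : IsRPoint V)
    {x : (α : PosRoot n) → Projectivization ℂ (ExtW α)}
    (hx : ∀ α, (x α).submodule =
      LinearMap.range (exteriorPower.map α.rk (Submodule.inclusion (hV.le_W α))))
    {u : (α : PosRoot n) → ExtW α} (hu : ∀ α, u α ≠ 0)
    (hux : ∀ α, Projectivization.mk ℂ (u α) (hu α) = x α)
    {B : (α : PosRoot n) → Matrix (Fin α.rk) (Fin n) ℂ}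
    (hB : ∀ α, V α = Submodule.span ℂ (Set.range (B α))) (α : PosRoot n) :
    ∃ t : ℂ, ∀ L : PlSet α, plCoord L (u α) = t * ((B α).submatrix id L.seq).det := by
  have hmem : ∀ k, B α k ∈ V α := fun k => by
    rw [hB]; exact Submodule.subset_span ⟨k, rfl⟩
  let w : Fin α.rk → V α := fun k => ⟨B α k, hmem k⟩
  have hspan : ⊤ ≤ Submodule.span ℂ (Set.range w) := by
    have h := hB α
    rintro y -
    have hy : (y : Fin n → ℂ) ∈ Submodule.span ℂ (Set.range (B α)) := h ▸ y.2
    obtain ⟨c, hc⟩ := (Submodule.mem_span_range_iff_exists_fun ℂ).1 hy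
    refine (Submodule.mem_span_range_iff_exists_fun ℂ).2 ⟨c, Subtype.ext ?_⟩
    rw [← hc]
    simp [w]
  let b : Module.Basis (Fin α.rk) ℂ (V α) := basisOfTopLeSpanOfCardEqFinrank w hspan
    (by rw [Fintype.card_fin, hV.finrank_eq])
  have h1 : u α ∈ (x α).submodule := by
    rw [← hux, Projectivization.submodule_mk]
    exact Submodule.mem_span_singleton_self _
  rw [hx, range_map_inclusion (hV.le_W α) b, Submodule.mem_span_singleton] at h1
  obtain ⟨t, ht⟩ := h1
  refine ⟨t, fun L => ?_⟩
  rw [← ht, map_smul, plCoord_ιMulti, smul_eq_mul]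
  congr 2
  ext k r
  simp [b, w]

theorem eval_scale {m : PosRoot n → ℕ} {F : CX n} (hF : F ∈ CXpiece m) (t : PosRoot n → ℂ)
    (y : PlIdx n → ℂ) :
    eval (fun k : PlIdx n => t k.1 * y k) F = (∏ α, t α ^ m α) * eval y F := by
  refine IsWeightedHomogeneous.induction_on (R := ℂ) (w := varDeg (n := n)) (m := m)
    (motive := fun F _ => eval (fun k : PlIdx n => t k.1 * y k) F =
      (∏ α, t α ^ m α) * eval y F) ?_ ?_ ?_ hF
  · simp
  · intro p q _ _ hp hq
    rw [map_add, map_add, hp, hq, mul_add]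
  · intro d c hd
    have h1 : ∀ d : PlIdx n →₀ ℕ, (d.prod fun k e => t k.1 ^ e) =
        ∏ α, t α ^ (Finsupp.weight varDeg d α) := fun d => by
      induction d using Finsupp.induction_linear with
      | zero => simp
      | add d e hd he =>
        rw [Finsupp.prod_add_index' (by simp) (by simp [pow_add]), hd, he, map_add,
          ← Finset.prod_mul_distrib]
        simp only [Pi.add_apply, pow_add]
      | single k e =>
        rw [Finsupp.prod_single_index (by simp), Finsupp.weight_single,
          Finset.prod_eq_single k.1]
        · simp [varDeg]
        · intro α _ hα
          simp [varDeg, hα]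
        · simp
    rw [eval_monomial, eval_monomial, ← hd, ← h1]
    simp only [mul_pow, Finsupp.prod_mul]
    ring

/-! ### The open cell of `R_n` -/

theorem Ymat_mem_W (x : PosRoot n → ℂ) (α : PosRoot n) (k : Fin α.rk) : Ymat x α k ∈ W α :=
  mem_W_iff.2 fun _ hl => Ymat_of_not_allowed x α k hl

theorem linearIndependent_Ymat (x : PosRoot n → ℂ) (α : PosRoot n) :
    LinearIndependent ℂ (Ymat x α) := by
  refine Fintype.linearIndependent_iff.2 fun c hc k => ?_
  have h := congrFun hc (rowIdx α k)
  simpa [Finset.sum_apply, Ymat_of_le, rowIdx_le, (rowIdx_injective α).eq_iff] using h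

/-- The rows for `(i,j)` are among those for `(i+1,j)`, and erasing the coordinate `w_{j+1}` from a
row for `(i,j)` gives the row of the same index for `(i,j+1)`. -/
theorem isRPoint_span_Ymat (x : PosRoot n → ℂ) :
    IsRPoint fun α : PosRoot n => Submodule.span ℂ (Set.range (Ymat x α)) where
  finrank_eq α := by
    rw [finrank_span_eq_card (linearIndependent_Ymat x α), Fintype.card_fin]
  le_W α := by
    rw [Submodule.span_le]
    rintro _ ⟨k, rfl⟩
    exact Ymat_mem_W x α k
  le_succ α β hs ht := by
    rw [Submodule.span_le]
    rintro _ ⟨k, rfl⟩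
    refine Submodule.subset_span ⟨⟨k, k.2.trans (by simp only [PosRoot.rk, hs]; omega)⟩, ?_⟩
    funext l
    simp only [Ymat, ht]
    rfl
  pr_le α β hs ht := by
    rw [Submodule.map_span_le]
    rintro _ ⟨k, rfl⟩
    refine Submodule.subset_span ⟨⟨k, k.2.trans_le (by simp only [PosRoot.rk, hs]; omega)⟩, ?_⟩
    funext l
    have hpr : pr α.t (Ymat x α k) l = if l = α.t then 0 else Ymat x α k l := by
      by_cases h : l = α.t
      · subst h; simp [pr]
      · simp [pr, h]
    rw [hpr]
    by_cases h : l = α.t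
    · rw [if_pos h, Ymat_of_not_allowed]
      subst h
      rw [PosRoot.Allowed, hs, not_or, not_le, not_le]
      exact ⟨α.2, Fin.lt_def.2 (by omega)⟩
    · rw [if_neg h]
      have h1 : β.t ≤ l ↔ α.t ≤ l := by
        rw [Fin.le_def, Fin.le_def, ht]
        have : (l : ℕ) ≠ α.t := fun h' => h (Fin.ext h')
        omega
      simp only [Ymat, h1]
      rfl

/-- The vector `(w_1 + ⋯) ∧ ⋯ ∧ (w_i + ⋯)` of the point of the open cell. -/
def cellVec (x : PosRoot n → ℂ) (α : PosRoot n) : ExtW α :=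
  exteriorPower.ιMulti ℂ α.rk fun k => ⟨Ymat x α k, Ymat_mem_W x α k⟩

theorem plCoord_cellVec (x : PosRoot n → ℂ) {α : PosRoot n} (L : PlSet α) :
    plCoord L (cellVec x α) = aeval x (cellMinor α L.seq) := by
  rw [cellVec, plCoord_ιMulti, aeval_cellMinor]
  rfl

theorem PlSet.seq_topSet (α : PosRoot n) : (topSet α).seq = rowIdx α := by
  have h := Finset.orderEmbOfFin_unique (topSet α).2.1 (f := rowIdx α)
    (fun k => Finset.mem_Iic.2 (rowIdx_le α k)) fun a b hab => hab
  exact h.symm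

theorem cellMinor_rowIdx (α : PosRoot n) : cellMinor α (rowIdx α) = 1 := by
  rw [cellMinor]
  convert Matrix.det_one (n := Fin α.rk) (R := Sn n)
  ext a b
  simp [Ymat_of_le, rowIdx_le, (rowIdx_injective α).eq_iff, Matrix.one_apply]

theorem cellVec_ne_zero (x : PosRoot n → ℂ) (α : PosRoot n) : cellVec x α ≠ 0 := by
  intro h
  have h1 := plCoord_cellVec x (topSet α)
  rw [h, map_zero, PlSet.seq_topSet, cellMinor_rowIdx, map_one] at h1
  exact zero_ne_one h1

theorem mk_cellVec_mem_R (x : PosRoot n → ℂ) :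
    (fun α => Projectivization.mk ℂ (cellVec x α) (cellVec_ne_zero x α)) ∈ R n := by
  refine ⟨_, isRPoint_span_Ymat x, fun α => ?_⟩
  rw [Projectivization.submodule_mk, range_map_inclusion _
    (Module.Basis.span (linearIndependent_Ymat x α))]
  congr 2
  rw [cellVec]
  congr 1
  funext k
  refine Subtype.ext ?_
  exact (Module.Basis.coe_span_apply (linearIndependent_Ymat x α) k).symm

theorem toCell_eq_zero_of_vanishes {F : CX n} (h : ∀ x ∈ R n, VanishesAt F x) :
    toCell n F = 0 := by
  refine MvPolynomial.funext fun x => ?_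
  have h1 := h _ (mk_cellVec_mem_R x) (cellVec x) (cellVec_ne_zero x) fun _ => rfl
  simp only [plCoord_cellVec] at h1
  rw [map_zero, ← h1, toCell, ← coe_aeval_eq_eval, ← coe_aeval_eq_eval]
  change aeval x (aeval _ F) = aeval _ F
  rw [← AlgHom.comp_apply, comp_aeval]

/-! ### Density of the open cell -/

section Flow

variable {A : Type*} [CommRing A]

/-- The standard basis vectors, indexed by natural numbers. -/
def stdVec (n : ℕ) (A : Type*) [CommRing A] (j : ℕ) : Fin n → A :=
  fun l => if (l : ℕ) = j then 1 else 0

/-- Vectors that span the components of a point of `R_n`, with arbitrary parameters: for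
`r = n - t` the vectors with indices `≤ s` span the component of the root `(s, t)`. -/
def flow (n : ℕ) (c : ℕ → ℕ → ℕ → A) (d : ℕ → ℕ → A) : ℕ → ℕ → Fin n → A
  | 0, s => stdVec n A s
  | r + 1, s => ∑ k ∈ Finset.range (s + 1), c r s k • flow n c d r k +
      d r s • stdVec n A (n - 1 - r)

variable {c : ℕ → ℕ → ℕ → A} {d : ℕ → ℕ → A}

theorem flow_succ (r s : ℕ) : flow n c d (r + 1) s =
    ∑ k ∈ Finset.range (s + 1), c r s k • flow n c d r k + d r s • stdVec n A (n - 1 - r) := rfl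

theorem flow_succ_apply (r s : ℕ) {l : Fin n} (h : (l : ℕ) ≠ n - 1 - r) :
    flow n c d (r + 1) s l = ∑ k ∈ Finset.range (s + 1), c r s k * flow n c d r k l := by
  simp [flow_succ, stdVec, h, Finset.sum_apply]

/-- At level `r` only the basis vectors with index `≥ n - r` have been added, so the `s`-th vector
is supported on indices `≤ s` and `≥ n - r`. -/
theorem flow_eq_zero {r s : ℕ} {l : Fin n} (h : s < l) (h' : (l : ℕ) < n - r) :
    flow n c d r s l = 0 := by
  induction r generalizing s with
  | zero => simp [flow, stdVec, h.ne']
  | succ r ih =>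
    rw [flow_succ_apply _ _ (by omega)]
    refine Finset.sum_eq_zero fun k hk => ?_
    rw [ih _ (by omega), mul_zero]
    have := Finset.mem_range.1 hk
    omega

theorem map_flow {B : Type*} [CommRing B] (f : A →+* B) (r s : ℕ) (l : Fin n) :
    f (flow n c d r s l) = flow n (fun r s k => f (c r s k)) (fun r s => f (d r s)) r s l := by
  induction r generalizing s with
  | zero => simp [flow, stdVec, apply_ite f]
  | succ r ih => simp [flow_succ, Finset.sum_apply, ih, stdVec, apply_ite f]

theorem flow_one (r s : ℕ) : flow n (fun _ s k => if k = s then (1 : A) else 0) (fun _ _ => 0) r s =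
    stdVec n A s := by
  induction r generalizing s with
  | zero => rfl
  | succ r ih => simp [flow_succ, ih]

/-- The matrix with rows `flow n c d (n - t) k`, `k ≤ s`. -/
def flowMat (c : ℕ → ℕ → ℕ → A) (d : ℕ → ℕ → A) (α : PosRoot n) : Matrix (Fin α.rk) (Fin n) A :=
  Matrix.of fun k l => flow n c d (n - α.t) k l

end Flow

theorem flowMat_eq_zero {c : ℕ → ℕ → ℕ → ℂ} {d : ℕ → ℕ → ℂ} {α : PosRoot n} {k : Fin α.rk}
    {l : Fin n} (h : (k : ℕ) < l) (h' : l < α.t) : flowMat c d α k l = 0 := by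
  refine flow_eq_zero h ?_
  have := α.t.2
  have := Fin.lt_def.1 h'
  omega

/-- The relation between the rows and the coordinates of the cell propagates along `flow`. -/
theorem flow_eq_sum {c : ℕ → ℕ → ℕ → ℂ} {d : ℕ → ℕ → ℂ} {y : Fin n → ℂ} {l : Fin n}
    (h : ∀ s < (l : ℕ), flow n c d (n - l) s l =
      ∑ k : Fin n, if (k : ℕ) ≤ s then flow n c d (n - l) s k * y k else 0)
    {r : ℕ} (hr : n - l ≤ r) {s : ℕ} (hs : s < n - r) :
    flow n c d r s l = ∑ k : Fin n, if (k : ℕ) ≤ s then flow n c d r s k * y k else 0 := by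
  induction r, hr using Nat.le_induction generalizing s with
  | base => exact h s (by omega)
  -- Past the level where `w_l` is added, entries are transported by the linear combinations alone,
  -- so the coefficients `y` do not change with `r`. Extending the sum from `k ≤ j` to `k ≤ s` adds
  -- only zero entries.
  | succ r hr ih =>
    rw [flow_succ_apply _ _ (by omega)]
    have h1 : ∀ j ∈ Finset.range (s + 1), c r s j * flow n c d r j l =
        ∑ k : Fin n, if (k : ℕ) ≤ s then c r s j * flow n c d r j k * y k else 0 := by
      intro j hj
      have hj' := Finset.mem_range.1 hj
      rw [ih (by omega), Finset.mul_sum]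
      refine Finset.sum_congr rfl fun k _ => ?_
      by_cases hk : (k : ℕ) ≤ j
      · rw [if_pos hk, if_pos (by omega), mul_assoc]
      · rw [if_neg hk, mul_zero]
        split_ifs with hk'
        · rw [flow_eq_zero (by omega) (by omega), mul_zero, zero_mul]
        · rfl
    rw [Finset.sum_congr rfl h1, Finset.sum_comm]
    refine Finset.sum_congr rfl fun k _ => ?_
    by_cases hk : (k : ℕ) ≤ s
    · simp only [if_pos hk]
      rw [flow_succ_apply _ _ (by omega), Finset.sum_mul]
    · simp only [if_neg hk, Finset.sum_const_zero]

theorem sum_rowIdx {α : PosRoot n} (g : Fin n → ℂ) (hg : ∀ l, α.s < l → g l = 0) :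
    ∑ k, g (rowIdx α k) = ∑ l, g l := by
  refine (Finset.sum_map Finset.univ ⟨rowIdx α, rowIdx_injective α⟩ g).symm.trans
    (Finset.sum_subset (Finset.subset_univ _) fun l _ hl => hg l ?_)
  by_contra hc
  obtain ⟨k, rfl⟩ := exists_rowIdx α (not_lt.1 hc)
  exact hl (Finset.mem_map_of_mem _ (Finset.mem_univ k))

/-- If the leading minors of the matrices `flowMat` do not vanish, then the corresponding point is
in the open cell. -/
theorem exists_flowMat_eq {c : ℕ → ℕ → ℕ → ℂ} {d : ℕ → ℕ → ℂ}
    (hdet : ∀ α : PosRoot n, ((flowMat c d α).submatrix id (rowIdx α)).det ≠ 0) :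
    ∃ (x t : PosRoot n → ℂ), ∀ α : PosRoot n, ∀ q : Fin α.rk → Fin n,
      ((flowMat c d α).submatrix id q).det = t α * aeval x (cellMinor α q) := by
  have hallow : ∀ (α : PosRoot n) (k : Fin α.rk) (l : Fin n), ¬ α.Allowed l →
      flowMat c d α k l = 0 := fun α k l hl =>
    flowMat_eq_zero ((Fin.le_def.1 (rowIdx_le α k)).trans_lt (Fin.lt_def.1 (not_le.1 fun h => hl (Or.inl h))))
      (not_le.1 fun h => hl (Or.inr h))
  have hcol : ∀ l : Fin n, ∃ y : Fin n → ℂ, ∀ s < (l : ℕ), flow n c d (n - l) s l =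
      ∑ k : Fin n, if (k : ℕ) ≤ s then flow n c d (n - l) s k * y k else 0 := by
    intro l
    rcases Nat.eq_zero_or_pos (l : ℕ) with hl | hl
    · exact ⟨0, fun s hs => by omega⟩
    -- Column `l` first carries a coordinate at level `n - l`, whose largest leading block has `l`
    -- rows and belongs to the root `(l - 1, l)`. Inverting it determines the coordinates `y` of
    -- column `l`; triangularity of the block restricts the sum to `k ≤ s`.
    let α : PosRoot n := ⟨(⟨l - 1, by have := l.2; omega⟩, l), Fin.lt_def.2 (by simp; omega)⟩
    refine ⟨fun k => if h : k < l then Ymat (cellCoord α (flowMat c d α)) α ⟨k, by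
      have := Fin.lt_def.1 h
      simp only [α, PosRoot.rk]; omega⟩ l else 0, fun s hs => ?_⟩
    have h := eq_mul_Ymat (hallow α) (hdet α)
    have h1 := congrFun (congrFun h ⟨s, by simp only [α, PosRoot.rk]; omega⟩) l
    refine h1.trans ?_
    rw [Matrix.mul_apply]
    have h2 := sum_rowIdx (α := α) (fun k => if (k : ℕ) ≤ s then flow n c d (n - l) s k *
      (if h : k < l then Ymat (cellCoord α (flowMat c d α)) α ⟨k, by
        have := Fin.lt_def.1 h
        simp only [α, PosRoot.rk]; omega⟩ l else 0) else 0) (by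
          intro k hk
          have := Fin.lt_def.1 hk
          simp only [α] at this
          rw [if_neg (by omega)])
    rw [← h2]
    refine Finset.sum_congr rfl fun k _ => ?_
    have hk : rowIdx α k < l := rowIdx_lt α k le_rfl
    rw [dif_pos hk]
    by_cases hks : (rowIdx α k : ℕ) ≤ s
    · rw [if_pos hks]
      rfl
    · rw [if_neg hks]
      have : (flowMat c d α) ⟨s, by simp only [α, PosRoot.rk]; omega⟩ (rowIdx α k) = 0 :=
        flowMat_eq_zero (by simpa using hks) hk
      rw [Matrix.submatrix_apply, id, this, zero_mul]
  choose y hy using hcol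
  -- The coordinates depend only on the row and the column, so one `x` serves every `α`; only the
  -- scalar, the leading minor, varies.
  refine ⟨fun γ => y γ.t γ.s,
    fun α => ((flowMat c d α).submatrix id (rowIdx α)).det, fun α q => ?_⟩
  rw [aeval_cellMinor]
  refine det_submatrix_of_eq_mul ?_ q
  ext k l
  rw [Matrix.mul_apply]
  by_cases h1 : l ≤ α.s
  · obtain ⟨j, rfl⟩ := exists_rowIdx α h1
    rw [Finset.sum_eq_single j]
    · rw [Ymat_of_le _ _ _ h1, if_pos rfl, mul_one, Matrix.submatrix_apply, id]
    · intro i _ hi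
      rw [Ymat_of_le _ _ _ h1, if_neg fun h => hi (rowIdx_injective α h), mul_zero]
    · simp
  by_cases h2 : α.t ≤ l
  · have hk := Fin.le_def.1 (rowIdx_le α k)
    have ht := Fin.le_def.1 h2
    have hst : (α.s : ℕ) < (α.t : ℕ) := Fin.lt_def.1 α.2
    have htn : (α.t : ℕ) < n := α.t.2
    change (k : ℕ) ≤ (α.s : ℕ) at hk
    have h3 := flow_eq_sum (hy l) (r := n - α.t) (by omega) (s := k) (by omega)
    refine h3.trans ?_
    rw [← sum_rowIdx (α := α)]
    · refine Finset.sum_congr rfl fun j _ => ?_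
      rw [Ymat_of_ge _ _ _ h2]
      by_cases hjk : (rowIdx α j : ℕ) ≤ k
      · rw [if_pos hjk]; rfl
      · rw [if_neg hjk, Matrix.submatrix_apply, id,
          flowMat_eq_zero (not_le.1 hjk) (rowIdx_lt α j le_rfl), zero_mul]
    · intro j hj
      have := Fin.lt_def.1 hj
      rw [if_neg (by omega)]
  · rw [hallow α k l (fun h => h.elim h1 h2)]
    symm
    refine Finset.sum_eq_zero fun j _ => ?_
    rw [Ymat_of_not_allowed _ _ _ (fun h => h.elim h1 h2), mul_zero]

/-- A polynomial which vanishes on the open cell vanishes at the minors of `flowMat`, for all values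
of the parameters. -/
theorem eval_flowMat_eq_zero {m : PosRoot n → ℕ} {F : CX n} (hF : F ∈ CXpiece m)
    (h0 : toCell n F = 0) (c : ℕ → ℕ → ℕ → ℂ) (d : ℕ → ℕ → ℂ) :
    eval (fun k : PlIdx n => ((flowMat c d k.1).submatrix id k.2.seq).det) F = 0 := by
  -- A line in parameter space: the given parameters at `z = 0`, and at `z = 1` those for which
  -- every `flow` vector is a standard basis vector, where all leading minors equal `1`.
  let c' : ℕ → ℕ → ℕ → Polynomial ℂ := fun r s k =>
    (1 - Polynomial.X) * Polynomial.C (c r s k) + Polynomial.X * (if k = s then 1 else 0)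
  let d' : ℕ → ℕ → Polynomial ℂ := fun r s => (1 - Polynomial.X) * Polynomial.C (d r s)
  let cz : ℂ → ℕ → ℕ → ℕ → ℂ := fun z r s k => (1 - z) * c r s k + z * (if k = s then 1 else 0)
  let dz : ℂ → ℕ → ℕ → ℂ := fun z r s => (1 - z) * d r s
  have hev : ∀ (z : ℂ) (α : PosRoot n) (q : Fin α.rk → Fin n),
      Polynomial.evalRingHom z ((flowMat c' d' α).submatrix id q).det =
        ((flowMat (cz z) (dz z) α).submatrix id q).det := by
    intro z α q
    rw [RingHom.map_det]
    congr 1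
    ext k l
    simp only [RingHom.mapMatrix_apply, Matrix.map_apply, Matrix.submatrix_apply, id, flowMat,
      Matrix.of_apply, map_flow]
    congr 1
    · funext r s k
      simp [c', cz, apply_ite (Polynomial.eval z)]
    · funext r s
      simp [d', dz]
  let H : Polynomial ℂ :=
    aeval (fun k : PlIdx n => ((flowMat c' d' k.1).submatrix id k.2.seq).det) F
  have hH : ∀ z, H.eval z =
      eval (fun k : PlIdx n => ((flowMat (cz z) (dz z) k.1).submatrix id k.2.seq).det) F := by
    intro z
    have h1 : H.eval z = (Polynomial.aeval z) H := by simp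
    rw [h1, ← coe_aeval_eq_eval]
    change Polynomial.aeval z (aeval _ F) = aeval _ F
    rw [← AlgHom.comp_apply, comp_aeval]
    congr 2
    funext k
    rw [← hev]
    simp
  have hH0 : H = 0 := by
    refine polynomial_eq_zero_of_generic
      (T := ∏ α : PosRoot n, ((flowMat c' d' α).submatrix id (rowIdx α)).det) ?_ ?_
    · intro z hz
      rw [← Polynomial.coe_evalRingHom, map_prod] at hz
      simp only [hev] at hz
      obtain ⟨x, t, hx⟩ :=
        exists_flowMat_eq fun α => Finset.prod_ne_zero_iff.1 hz α (Finset.mem_univ α)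
      rw [hH]
      simp only [hx]
      rw [eval_scale hF t fun k => aeval x (cellMinor k.1 k.2.seq)]
      have h1 := congrArg (aeval x) h0
      rw [toCell, map_zero, ← AlgHom.comp_apply, comp_aeval] at h1
      rw [← coe_aeval_eq_eval]
      change _ * aeval _ F = 0
      rw [h1, mul_zero]
    · rw [← Polynomial.coe_evalRingHom, map_prod]
      simp only [hev]
      refine Finset.prod_ne_zero_iff.2 fun α _ => ?_
      have e1 : cz 1 = fun _ s k => if k = s then 1 else 0 := by
        funext r s k; simp [cz]
      have e2 : dz 1 = fun _ _ => 0 := by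
        funext r s; simp [dz]
      rw [e1, e2]
      convert one_ne_zero (α := ℂ)
      convert Matrix.det_one (n := Fin α.rk) (R := ℂ)
      ext a b
      simp only [flowMat, Matrix.submatrix_apply, Matrix.of_apply, flow_one, stdVec, id,
        Matrix.one_apply]
      exact if_congr (by simp [rowIdx, Fin.ext_iff, eq_comm]) rfl rfl
  have h1 := hH 0
  rw [hH0, Polynomial.eval_zero] at h1
  have e1 : cz 0 = c := by funext r s k; simp [cz]
  have e2 : dz 0 = d := by funext r s; simp [dz]
  rw [e1, e2] at h1
  exact h1.symm

/-! ### Parametrization of all points of `R_n` by `flow` -/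

theorem exists_eq_sup_span {E : Type*} [AddCommGroup E] [Module ℂ E] {P U : Submodule ℂ E}
    [FiniteDimensional ℂ U] (h : P ≤ U) (hd : Module.finrank ℂ U = Module.finrank ℂ P + 1) :
    ∃ v, U = P ⊔ Submodule.span ℂ {v} := by
  have hlt : P < U := lt_of_le_of_ne h fun he => by rw [he] at hd; omega
  obtain ⟨v, hvU, hvP⟩ := SetLike.exists_of_lt hlt
  have hle : P ⊔ Submodule.span ℂ {v} ≤ U :=
    sup_le h ((Submodule.span_singleton_le_iff_mem _ _).2 hvU)
  have hlt' : P < P ⊔ Submodule.span ℂ {v} := lt_of_le_of_ne le_sup_left fun he => hvP (by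
    rw [he]; exact Submodule.mem_sup_right (Submodule.mem_span_singleton_self v))
  have : FiniteDimensional ℂ ↥(P ⊔ Submodule.span ℂ {v}) := Submodule.finiteDimensional_of_le hle
  have := Submodule.finrank_lt_finrank_of_lt hlt'
  exact ⟨v, (Submodule.eq_of_le_of_finrank_le hle (by omega)).symm⟩

/-- A basis vector for the root `(s, n - r)`, or the standard basis vector. -/
def extVec (v : PosRoot n → Fin n → ℂ) (r s : ℕ) : Fin n → ℂ :=
  if h : s < n - r ∧ 0 < r then
    v ⟨(⟨s, by omega⟩, ⟨n - r, by omega⟩), Fin.lt_def.2 h.1⟩ else stdVec n ℂ s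

theorem extVec_root (v : PosRoot n → Fin n → ℂ) (α : PosRoot n) :
    extVec v (n - α.t) α.s = v α := by
  have h1 : (α.s : ℕ) < (α.t : ℕ) := Fin.lt_def.1 α.2
  have h2 : (α.t : ℕ) < n := α.t.2
  rw [extVec, dif_pos ⟨by omega, by omega⟩]
  congr 1
  refine Subtype.ext (Prod.ext (Fin.ext rfl) (Fin.ext ?_))
  change n - (n - (α.t : ℕ)) = α.t
  omega

theorem extVec_zero (v : PosRoot n → Fin n → ℂ) (s : ℕ) : extVec v 0 s = stdVec n ℂ s :=
  dif_neg (by omega)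

/-- For fixed `j` the spaces `V_{1,j} ⊆ V_{2,j} ⊆ ⋯` grow by one dimension at a time, so a basis
adapted to the whole chain can be chosen one vector per root. -/
theorem IsRPoint.exists_extVec {V : PosRoot n → Submodule ℂ (Fin n → ℂ)} (hV : IsRPoint V) :
    ∃ v : PosRoot n → Fin n → ℂ, ∀ α, V α =
      Submodule.span ℂ (extVec v (n - α.t) '' (Finset.range (α.s + 1) : Set ℕ)) := by
  have step : ∀ α : PosRoot n, ∃ v, ((α.s : ℕ) = 0 ∧ V α = ⊥ ⊔ Submodule.span ℂ {v}) ∨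
      ∃ γ : PosRoot n, (α.s : ℕ) = γ.s + 1 ∧ α.t = γ.t ∧ V α = V γ ⊔ Submodule.span ℂ {v} := by
    intro α
    rcases Nat.eq_zero_or_pos (α.s : ℕ) with h | h
    · obtain ⟨v, hv⟩ := exists_eq_sup_span (P := ⊥) (U := V α) bot_le (by
        rw [hV.finrank_eq, finrank_bot, PosRoot.rk, h])
      exact ⟨v, Or.inl ⟨h, hv⟩⟩
    · have h1 : (α.s : ℕ) < (α.t : ℕ) := Fin.lt_def.1 α.2
      have h2 : (α.t : ℕ) < n := α.t.2
      let γ : PosRoot n := ⟨(⟨α.s - 1, by omega⟩, α.t),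
        Fin.lt_def.2 (by change (α.s : ℕ) - 1 < α.t; omega)⟩
      have hγ : (α.s : ℕ) = γ.s + 1 := by change (α.s : ℕ) = α.s - 1 + 1; omega
      obtain ⟨v, hv⟩ := exists_eq_sup_span (hV.le_succ γ α hγ rfl) (by
        rw [hV.finrank_eq, hV.finrank_eq, PosRoot.rk, hγ])
      exact ⟨v, Or.inr ⟨γ, hγ, rfl, hv⟩⟩
  choose v hv using step
  refine ⟨v, ?_⟩
  suffices h : ∀ (N : ℕ) (α : PosRoot n), (α.s : ℕ) = N → V α =
      Submodule.span ℂ (extVec v (n - α.t) '' (Finset.range (α.s + 1) : Set ℕ)) from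
    fun α => h _ α rfl
  intro N
  induction N with
  | zero =>
    intro α hα
    obtain ⟨-, h⟩ | ⟨γ, h, -⟩ := hv α
    · rw [Finset.range_add_one, Finset.coe_insert, Set.image_insert_eq, extVec_root, h, hα]
      simp
    · omega
  | succ N ih =>
    intro α hα
    obtain ⟨h, -⟩ | ⟨γ, h, ht, h'⟩ := hv α
    · omega
    · rw [Finset.range_add_one, Finset.coe_insert, Set.image_insert_eq, extVec_root, h',
        Submodule.span_insert, sup_comm, ih γ (by omega), h, ht]

theorem add_pr (k : Fin n) (w : Fin n → ℂ) : w = pr k w + w k • stdVec n ℂ k := by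
  funext l
  by_cases h : l = k
  · subst h; simp [pr, stdVec]
  · have : (l : ℕ) ≠ k := fun h' => h (Fin.ext h')
    simp [pr, stdVec, h, this]

/-- The recursion of `flow` is the inclusion `pr_{j+1} V_{i,j} ⊆ V_{i,j+1}` written in adapted
bases: an adapted vector equals a combination of vectors one level below plus a multiple of
`w_{j+1}`. -/
theorem IsRPoint.exists_flow {V : PosRoot n → Submodule ℂ (Fin n → ℂ)} (hV : IsRPoint V) :
    ∃ (c : ℕ → ℕ → ℕ → ℂ) (d : ℕ → ℕ → ℂ), ∀ α,
      V α = Submodule.span ℂ (Set.range (flowMat c d α)) := by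
  obtain ⟨v, hv⟩ := hV.exists_extVec
  have hcoef : ∀ r s, ∃ (c : ℕ → ℂ) (d : ℂ), s < n - (r + 1) → extVec v (r + 1) s =
      ∑ k ∈ Finset.range (s + 1), c k • extVec v r k + d • stdVec n ℂ (n - 1 - r) := by
    intro r s
    by_cases hs : s < n - (r + 1)
    swap
    · exact ⟨0, 0, fun h => absurd h hs⟩
    let α : PosRoot n := ⟨(⟨s, by omega⟩, ⟨n - (r + 1), by omega⟩), Fin.lt_def.2 hs⟩
    have hvα : extVec v (r + 1) s = v α := dif_pos ⟨hs, by omega⟩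
    have hmem : v α ∈ V α := by
      rw [hv, ← extVec_root v α]
      exact Submodule.subset_span ⟨_, by simp, rfl⟩
    have hpr : pr α.t (v α) ∈
        Submodule.span ℂ (extVec v r '' (Finset.range (s + 1) : Set ℕ)) := by
      -- For `r = 0`, that is `j = n - 1`, there is no projection condition; the inclusion in
      -- `W_{i,n-1}` shows that killing `w_n` leaves a vector in `span(w_1, …, w_i)`.
      rcases Nat.eq_zero_or_pos r with rfl | hr
      · have hW := mem_W_iff.1 (hV.le_W α hmem)
        rw [pi_eq_sum_univ' (pr α.t (v α))]
        refine Submodule.sum_mem _ fun l _ => ?_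
        by_cases hl : l ≤ α.s
        · refine Submodule.smul_mem _ _ (Submodule.subset_span ⟨l, ?_, ?_⟩)
          · exact Finset.mem_coe.2 (Finset.mem_range.2 (Nat.lt_succ_of_le (Fin.le_def.1 hl)))
          · rw [extVec_zero]
            funext j
            by_cases h : j = l
            · subst h; simp [stdVec]
            · have : (j : ℕ) ≠ l := fun h' => h (Fin.ext h')
              simp [stdVec, h, this]
        · have h0 : pr α.t (v α) l = 0 := by
            by_cases hlt : l = α.t
            · subst hlt; simp [pr]
            · have h1 : ¬ α.Allowed l := by
                rintro (h | h)
                · exact hl h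
                · refine hlt (Fin.ext ?_)
                  have h2 := Fin.le_def.1 h
                  have h3 := l.2
                  change n - (0 + 1) ≤ (l : ℕ) at h2
                  change (l : ℕ) = n - (0 + 1)
                  omega
              simp [pr, hlt, hW l h1]
          rw [h0, zero_smul]
          exact zero_mem _
      · let β : PosRoot n := ⟨(⟨s, by omega⟩, ⟨n - r, by omega⟩),
          Fin.lt_def.2 (by change s < n - r; omega)⟩
        have h1 := hV.pr_le α β rfl (by change n - r = n - (r + 1) + 1; omega)
          (Submodule.mem_map_of_mem hmem)
        rw [hv] at h1
        have h2 : n - (β.t : ℕ) = r := by change n - (n - r) = r; omega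
        rwa [h2] at h1
    obtain ⟨c, hc⟩ := (Submodule.mem_span_image_finset_iff_exists_fun' ℂ).1 hpr
    refine ⟨c, v α α.t, fun _ => ?_⟩
    rw [hvα, hc]
    have h1 : ((α.t : Fin n) : ℕ) = n - 1 - r := by change n - (r + 1) = _; omega
    rw [← h1]
    exact add_pr α.t (v α)
  choose c d hcd using hcoef
  have hflow : ∀ r s, s < n - r → flow n c d r s = extVec v r s := by
    intro r
    induction r with
    | zero => intro s _; rw [extVec_zero]; rfl
    | succ r ih =>
      intro s hs
      rw [hcd r s hs, flow_succ]
      congr 1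
      refine Finset.sum_congr rfl fun k hk => ?_
      rw [ih k (by have := Finset.mem_range.1 hk; omega)]
  refine ⟨c, d, fun α => ?_⟩
  rw [hv]
  congr 1
  have h1 : (α.s : ℕ) < (α.t : ℕ) := Fin.lt_def.1 α.2
  have h2 : (α.t : ℕ) < n := α.t.2
  ext w
  constructor
  · rintro ⟨k, hk, rfl⟩
    have hk' := Finset.mem_range.1 hk
    exact ⟨⟨k, hk'⟩, hflow (n - α.t) k (by omega)⟩
  · rintro ⟨k, rfl⟩
    have hk : (k : ℕ) < α.s + 1 := k.2
    exact ⟨k, Finset.mem_coe.2 (Finset.mem_range.2 hk), (hflow (n - α.t) k (by omega)).symm⟩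

/-- The open cell is dense in `R_n`. -/
theorem vanishesAt_of_toCell_eq_zero {m : PosRoot n → ℕ} {F : CX n} (hF : F ∈ CXpiece m)
    (h0 : toCell n F = 0) {x : (α : PosRoot n) → Projectivization ℂ (ExtW α)} (hx : x ∈ R n) :
    VanishesAt F x := by
  intro u hu hux
  obtain ⟨V, hV, hx⟩ := hx
  obtain ⟨c, d, hB⟩ := hV.exists_flow
  choose t ht using exists_plCoord_eq hV hx hu hux hB
  simp only [ht]
  rw [eval_scale hF t fun k => ((flowMat c d k.1).submatrix id k.2.seq).det,
    eval_flowMat_eq_zero hF h0, mul_zero]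

/-! ### The multi-homogeneous coordinate ring as a ring of functions on the open cell -/

/-- The multi-graded version of the restriction to the open cell. -/
def toGradedCell (n : ℕ) : CX n →ₐ[ℂ] AddMonoidAlgebra (Sn n) (PosRoot n → ℕ) :=
  aeval fun k : PlIdx n => AddMonoidAlgebra.single (varDeg k) (cellMinor k.1 k.2.seq)

theorem actCX_X_mem (β : PosRoot n) (k : PlIdx n) : actCX β (X k) ∈ CXpiece (varDeg k) := by
  rw [actCX, mkDerivation_X]
  split_ifs
  · refine neg_mem (sum_mem fun r _ => ?_)
    split_ifs
    · refine sum_mem fun P _ => ?_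
      rw [← smul_eq_C_mul]
      exact Submodule.smul_mem _ _ (isWeightedHomogeneous_X ℂ varDeg (⟨k.1, P⟩ : PlIdx n))
    · exact zero_mem _
  · exact zero_mem _

theorem exists_monomial_mem (d : PlIdx n →₀ ℕ) (c : ℂ) : ∃ m, monomial d c ∈ CXpiece m ∧
    (∀ β, actCX β (monomial d c) ∈ CXpiece m) ∧
    toGradedCell n (monomial d c) = AddMonoidAlgebra.single m (toCell n (monomial d c)) := by
  refine induction_on_monomial (motive := fun p : CX n => ∃ m, p ∈ CXpiece m ∧
    (∀ β, actCX β p ∈ CXpiece m) ∧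
    toGradedCell n p = AddMonoidAlgebra.single m (toCell n p)) (fun c => ?_) ?_ d c
  · refine ⟨0, isWeightedHomogeneous_C _ _, fun β => ?_, ?_⟩
    · rw [derivation_C]; exact zero_mem _
    · rw [toGradedCell, toCell, algHom_C, algHom_C]
      rfl
  · rintro p k ⟨m, h1, h2, h3⟩
    refine ⟨m + varDeg k, IsWeightedHomogeneous.mul h1 (isWeightedHomogeneous_X ℂ varDeg k),
      fun β => ?_, ?_⟩
    · rw [Derivation.leibniz, smul_eq_mul, smul_eq_mul, mul_comm (X k)]
      exact add_mem (IsWeightedHomogeneous.mul h1 (actCX_X_mem β k))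
        (IsWeightedHomogeneous.mul (h2 β) (isWeightedHomogeneous_X ℂ varDeg k))
    · rw [map_mul, map_mul, h3, toCell_X, toGradedCell, aeval_X,
        AddMonoidAlgebra.single_mul_single]

theorem piece_induction {m : PosRoot n → ℕ} {p : CX n → Prop} (zero : p 0)
    (add : ∀ F G, p F → p G → p (F + G))
    (monomial : ∀ d c, monomial d c ∈ CXpiece m → (∀ β, actCX β (monomial d c) ∈ CXpiece m) →
      toGradedCell n (monomial d c) = AddMonoidAlgebra.single m (toCell n (monomial d c)) →
      p (monomial d c)) {F : CX n} (hF : F ∈ CXpiece m) : p F := by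
  refine IsWeightedHomogeneous.induction_on (R := ℂ) (w := varDeg (n := n)) (m := m)
    (motive := fun F _ => p F) zero (fun F G _ _ => add F G) ?_ hF
  intro d c hd
  by_cases hc : c = 0
  · rw [hc, monomial_zero]; exact zero
  obtain ⟨m', h1, h2, h3⟩ := exists_monomial_mem d c
  obtain rfl := IsWeightedHomogeneous.inj_right (monomial_eq_zero.not.2 hc) h1
    (isWeightedHomogeneous_monomial _ d c hd)
  exact monomial d c h1 h2 h3

theorem actCX_mem {m : PosRoot n → ℕ} {F : CX n} (hF : F ∈ CXpiece m) (β : PosRoot n) :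
    actCX β F ∈ CXpiece m := by
  refine piece_induction (p := fun F => actCX β F ∈ CXpiece m) ?_ ?_ ?_ hF
  · rw [map_zero]; exact zero_mem _
  · intro F G h h'
    rw [map_add]; exact add_mem h h'
  · intro d c _ h _
    exact h β

theorem toGradedCell_of_mem {m : PosRoot n → ℕ} {F : CX n} (hF : F ∈ CXpiece m) :
    toGradedCell n F = AddMonoidAlgebra.single m (toCell n F) := by
  refine piece_induction (p := fun F => toGradedCell n F =
    AddMonoidAlgebra.single m (toCell n F)) ?_ ?_ ?_ hF
  · simp
  · intro F G h h'
    rw [map_add, map_add, h, h', AddMonoidAlgebra.single_add]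
  · intro d c _ _ h
    exact h

/-- Every polynomial is a sum of multi-homogeneous polynomials. -/
theorem CX_induction {p : CX n → Prop} (add : ∀ F G, p F → p G → p (F + G))
    (piece : ∀ m, ∀ F ∈ CXpiece m, p F) (F : CX n) : p F := by
  induction F using MvPolynomial.induction_on' with
  | monomial d c =>
    obtain ⟨m, h, -⟩ := exists_monomial_mem d c
    exact piece m _ h
  | add F G hF hG => exact add F G hF hG

theorem coeff_toGradedCell (F : CX n) (m : PosRoot n → ℕ) :
    (toGradedCell n F).coeff m = toCell n (weightedHomogeneousComponent varDeg m F) := by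
  classical
  induction F using CX_induction with
  | add F G hF hG => rw [map_add, map_add, map_add, ← hF, ← hG]; simp
  | piece m' F hF =>
    rw [toGradedCell_of_mem hF, weightedHomogeneousComponent_of_mem hF,
      AddMonoidAlgebra.coeff_single, Finsupp.single_apply]
    by_cases h : m' = m
    · rw [if_pos h, if_pos h.symm]
    · rw [if_neg h, if_neg fun h' => h h'.symm, map_zero]

/-- One direction uses that the cell lies in `R_n`. The other uses density, applied to each
multi-homogeneous component separately, which is why the grading is recorded in the target. -/
theorem mem_vanishingIdeal_iff {F : CX n} : F ∈ vanishingIdeal n ↔ toGradedCell n F = 0 := by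
  constructor
  · intro hF
    have h : vanishingIdeal n ≤ RingHom.ker (toGradedCell n) := by
      refine Ideal.span_le.2 ?_
      rintro F ⟨⟨m, hm⟩, hF⟩
      change toGradedCell n F = 0
      rw [toGradedCell_of_mem hm, toCell_eq_zero_of_vanishes hF, AddMonoidAlgebra.single_zero]
    exact h hF
  · intro h
    rw [← sum_weightedHomogeneousComponent varDeg F]
    refine finsum_induction (· ∈ vanishingIdeal n) (zero_mem _) (fun _ _ => add_mem) fun m => ?_
    have hm : weightedHomogeneousComponent varDeg m F ∈ CXpiece m :=
      weightedHomogeneousComponent_mem _ _ _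
    refine Ideal.subset_span ⟨⟨m, hm⟩, fun x hx => vanishesAt_of_toCell_eq_zero hm ?_ hx⟩
    rw [← coeff_toGradedCell, h]
    rfl
  

/-- The embedding of `Q_n` into the multi-graded ring of functions on the open cell. -/
def coordEmb (n : ℕ) : Q n →ₐ[ℂ] AddMonoidAlgebra (Sn n) (PosRoot n → ℕ) :=
  Ideal.Quotient.liftₐ (vanishingIdeal n) (toGradedCell n) fun _ h => mem_vanishingIdeal_iff.1 h

theorem coordEmb_toQ (F : CX n) : coordEmb n (toQ n F) = toGradedCell n F := rfl

theorem toQ_surjective : Function.Surjective (toQ n) := Ideal.Quotient.mk_surjective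

theorem coordEmb_injective : Function.Injective (coordEmb n) := by
  refine (injective_iff_map_eq_zero _).2 fun x hx => ?_
  obtain ⟨F, rfl⟩ := toQ_surjective x
  exact Ideal.Quotient.eq_zero_iff_mem.2 (mem_vanishingIdeal_iff.2 hx)

/-- The embedding of `⨁ M_𝐦^*` into the multi-graded ring of functions on the open cell. -/
def dualEmb (n : ℕ) : DualAlg n →ₗ[ℂ] AddMonoidAlgebra (Sn n) (PosRoot n → ℕ) :=
  DirectSum.toModule ℂ _ _ fun m => AddMonoidAlgebra.lsingle m ∘ₗ dualToCell m

theorem dualEmb_lof (m : PosRoot n → ℕ) (φ : MDual m) :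
    dualEmb n (DirectSum.lof ℂ _ (fun m => MDual m) m φ) =
      AddMonoidAlgebra.single m (dualToCell m φ) := by
  rw [dualEmb, DirectSum.toModule_lof]
  rfl

theorem DualAlg_induction {p : DualAlg n → Prop} (zero : p 0)
    (lof : ∀ m φ, p (DirectSum.lof ℂ _ (fun m => MDual m) m φ))
    (add : ∀ x y, p x → p y → p (x + y)) (x : DualAlg n) : p x :=
  DirectSum.induction_on x zero lof add

theorem coeff_dualEmb (x : DualAlg n) (m : PosRoot n → ℕ) :
    (dualEmb n x).coeff m = dualToCell m (x m) := by
  classical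
  induction x using DualAlg_induction with
  | zero => simp
  | lof m' φ =>
    rw [dualEmb_lof, AddMonoidAlgebra.coeff_single, Finsupp.single_apply]
    by_cases h : m' = m
    · subst h
      rw [if_pos rfl]
      exact congrArg _ (DirectSum.lof_apply ℂ m' φ).symm
    · rw [if_neg h]
      have : (DirectSum.lof ℂ _ (fun m => MDual m) m' φ) m = 0 :=
        DFinsupp.single_eq_of_ne (Ne.symm h)
      rw [this, map_zero]
  | add x y hx hy =>
    rw [map_add, DirectSum.add_apply, map_add, ← hx, ← hy]
    rfl

theorem dualEmb_injective : Function.Injective (dualEmb n) := by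
  refine (injective_iff_map_eq_zero _).2 fun x hx => DFinsupp.ext fun m => ?_
  refine dualToCell_injective m ?_
  change dualToCell m (x m) = dualToCell m 0
  rw [← coeff_dualEmb, hx, map_zero]
  rfl

theorem dualEmb_mul (x y : DualAlg n) : dualEmb n (x * y) = dualEmb n x * dualEmb n y := by
  induction x using DualAlg_induction with
  | zero => rw [zero_mul, map_zero, zero_mul]
  | add x x' hx hx' => rw [add_mul, map_add, map_add, hx, hx', add_mul]
  | lof m φ =>
    induction y using DualAlg_induction with
    | zero => rw [mul_zero, map_zero, mul_zero]
    | add x x' hx hx' => rw [mul_add, map_add, map_add, hx, hx', mul_add]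
    | lof m' ψ =>
      have : DirectSum.lof ℂ _ (fun m => MDual m) m φ * DirectSum.lof ℂ _ (fun m => MDual m) m' ψ =
          DirectSum.lof ℂ _ (fun m => MDual m) (m + m') (dualMul φ ψ) :=
        DirectSum.of_mul_of (A := MDual (n := n)) φ ψ
      rw [this, dualEmb_lof, dualEmb_lof, dualEmb_lof, AddMonoidAlgebra.single_mul_single,
        dualToCell_dualMul]

/-- Degree by degree this is `exists_toCell_eq` and `exists_dualToCell_eq`; it identifies the two
algebras inside the common ambient ring. -/
theorem range_dualEmb :
    LinearMap.range (dualEmb n) = LinearMap.range (coordEmb n).toLinearMap := by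
  apply le_antisymm
  · rintro _ ⟨x, rfl⟩
    induction x using DualAlg_induction with
    | zero => rw [map_zero]; exact zero_mem _
    | add x y hx hy => rw [map_add]; exact add_mem hx hy
    | lof m φ =>
      obtain ⟨F, hF, h⟩ := exists_toCell_eq φ
      refine ⟨toQ n F, ?_⟩
      rw [dualEmb_lof, ← h]
      exact toGradedCell_of_mem hF
  · rintro _ ⟨x, rfl⟩
    obtain ⟨F, rfl⟩ := toQ_surjective x
    induction F using CX_induction with
    | add F G hF hG => rw [map_add, map_add]; exact add_mem hF hG
    | piece m F hF =>
      obtain ⟨φ, h⟩ := exists_dualToCell_eq hF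
      refine ⟨DirectSum.lof ℂ _ (fun m => MDual m) m φ, ?_⟩
      rw [dualEmb_lof, h]
      exact (toGradedCell_of_mem hF).symm

/-! ### The isomorphism of graded algebras -/

/-- The isomorphism `Q_n ≃ ⨁ M_𝐦^*`. -/
def coordEquiv (n : ℕ) : Q n ≃ₗ[ℂ] DualAlg n :=
  LinearEquiv.ofInjective (coordEmb n).toLinearMap coordEmb_injective ≪≫ₗ
    LinearEquiv.ofEq _ _ range_dualEmb.symm ≪≫ₗ
      (LinearEquiv.ofInjective (dualEmb n) dualEmb_injective).symm

theorem dualEmb_coordEquiv (x : Q n) : dualEmb n (coordEquiv n x) = coordEmb n x :=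
  congrArg Subtype.val (LinearEquiv.apply_symm_apply
    (LinearEquiv.ofInjective (dualEmb n) dualEmb_injective) _)

theorem coordEquiv_eq_iff {x : Q n} {y : DualAlg n} :
    coordEquiv n x = y ↔ coordEmb n x = dualEmb n y := by
  rw [← dualEmb_coordEquiv, dualEmb_injective.eq_iff]

theorem coordEquiv_mul (x y : Q n) :
    coordEquiv n (x * y) = coordEquiv n x * coordEquiv n y := by
  rw [coordEquiv_eq_iff, dualEmb_mul, dualEmb_coordEquiv, dualEmb_coordEquiv, map_mul]

theorem coordEquiv_toQ {m : PosRoot n → ℕ} {F : CX n} (hF : F ∈ CXpiece m) {φ : MDual m}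
    (h : dualToCell m φ = toCell n F) :
    coordEquiv n (toQ n F) = DirectSum.lof ℂ _ (fun m => MDual m) m φ := by
  rw [coordEquiv_eq_iff, dualEmb_lof, h]
  exact toGradedCell_of_mem hF

theorem map_Qpiece (m : PosRoot n → ℕ) : (Qpiece m).map (coordEquiv n).toLinearMap =
    LinearMap.range (DirectSum.lof ℂ (PosRoot n → ℕ) (fun m => MDual m) m) := by
  apply le_antisymm
  · rintro _ ⟨_, ⟨F, hF, rfl⟩, rfl⟩
    obtain ⟨φ, h⟩ := exists_dualToCell_eq hF
    exact ⟨φ, (coordEquiv_toQ hF h).symm⟩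
  · rintro _ ⟨φ, rfl⟩
    obtain ⟨F, hF, h⟩ := exists_toCell_eq φ
    exact ⟨_, ⟨F, hF, rfl⟩, coordEquiv_toQ hF h.symm⟩

theorem lof_injective (m : PosRoot n → ℕ) :
    Function.Injective (DirectSum.lof ℂ _ (fun m : PosRoot n → ℕ => MDual m) m) :=
  DFinsupp.single_injective

/-- The isomorphism `M_𝐦^* ≃ Q_𝐦`. -/
def pieceEquiv (m : PosRoot n → ℕ) : MDual m ≃ₗ[ℂ] Qpiece m :=
  LinearEquiv.ofInjective _ (lof_injective m) ≪≫ₗ LinearEquiv.ofEq _ _ (map_Qpiece m).symm ≪≫ₗ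
    ((coordEquiv n).submoduleMap (Qpiece m)).symm

theorem coordEquiv_pieceEquiv (m : PosRoot n → ℕ) (φ : MDual m) :
    coordEquiv n (pieceEquiv m φ) = DirectSum.lof ℂ _ (fun m => MDual m) m φ :=
  congrArg Subtype.val
    (LinearEquiv.apply_symm_apply ((coordEquiv n).submoduleMap (Qpiece m)) _)

/-- The decomposition is transported from `⨁ M_𝐦^*`: after identifying each summand by `pieceEquiv`,
the sum map is the inverse of `coordEquiv`. -/
theorem isInternal_Qpiece (n : ℕ) :
    DirectSum.IsInternal (fun m : PosRoot n → ℕ => Qpiece m) := by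
  have h : DirectSum.coeLinearMap (fun m : PosRoot n → ℕ => Qpiece m) ∘ₗ
      DirectSum.lmap (fun m => (pieceEquiv m).toLinearMap) =
        (coordEquiv n).symm.toLinearMap := by
    refine DirectSum.linearMap_ext ℂ fun m => LinearMap.ext fun φ => ?_
    simp only [LinearMap.comp_apply, DirectSum.lmap_lof, DirectSum.coeLinearMap_lof]
    apply (coordEquiv n).injective
    exact (coordEquiv_pieceEquiv m φ).trans ((coordEquiv n).apply_symm_apply _).symm
  have h' : ⇑(DirectSum.coeLinearMap (fun m : PosRoot n → ℕ => Qpiece m)) ∘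
      ⇑(DirectSum.congrLinearEquiv (R := ℂ) pieceEquiv) = ⇑(coordEquiv n).symm := by
    rw [DirectSum.coe_congrLinearEquiv, ← LinearMap.coe_comp, h]
    rfl
  have hb : Function.Bijective (⇑(DirectSum.coeLinearMap (fun m : PosRoot n → ℕ => Qpiece m)) ∘
      ⇑(DirectSum.congrLinearEquiv (R := ℂ) pieceEquiv)) := h' ▸ (coordEquiv n).symm.bijective
  exact (Function.Bijective.of_comp_iff _ (LinearEquiv.bijective _)).1 hb

/-! ### The action of the abelian Lie algebra on `Q_n` -/

/-- The action of `f_β` on `Q_n`. -/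
def actQ (β : PosRoot n) : Module.End ℂ (Q n) :=
  (coordEquiv n).symm.toLinearMap ∘ₗ fDualAlg β ∘ₗ (coordEquiv n).toLinearMap

theorem coordEquiv_actQ (β : PosRoot n) (x : Q n) :
    coordEquiv n (actQ β x) = fDualAlg β (coordEquiv n x) :=
  (coordEquiv n).apply_symm_apply _

theorem fDualAlg_lof (β : PosRoot n) (m : PosRoot n → ℕ) (φ : MDual m) :
    fDualAlg β (DirectSum.lof ℂ _ (fun m => MDual m) m φ) =
      DirectSum.lof ℂ _ (fun m => MDual m) m (fMDual m β φ) :=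
  DirectSum.lmap_lof _ _ _

/-- The transported action is the one induced from `ℂ𝐗_n`, because both are `-∂_β` on the cell. In
particular `actCX` preserves the vanishing ideal. -/
theorem actQ_toQ (β : PosRoot n) (F : CX n) : actQ β (toQ n F) = toQ n (actCX β F) := by
  induction F using CX_induction with
  | add F G hF hG => rw [map_add, map_add, map_add, map_add, hF, hG]
  | piece m F hF =>
    obtain ⟨φ, h⟩ := exists_dualToCell_eq hF
    apply (coordEquiv n).injective
    rw [coordEquiv_actQ, coordEquiv_toQ hF h, fDualAlg_lof,
      coordEquiv_toQ (actCX_mem hF β) (φ := fMDual m β φ)]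
    rw [dualToCell_fMDual, toCell_actCX, h]

theorem actQ_mem (β : PosRoot n) (m : PosRoot n → ℕ) : ∀ x ∈ Qpiece m, actQ β x ∈ Qpiece m := by
  rintro _ ⟨F, hF, rfl⟩
  exact ⟨actCX β F, actCX_mem hF β, (actQ_toQ β F).symm⟩

theorem fMDual_comm (β γ : PosRoot n) {m : PosRoot n → ℕ} (φ : MDual m) :
    fMDual m β (fMDual m γ φ) = fMDual m γ (fMDual m β φ) := by
  apply dualToCell_injective m
  rw [dualToCell_fMDual, dualToCell_fMDual, dualToCell_fMDual, dualToCell_fMDual, map_neg,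
    map_neg, pderiv_comm]

theorem commute_actQ (β γ : PosRoot n) : Commute (actQ β) (actQ γ) := by
  refine LinearMap.ext fun x => (coordEquiv n).injective ?_
  simp only [Module.End.mul_apply, coordEquiv_actQ]
  induction coordEquiv n x using DualAlg_induction with
  | zero => simp
  | add x y hx hy => simp only [map_add, hx, hy]
  | lof m φ =>
    rw [fDualAlg_lof, fDualAlg_lof, fDualAlg_lof, fDualAlg_lof, fMDual_comm]

theorem actQ_pieceEquiv (β : PosRoot n) (m : PosRoot n → ℕ) (φ : MDual m) :
    actQ β (pieceEquiv m φ) = pieceEquiv m (fMDual m β φ) := by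
  apply (coordEquiv n).injective
  rw [coordEquiv_actQ, coordEquiv_pieceEquiv, coordEquiv_pieceEquiv, fDualAlg_lof]

/-! ### Cocyclicity and the dual of `Q_𝐦` -/

theorem prod_X_topSet_mem (m : PosRoot n → ℕ) :
    (∏ α, (X ⟨α, topSet α⟩ : CX n) ^ m α) ∈ CXpiece m := by
  have h := IsWeightedHomogeneous.prod (R := ℂ) (w := varDeg (n := n)) Finset.univ
    (fun α => (X ⟨α, topSet α⟩ : CX n) ^ m α) (fun α => m α • varDeg (⟨α, topSet α⟩ : PlIdx n))
    fun α _ => (isWeightedHomogeneous_X ℂ varDeg _).pow (m α)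
  have hm : ∑ α, m α • varDeg (⟨α, topSet α⟩ : PlIdx n) = m := by
    funext β
    simp [varDeg, Finset.sum_apply, Pi.single_apply]
  rwa [hm] at h

theorem toCell_prod_X_topSet (m : PosRoot n → ℕ) :
    toCell n (∏ α, (X ⟨α, topSet α⟩ : CX n) ^ m α) = 1 := by
  rw [map_prod]
  refine Finset.prod_eq_one fun α _ => ?_
  rw [map_pow, toCell_X, PlSet.seq_topSet, cellMinor_rowIdx, one_pow]

theorem vStar_mem (m : PosRoot n → ℕ) : vStar m ∈ Qpiece m := ⟨_, prod_X_topSet_mem m, rfl⟩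

theorem coordEmb_vStar (m : PosRoot n → ℕ) :
    coordEmb n (vStar m) = AddMonoidAlgebra.single m 1 := by
  rw [vStar, coordEmb_toQ, toGradedCell_of_mem (prod_X_topSet_mem m), toCell_prod_X_topSet]

theorem vStar_ne_zero (m : PosRoot n → ℕ) : vStar m ≠ 0 := by
  intro h
  have := coordEmb_vStar m
  rw [h, map_zero] at this
  exact one_ne_zero (AddMonoidAlgebra.single_eq_zero.1 this.symm)

theorem coordEmb_pieceEquiv (m : PosRoot n → ℕ) (φ : MDual m) :
    coordEmb n (pieceEquiv m φ) = AddMonoidAlgebra.single m (dualToCell m φ) := by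
  rw [← dualEmb_coordEquiv, coordEquiv_pieceEquiv, dualEmb_lof]

/-- Induction on the total degree of the representing polynomial: if some `∂_β` does not kill it,
applying `f_β` lowers the degree and keeps the vector nonzero; otherwise it is a nonzero constant, a
multiple of `v_𝐦^*`. -/
theorem exists_apply_eq_vStar {m : PosRoot n → ℕ} {x : Q n} (hx : x ∈ Qpiece m) (h0 : x ≠ 0) :
    ∃ T ∈ Algebra.adjoin ℂ (Set.range (actQ (n := n))), T x = vStar m := by
  obtain ⟨φ, hφ⟩ := (pieceEquiv m).surjective ⟨x, hx⟩
  obtain rfl : x = pieceEquiv m φ := by rw [hφ]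
  clear hφ
  have h0' : φ ≠ 0 := by rintro rfl; exact h0 (by rw [map_zero]; rfl)
  clear h0 hx
  induction h : (dualToCell m φ).totalDegree using Nat.strong_induction_on generalizing φ with
  | _ N ih =>
  by_cases hd : ∀ β, pderiv β (dualToCell m φ) = 0
  · have hC := eq_C_of_pderiv hd
    set c := constantCoeff (dualToCell m φ) with hc
    have hc0 : c ≠ 0 := by
      intro h0
      rw [h0, map_zero] at hC
      exact h0' (dualToCell_injective m (hC.trans (map_zero _).symm))
    refine ⟨algebraMap ℂ _ c⁻¹, Subalgebra.algebraMap_mem _ _, coordEmb_injective ?_⟩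
    rw [Module.algebraMap_end_apply, map_smul, coordEmb_pieceEquiv, coordEmb_vStar, hC,
      AddMonoidAlgebra.smul_single, smul_eq_C_mul, ← C_mul, inv_mul_cancel₀ hc0, C_1]
  · push Not at hd
    obtain ⟨β, hβ⟩ := hd
    have hlt := totalDegree_pderiv_lt hβ
    obtain ⟨T, hT, hTx⟩ := ih _ (h ▸ hlt) (fMDual m β φ) (fun h' => hβ (by
      have := dualToCell_fMDual (m := m) β φ
      rw [h', map_zero] at this
      exact neg_eq_zero.1 this.symm)) (by rw [dualToCell_fMDual, totalDegree_neg])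
    refine ⟨T * actQ β, mul_mem hT (Algebra.subset_adjoin ⟨β, rfl⟩), ?_⟩
    rw [Module.End.mul_apply, actQ_pieceEquiv, hTx]

/-- The isomorphism `Q_𝐦^* ≃ M_𝐦`. -/
def dualPieceEquiv (m : PosRoot n → ℕ) : Module.Dual ℂ (Qpiece m) ≃ₗ[ℂ] M m :=
  (pieceEquiv m).dualMap ≪≫ₗ (Module.evalEquiv ℂ (M m)).symm

/-- `Q_𝐦^*` is the double dual of the finite-dimensional `M_𝐦`, and the signs of the two successive
dual actions cancel. -/
theorem dualPieceEquiv_actQ (m : PosRoot n → ℕ) (β : PosRoot n)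
    (φ : Module.Dual ℂ (Qpiece m)) :
    dualPieceEquiv m (-(((actQ β).restrict (actQ_mem β m)).dualMap φ)) =
      fM m β (dualPieceEquiv m φ) := by
  have key : ∀ (ψ : MDual m) (φ : Module.Dual ℂ (Qpiece m)),
      ψ (dualPieceEquiv m φ) = φ (pieceEquiv m ψ) := fun ψ φ =>
    LinearMap.congr_fun ((Module.evalEquiv ℂ (M m)).apply_symm_apply _) ψ
  refine (Module.forall_dual_apply_eq_zero_iff ℂ _).1 (fun ψ => ?_) |> sub_eq_zero.1
  have h : (actQ β).restrict (actQ_mem β m) (pieceEquiv m ψ) = pieceEquiv m (fMDual m β ψ) :=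
    Subtype.ext (actQ_pieceEquiv β m ψ)
  have h' : ψ (fM m β (dualPieceEquiv m φ)) = - (fMDual m β ψ) (dualPieceEquiv m φ) := by
    simp [fMDual]
  rw [map_sub, h', key, key, LinearMap.neg_apply, LinearMap.dualMap_apply, h]
  ring

end DegenerateSL

end

open DegenerateSL in
theorem theorem0p1 (n : ℕ) :
    -- the action of the abelian Lie algebra descends from `ℂ𝐗_n` to `Q_n`
    ∃ ρ : PosRoot n → Module.End ℂ (Q n),
      (∀ β F, ρ β (toQ n F) = toQ n (actCX β F)) ∧
      (∀ β γ, Commute (ρ β) (ρ γ)) ∧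
      -- `Q_n` is the direct sum of the spaces `Q_𝐦`, and they are submodules
      DirectSum.IsInternal (fun m : PosRoot n → ℕ => Qpiece m) ∧
      ∃ hρ : ∀ (β : PosRoot n) (m : PosRoot n → ℕ), ∀ x ∈ Qpiece m, ρ β x ∈ Qpiece m,
        -- `Q_𝐦` is cocyclic with cocyclic vector `v_𝐦^*`
        (∀ m : PosRoot n → ℕ, vStar m ∈ Qpiece m ∧ vStar m ≠ 0 ∧
          ∀ x ∈ Qpiece m, x ≠ 0 → ∃ T ∈ Algebra.adjoin ℂ (Set.range ρ), T x = vStar m) ∧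
        -- `Q_𝐦^*` is isomorphic to `M_𝐦`
        (∀ m : PosRoot n → ℕ, ∃ Θ : Module.Dual ℂ (Qpiece m) ≃ₗ[ℂ] M m,
          ∀ (β : PosRoot n) (φ : Module.Dual ℂ (Qpiece m)),
            Θ (-(((ρ β).restrict (hρ β m)).dualMap φ)) = fM m β (Θ φ)) ∧
        -- `Q_n` is isomorphic to `⨁ M_𝐦^*`, as a graded algebra and as a module
        ∃ Φ : Q n ≃ₗ[ℂ] DualAlg n,
          (∀ x y, Φ (x * y) = Φ x * Φ y) ∧
          (∀ m : PosRoot n → ℕ, (Qpiece m).map Φ.toLinearMap =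
            LinearMap.range (DirectSum.lof ℂ (PosRoot n → ℕ) (fun m => MDual m) m)) ∧
          (∀ β x, Φ (ρ β x) = fDualAlg β (Φ x)) :=
  ⟨actQ, actQ_toQ, commute_actQ, isInternal_Qpiece n, actQ_mem,
    fun m => ⟨vStar_mem m, vStar_ne_zero m, fun _ => exists_apply_eq_vStar⟩,
    fun m => ⟨dualPieceEquiv m, dualPieceEquiv_actQ m⟩,
    coordEquiv n, coordEquiv_mul, map_Qpiece, coordEquiv_actQ⟩
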